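/- Setting. Fix $d\ge 1$, $\phi>0$ and constants $C,c>0$. Let $N/M=d$ and let $X=(X_{\alpha i})$ be a real $M\times N$ random matrix with i.i.d. entries having finite moments of all orders and satisfying $\mathbb E X_{\alpha i}=0$, $\mathbb E X_{\alpha i}^2=\frac1N$, $\mathbb E|X_{\alpha i}|^k\le \frac{(Ck)^{ck}}{Nq^{k-2}}$ for all $k\ge3$, where $N^{\phi}\le q\le N^{1/2}$. Let $s^{(4)}:=Nq^2\kappa^{(4)}$, where $\kappa^{(4)}$ is the fourth cumulant of the entries, and for $t\ge 0$ let $q_t:=q\,e^{t/2}$. Put $\lambda_\pm:=(1\pm\frac1{\sqrt d})^2$, $$P_{t,z}(w):=1+\Big(z+1-\frac1d\Big)w+zw^2+\frac{e^{-t}s^{(4)}}{q_t^2}\,w^2\Big(zw+1-\frac1d\Big)^2 ,$$ and $\mathcal E:=\{E+i\eta:\ a\le E\le\lambda_++1,\ 0<\eta<3\}$ with $a=\lambda_- /2$ if $d>1$ and $a=\frac1{10}$ if $d=1$. Let $R:=6\lambda_+/\lambda_-$ if $d>1$ and $R:=10$ if $d=1$. There are $N_0$ and $K\ge1$, depending only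 on $d,\phi,C,c$, such that the following holds for all $N\ge N_0$, all such $M,q,X$ and all $t\ge0$. Here $a\sim b$ means $K^{-1}b\le a\le Kb$, and $O(b)$ denotes a quantity of absolute value at most $Kb$; so the estimates are uniform in $N$, $t$, $X$ and in $z\in\mathcal E$ (resp. in $E$). For every $z=E+i\eta\in\mathcal E$ the equation $P_{t,z}(w_t)=0$ has a unique solution $w_t=w_t(z)$ with $\operatorname{Im}w_t>0$ and $|w_t|\le R$. Moreover, there are a probability measure $\widetilde\rho_t$ on $\mathbb R$ and numbers $0\le L_t^-\le L_t$ such that: 1. $w_t$ extends analytically from $\mathcal E$ to $\mathbb C^+=\{\operatorname{Im}z>0\}$, and the extension is the Stieltjes transform $\int\frac{\widetilde\rho_t(dx)}{x-z}$ of $\widetilde\rho_t$. 2. $\widetilde\rho_t$ is supported on $\{0\}\cup[L_t^-,L_t]$. If $s^{(4)}\ge0$, then $L_t\ge\lambda_+$. On $[L_t-\frac1{\sqrt d},L_t]$ the measure $\widetilde\rho_t$ has a density, also denoted $\widetilde\rho_t$, with $\widetilde\rho_t(E)\sim\sqrt{L_t-E}$ there. Moreover, $$L_t=\Big(1+\frac1{\sqrt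 d}\Big)^2+\frac1{\sqrt d}\Big(1+\frac1{\sqrt d}\Big)^2e^{-t}q_t^{-2}s^{(4)}+O\big(e^{-2t}q_t^{-4}\big).$$ 3. With $\varkappa_t(E):=\min\{|E-L_t^-|,|E-L_t|\}$, for all $z=E+i\eta\in\mathcal E$, $$|P_{t,z}'(w_t)|\sim\sqrt{\varkappa_t(E)+\eta},$$ where $P'_{t,z}$ is the derivative in $w$, and $$\operatorname{Im}w_t(z)\sim\frac{\eta}{\sqrt{\varkappa_t(E)+\eta}}\ \text{ if }E>L_t,\qquad \operatorname{Im}w_t(z)\sim\sqrt{\varkappa_t(E)+\eta}\ \text{ if }L_t-\tfrac1{\sqrt d}\le E\le L_t,$$ $$\operatorname{Im}w_t(z)=O(1)\ \text{ if }E<L_t-\tfrac1{\sqrt d}.$$ -/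

import Mathlib

open MeasureTheory ProbabilityTheory

noncomputable section

namespace SparseCov

/-- The upper edge `(1 + 1/√d)²` of the Marchenko-Pastur law. -/
def lamPlus (d : ℝ) : ℝ := (1 + 1 / Real.sqrt d) ^ 2

/-- The lower edge `(1 - 1/√d)²` of the Marchenko-Pastur law. -/
def lamMinus (d : ℝ) : ℝ := (1 - 1 / Real.sqrt d) ^ 2

/-- The spectral domain: `E` between `λ₋/2` (or `1/10` if `d = 1`) and `λ₊ + 1`, `0 < η < 3`. -/
def domainE (d : ℝ) : Set ℂ :=
  {z : ℂ | (if 1 < d then lamMinus d / 2 else 1 / 10) ≤ z.re ∧ z.re ≤ lamPlus d + 1 ∧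
    0 < z.im ∧ z.im < 3}

/-- The a priori bound on the solution: `6 λ₊/λ₋` if `d > 1`. For `d = 1`, where `λ₋ = 0`,
it is `10`. -/
def solBound (d : ℝ) : ℝ := if 1 < d then 6 * lamPlus d / lamMinus d else 10

/-- The fourth cumulant of a random variable, in terms of its moments. -/
def fourthCumulant {Ω : Type*} [MeasurableSpace Ω] (P : Measure Ω) (Y : Ω → ℝ) : ℝ :=
  (∫ ω, Y ω ^ 4 ∂P) - 4 * (∫ ω, Y ω ^ 3 ∂P) * (∫ ω, Y ω ∂P) - 3 * (∫ ω, Y ω ^ 2 ∂P) ^ 2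
    + 12 * (∫ ω, Y ω ^ 2 ∂P) * (∫ ω, Y ω ∂P) ^ 2 - 6 * (∫ ω, Y ω ∂P) ^ 4

/-- The normalized fourth cumulant `s⁽⁴⁾ = N q² κ⁽⁴⁾`. -/
def normFourthCumulant {Ω : Type*} [MeasurableSpace Ω] (P : Measure Ω) (N : ℕ) (q : ℝ)
    (Y : Ω → ℝ) : ℝ :=
  N * q ^ 2 * fourthCumulant P Y

/-- A sparse random `M × N` matrix with i.i.d. real entries: centered, of variance `1/N`, with
`𝔼|X|^k ≤ (Ck)^(ck) / (N q^(k-2))` for `k ≥ 3`, and sparsity parameter `N^φ ≤ q ≤ N^(1/2)`. -/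
structure IsSparseMatrix {Ω : Type*} [MeasurableSpace Ω] (P : Measure Ω) (M N : ℕ)
    (φ C c q : ℝ) (X : Fin M → Fin N → Ω → ℝ) : Prop where
  indep : iIndepFun (fun p : Fin M × Fin N => X p.1 p.2) P
  ident : ∀ α i β j, IdentDistrib (X α i) (X β j) P P
  memLp : ∀ α i, ∀ k : ℕ, MemLp (X α i) k P
  mean : ∀ α i, ∫ ω, X α i ω ∂P = 0
  variance : ∀ α i, ∫ ω, X α i ω ^ 2 ∂P = 1 / N
  moments : ∀ α i, ∀ k : ℕ, 3 ≤ k →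
    ∫ ω, |X α i ω| ^ k ∂P ≤ (C * k) ^ (c * k) / (N * q ^ (k - 2))
  sparsity_lower : (N : ℝ) ^ φ ≤ q
  sparsity_upper : q ≤ (N : ℝ) ^ (1 / 2 : ℝ)

/-- The time-dependent sparsity parameter `q_t = q e^{t/2}`. -/
def qt (q t : ℝ) : ℝ := q * Real.exp (t / 2)

/-- The coefficient `e^{-t} s⁽⁴⁾ / q_t²` of the sparsity correction. -/
def corr (s q t : ℝ) : ℝ := Real.exp (-t) * s / qt q t ^ 2

/-- The quartic polynomial `P_{t,z}(w)`, as a function of `w`; `s` stands for `s⁽⁴⁾`. -/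
def quartic (d s q t : ℝ) (z w : ℂ) : ℂ :=
  1 + (z + 1 - 1 / (d : ℂ)) * w + z * w ^ 2
    + (corr s q t : ℂ) * w ^ 2 * (z * w + 1 - 1 / (d : ℂ)) ^ 2

/-- `w` solves `P_{t,z}(w) = 0`, lies in the upper half-plane and obeys the a priori bound. -/
def IsSolution (d s q t : ℝ) (z w : ℂ) : Prop :=
  quartic d s q t z w = 0 ∧ 0 < w.im ∧ ‖w‖ ≤ solBound d

/-- The Stieltjes transform `∫ ρ(dx) / (x - z)`. -/
def stieltjes (ρ : Measure ℝ) (z : ℂ) : ℂ := ∫ x : ℝ, 1 / ((x : ℂ) - z) ∂ρ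

/-- `a ∼ b` with constant `K`, for nonnegative `a` and `b`. -/
def Comparable (K a b : ℝ) : Prop := K⁻¹ * b ≤ a ∧ a ≤ K * b

/-- The distance of `E` to the nearer one of the two edges `Lm` and `L`. -/
def edgeDist (Lm L E : ℝ) : ℝ := min |E - Lm| |E - L|

end SparseCov

end

/-!
With `r = 1/√d` and `ε = corr s q t`, the quartic equation is solved by an explicit
parametrization. For a solution `w` put `u = w (z w + 1 - r²)`. The equation becomes
`z w + 1 - r² = -(r² + u + ε u²)`, so that `w = -u / (r² + u + ε u²)` and
`u z = (r² + u + ε u²) (1 + u + ε u²)`. Substituting `u = r v` and `z = 1 + r² + r Z` turns this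
into `Z = J(v)` for the perturbed Joukowski map `J(v) = v⁻¹ + (1 + α) v + β v² + κ v³` with
`α = ε (1 + r²)`, `β = 2 ε r`, `κ = ε² r²`. For `ε = 0` this is the Joukowski map behind the
Marchenko-Pastur law, and everything rests on the fact that a small perturbation keeps its features.

* *Solution.* `J` maps a region of the lower half-plane, close to the lower half of the unit disc,
  bijectively onto the closed upper half-plane. It is injective because its divided differences do
  not vanish (`dividedDiff_ne_zero`, `jouk_injOn`) and surjective because the image is open and
  closed in the upper half-plane (`exists_jouk_eq_of_im_pos`). The inverse gives the solution
  `mSol`, and the same divided differences give uniqueness (`quarticP_unique`).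
* *Measure.* The solution plus `(1 - r²)/z` is holomorphic in the upper half-plane, continuous up
  to the boundary away from `0`, of order `|z|⁻¹` at infinity, and at worst of order `|z|^(-1/2)`
  at `0`. Stieltjes inversion (`integral_boundary_im_div`) represents it by the density
  `specDensity`, and the term `-(1 - r²)/z` is the atom of `specMeasure` at `0`.
* *Edges.* The edges are the values at the critical points `a` near `1` and `c` near `-1` of `J`.
  Since `v (J(v) - J(a)) = (v - a)² (1 + O(ε))` (`IsCrit.jouk_sub`), the distance of `z` to the
  upper edge is comparable to `|v - a|²`. Evaluating at `v = 1` expands the edge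
  (`EdgePair.upper_expansion`). The imaginary part of `J` then yields the size of `Im v`
  (`im_uInv_inside`, `im_uInv_outside`), and with it the square-root decay of the density.
* *Derivative.* Differentiating the quartic at the solution gives `-r v J'(v)`
  (`deriv_quarticP_mSol`), and `v² J'(v) = (v - a) (v - c) (1 + O(ε))`, so that `|v J'(v)|²` is
  comparable to the product of the distances to the two edges (`joukCrit_sq_comparable`).

Randomness enters only through the bound on the fourth cumulant, which makes `ε = O(N^(-2φ))`
smaller than any constant depending on `d` (`abs_normFourthCumulant_le`).
-/

namespace SparseCov

open Complex Filter Topology Set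

/-! ### The perturbed Joukowski map -/

/-- The perturbed Joukowski map `v⁻¹ + (1 + α) v + β v² + κ v³`, with the value `0` at `v = 0`
coming from the convention `0⁻¹ = 0`. -/
noncomputable def jouk (α β κ : ℝ) (v : ℂ) : ℂ :=
  v⁻¹ + (1 + α) * v + β * v ^ 2 + κ * v ^ 3

/-- The polynomial equal to `v * jouk v` for `v ≠ 0`. The equation `jouk v = Z` is used in the form
`v * Z = joukNum v`, which is meaningful for all `v` and rules out `v = 0`. -/
noncomputable def joukNum (α β κ : ℝ) (v : ℂ) : ℂ :=
  1 + (1 + α) * v ^ 2 + β * v ^ 3 + κ * v ^ 4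

/-- The factor `C(v)` in `Im (jouk v) = Im v * (C(v) - |v|⁻²)`. -/
def joukSlope (α β κ : ℝ) (v : ℂ) : ℝ :=
  1 + α + 2 * β * v.re + κ * (3 * v.re ^ 2 - v.im ^ 2)

/-- The closed region in the lower half-plane on which the perturbed Joukowski map inverts onto the
closed upper half-plane. The condition `|v|² C(v) ≤ 1` says that `jouk v` has nonnegative imaginary
part; it is written without division, so that the region is compact and contains `0`. -/
def lowerDom (α β κ : ℝ) : Set ℂ :=
  {v | v.im ≤ 0 ∧ ‖v‖ ≤ 2 ∧ normSq v * joukSlope α β κ v ≤ 1}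

/-- The three coefficients of the perturbation are at most `e` in absolute value. -/
structure SmallCoeffs (e α β κ : ℝ) : Prop where
  a : |α| ≤ e
  b : |β| ≤ e
  k : |κ| ≤ e

lemma SmallCoeffs.nonneg {e α β κ : ℝ} (h : SmallCoeffs e α β κ) : 0 ≤ e :=
  (abs_nonneg _).trans h.a

variable {e α β κ : ℝ}

lemma joukNum_eq {v : ℂ} (hv : v ≠ 0) : v * jouk α β κ v = joukNum α β κ v := by
  unfold jouk joukNum
  field_simp

lemma jouk_eq_iff {v Z : ℂ} (hv : v ≠ 0) : jouk α β κ v = Z ↔ v * Z = joukNum α β κ v := by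
  rw [← joukNum_eq hv]
  exact ⟨fun h => by rw [h], fun h => (mul_left_cancel₀ hv h).symm⟩

lemma ne_zero_of_joukNum {v Z : ℂ} (h : v * Z = joukNum α β κ v) : v ≠ 0 := by
  rintro rfl
  simp [joukNum] at h

lemma jouk_im (v : ℂ) :
    (jouk α β κ v).im = v.im * (joukSlope α β κ v - (normSq v)⁻¹) := by
  have h : ((v : ℂ)⁻¹).im = -v.im * (normSq v)⁻¹ := by
    rw [inv_im, div_eq_mul_inv]
  simp only [jouk, add_im, h, joukSlope, pow_succ, pow_zero, one_mul, mul_im, mul_re, ofReal_re,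
    ofReal_im, add_re, one_re, one_im]
  ring

lemma jouk_re {v : ℂ} :
    (jouk α β κ v).re = v.re * (normSq v)⁻¹ + (1 + α) * v.re + β * (v.re ^ 2 - v.im ^ 2)
      + κ * (v.re ^ 3 - 3 * v.re * v.im ^ 2) := by
  have h : ((v : ℂ)⁻¹).re = v.re * (normSq v)⁻¹ := by
    rw [inv_re, div_eq_mul_inv]
  simp only [jouk, add_re, h, pow_succ, pow_zero, one_mul, mul_im, mul_re, ofReal_re,
    ofReal_im, add_im, one_re, one_im]
  ring

lemma jouk_sub {v w : ℂ} (hv : v ≠ 0) (hw : w ≠ 0) :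
    jouk α β κ v - jouk α β κ w =
      (v - w) * (1 + α - 1 / (v * w) + β * (v + w) + κ * (v ^ 2 + v * w + w ^ 2)) := by
  unfold jouk
  field_simp
  ring

lemma jouk_hasStrictDerivAt {v : ℂ} (hv : v ≠ 0) :
    HasStrictDerivAt (jouk α β κ) (1 + α - 1 / (v * v) + β * (v + v)
      + κ * (v ^ 2 + v * v + v ^ 2)) v := by
  have h := (((hasStrictDerivAt_inv hv).add ((hasStrictDerivAt_id v).const_mul (1 + α : ℂ))).add
    (((hasStrictDerivAt_id v).pow 2).const_mul (β : ℂ))).add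
    (((hasStrictDerivAt_id v).pow 3).const_mul (κ : ℂ))
  refine HasStrictDerivAt.congr_deriv (f := jouk α β κ) h ?_
  simp only [id]
  field_simp
  push_cast
  ring

lemma abs_re_im_le {v : ℂ} {V : ℝ} (h : ‖v‖ ≤ V) :
    |v.re| ≤ V ∧ |v.im| ≤ V := ⟨(abs_re_le_norm v).trans h, (abs_im_le_norm v).trans h⟩

/-- The real part `p` of the inverse of `1 + s + i t`, for small `s` and `t`. -/
lemma re_inv_bounds {s t p : ℝ} (hs1 : -0.06 ≤ s) (hs2 : s ≤ 0.06) (ht1 : -0.06 ≤ t)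
    (ht2 : t ≤ 0.06) (h : p * ((1 + s) ^ 2 + t ^ 2) = 1 + s) : 0.8 ≤ p ∧ p ≤ 1.25 := by
  have ht : t ^ 2 ≤ 0.0036 := by nlinarith
  have hq : (1 + s) ^ 2 + t ^ 2 ≤ 1.13 := by nlinarith
  have hq' : 0.88 ≤ (1 + s) ^ 2 + t ^ 2 := by nlinarith [sq_nonneg t]
  constructor <;> by_contra hlt <;> push Not at hlt
  · rcases le_or_gt 0 p with hp | hp <;> nlinarith
  · nlinarith

/-- The divided difference of the perturbed Joukowski map does not vanish on the closed lower
half-disc of radius `V` if one of the points is not real. For two such points `v w` would be close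
to `1`, so that `Re v` and `Re w` have the same sign and both contribute with the same sign to
`Im (v w)`; this imaginary part is then too large for the perturbation. -/
lemma dividedDiff_ne_zero {V : ℝ} (hs : SmallCoeffs e α β κ) (hV : 1 ≤ V)
    (he : 100 * e * V ^ 2 ≤ 1) {v w : ℂ} (hv : v ≠ 0) (hw : w ≠ 0) (hvV : ‖v‖ ≤ V) (hwV : ‖w‖ ≤ V)
    (hvi : v.im ≤ 0) (hwi : w.im ≤ 0) (hi : v.im + w.im < 0) :
    1 + (α : ℂ) - 1 / (v * w) + β * (v + w) + κ * (v ^ 2 + v * w + w ^ 2) ≠ 0 := by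
  intro h0
  have he0 := hs.nonneg
  obtain ⟨ha, hb, hk⟩ := hs
  obtain ⟨hx1, hy1⟩ := abs_re_im_le hvV
  obtain ⟨hx2, hy2⟩ := abs_re_im_le hwV
  set E : ℂ := α + β * (v + w) + κ * (v ^ 2 + v * w + w ^ 2) with hE
  -- with `E` collecting the perturbation, a zero of the divided difference means `(1 + E) v w = 1`
  have h1 : (1 + E) * (v * w) = 1 := by
    have : 1 + E = 1 / (v * w) := by rw [hE]; linear_combination h0
    rw [this]; field_simp
  have heV : e * V ≤ e * V ^ 2 := by nlinarith [mul_nonneg he0 (by linarith : 0 ≤ V)]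
  have heV' : e ≤ e * V ^ 2 := by nlinarith
  have hEn : ‖E‖ ≤ 0.06 := by
    have n1 : ‖(α : ℂ)‖ ≤ e := by simpa using ha
    have n2 : ‖(β : ℂ) * (v + w)‖ ≤ e * (V + V) := by
      rw [norm_mul]
      exact mul_le_mul (by simpa using hb) ((norm_add_le _ _).trans (add_le_add hvV hwV))
        (norm_nonneg _) he0
    have n3 : ‖(κ : ℂ) * (v ^ 2 + v * w + w ^ 2)‖ ≤ e * (V ^ 2 + V * V + V ^ 2) := by
      rw [norm_mul]
      refine mul_le_mul (by simpa using hk) ((norm_add₃_le).trans ?_) (norm_nonneg _) he0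
      rw [norm_pow, norm_mul, norm_pow]
      gcongr
    have := norm_add₃_le (a := (α : ℂ)) (b := (β : ℂ) * (v + w))
      (c := (κ : ℂ) * (v ^ 2 + v * w + w ^ 2))
    rw [hE]
    nlinarith
  obtain ⟨hE1, hE2⟩ := abs_re_im_le hEn
  have hEim : E.im = β * (v.im + w.im) + κ * (2 * v.re * v.im + v.re * w.im + w.re * v.im
      + 2 * w.re * w.im) := by
    rw [hE]
    simp only [add_im, ofReal_im, mul_im, add_re, ofReal_re, pow_two, mul_re]
    ring
  have hr := congrArg re h1
  have hm := congrArg im h1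
  simp only [mul_re, mul_im, add_re, add_im, one_re, one_im] at hr hm
  set x1 := v.re
  set x2 := w.re
  set y1 := v.im
  set y2 := w.im
  set p1 := x1 * x2 - y1 * y2 with hp1
  set p2 := x1 * y2 + y1 * x2 with hp2
  rw [abs_le] at hE1 hE2
  have hEim' : |E.im| ≤ 4 * e * V * (|y1| + |y2|) := by
    rw [hEim]
    have t1 : |β * (y1 + y2)| ≤ e * (|y1| + |y2|) := by
      rw [abs_mul]; exact mul_le_mul hb (abs_add_le _ _) (abs_nonneg _) he0
    have t2 : |2 * x1 * y1 + x1 * y2 + x2 * y1 + 2 * x2 * y2| ≤ 3 * V * (|y1| + |y2|) := by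
      have q1 : |2 * x1 * y1| ≤ 2 * V * |y1| := by
        rw [abs_mul, abs_mul, abs_two]; gcongr
      have q2 : |x1 * y2| ≤ V * |y2| := by rw [abs_mul]; gcongr
      have q3 : |x2 * y1| ≤ V * |y1| := by rw [abs_mul]; gcongr
      have q4 : |2 * x2 * y2| ≤ 2 * V * |y2| := by
        rw [abs_mul, abs_mul, abs_two]; gcongr
      have := abs_add_le (2 * x1 * y1 + x1 * y2 + x2 * y1) (2 * x2 * y2)
      have := abs_add_le (2 * x1 * y1 + x1 * y2) (x2 * y1)
      have := abs_add_le (2 * x1 * y1) (x1 * y2)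
      linarith
    have t3 : |κ * (2 * x1 * y1 + x1 * y2 + x2 * y1 + 2 * x2 * y2)| ≤
        e * (3 * V * (|y1| + |y2|)) := by
      rw [abs_mul]; exact mul_le_mul hk t2 (abs_nonneg _) he0
    have := abs_add_le (β * (y1 + y2)) (κ * (2 * x1 * y1 + x1 * y2 + x2 * y1 + 2 * x2 * y2))
    have hY : 0 ≤ e * (|y1| + |y2|) := by positivity
    nlinarith
  have hA : 0 < 1 + E.re := by linarith
  have hp2E : (1 + E.re) * p2 = -(E.im * p1) := by rw [hp1, hp2]; linarith
  have hp1E : p1 * ((1 + E.re) ^ 2 + E.im ^ 2) = 1 + E.re := by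
    linear_combination (1 + E.re) * hr + E.im * hp2E
  obtain ⟨hp1l, hp1u⟩ := re_inv_bounds hE1.1 hE1.2 hE2.1 hE2.2 hp1E
  have hyy : 0 ≤ y1 * y2 := mul_nonneg_of_nonpos_of_nonpos hvi hwi
  have hxx : 0.8 ≤ x1 * x2 := by linarith
  -- both real parts are at least `0.8 / V` in absolute value
  have hxx' : x1 * x2 ≤ |x1| * |x2| := by rw [← abs_mul]; exact le_abs_self _
  have hx1l : 0.8 ≤ V * |x1| := by
    have := mul_le_mul_of_nonneg_left hx2 (abs_nonneg x1)
    linarith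
  have hx2l : 0.8 ≤ V * |x2| := by
    have := mul_le_mul_of_nonneg_right hx1 (abs_nonneg x2)
    linarith
  have hp2abs : |p2| = |x1| * |y2| + |x2| * |y1| := by
    have h1 : |y1| = -y1 := abs_of_nonpos hvi
    have h2 : |y2| = -y2 := abs_of_nonpos hwi
    rcases pos_and_pos_or_neg_and_neg_of_mul_pos (by linarith : 0 < x1 * x2) with
      ⟨hx, hx'⟩ | ⟨hx, hx'⟩
    · have q1 := mul_nonpos_of_nonneg_of_nonpos hx.le hwi
      have q2 := mul_nonpos_of_nonneg_of_nonpos hx'.le hvi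
      rw [h1, h2, abs_of_pos hx, abs_of_pos hx', abs_of_nonpos (by linarith)]
      linarith
    · have q1 := mul_nonneg_of_nonpos_of_nonpos hx.le hwi
      have q2 := mul_nonneg_of_nonpos_of_nonpos hx'.le hvi
      rw [h1, h2, abs_of_neg hx, abs_of_neg hx', abs_of_nonneg (by linarith)]
      linarith
  have hY : 0 < |y1| + |y2| := by
    rw [abs_of_nonpos hvi, abs_of_nonpos hwi]; linarith
  have hlow : 0.8 * (|y1| + |y2|) ≤ V * |p2| := by
    have q1 := mul_le_mul_of_nonneg_right hx1l (abs_nonneg y2)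
    have q2 := mul_le_mul_of_nonneg_right hx2l (abs_nonneg y1)
    rw [hp2abs]; linarith
  have hup : 0.94 * |p2| ≤ 1.25 * |E.im| := by
    have : |(1 + E.re) * p2| = |E.im * p1| := by rw [hp2E, abs_neg]
    rw [abs_mul, abs_mul, abs_of_pos hA, abs_of_pos (by linarith : 0 < p1)] at this
    have q1 := mul_le_mul_of_nonneg_right hE1.1 (abs_nonneg p2)
    have q2 := mul_le_mul_of_nonneg_left hp1u (abs_nonneg E.im)
    linarith
  have : V * |E.im| ≤ 0.04 * (|y1| + |y2|) := by
    calc V * |E.im| ≤ V * (4 * e * V * (|y1| + |y2|)) := by gcongr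
      _ = 4 * (e * V ^ 2) * (|y1| + |y2|) := by ring
      _ ≤ 0.04 * (|y1| + |y2|) := by
        apply mul_le_mul_of_nonneg_right _ hY.le
        linarith
  have q := mul_le_mul_of_nonneg_left hup (by linarith : 0 ≤ V)
  linarith

lemma joukSlope_ge (hs : SmallCoeffs e α β κ) {v : ℂ} (hv : ‖v‖ ≤ 2) :
    1 - 17 * e ≤ joukSlope α β κ v := by
  have he0 := hs.nonneg
  obtain ⟨ha, hb, hk⟩ := hs
  obtain ⟨hx, hy⟩ := abs_re_im_le hv
  have h1 : |2 * β * v.re| ≤ 4 * e := by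
    rw [abs_mul, abs_mul, abs_two]; nlinarith [abs_nonneg v.re, abs_nonneg β]
  have hxy : v.re ^ 2 + v.im ^ 2 ≤ 4 := by
    have := Complex.sq_norm v
    rw [normSq_apply] at this
    nlinarith [norm_nonneg v]
  have h2 : |3 * v.re ^ 2 - v.im ^ 2| ≤ 12 := by
    rw [abs_le]; constructor <;> nlinarith [sq_nonneg v.re, sq_nonneg v.im]
  have h3 : |κ * (3 * v.re ^ 2 - v.im ^ 2)| ≤ e * 12 := by
    rw [abs_mul]; exact mul_le_mul hk h2 (abs_nonneg _) he0
  rw [abs_le] at ha h1 h3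
  unfold joukSlope
  linarith

/-- The region `lowerDom` is contained in a disc slightly larger than the unit disc. -/
lemma norm_le_of_mem_lowerDom (hs : SmallCoeffs e α β κ) (he : e ≤ 1 / 1000) {v : ℂ}
    (hv : v ∈ lowerDom α β κ) : ‖v‖ ≤ 1 + 10 * e := by
  have he0 := hs.nonneg
  have h1 := joukSlope_ge hs hv.2.1
  have h2 := hv.2.2
  rw [← Complex.sq_norm] at h2
  by_contra hlt
  push Not at hlt
  have h3 : (1 + 10 * e) ^ 2 < ‖v‖ ^ 2 := by gcongr
  have h4 : ‖v‖ ^ 2 * (1 - 17 * e) ≤ 1 := by nlinarith [sq_nonneg ‖v‖]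
  have h5 : 0 ≤ e * (3 - 240 * e - 1700 * e ^ 2) := mul_nonneg he0 (by nlinarith)
  have h6 : (1 + 10 * e) ^ 2 * (1 - 17 * e) < ‖v‖ ^ 2 * (1 - 17 * e) :=
    mul_lt_mul_of_pos_right h3 (by linarith)
  nlinarith

lemma isCompact_lowerDom : IsCompact (lowerDom α β κ) := by
  apply (isCompact_closedBall (0 : ℂ) 2).of_isClosed_subset
  · have h : Continuous fun v : ℂ => normSq v * joukSlope α β κ v := by
      unfold joukSlope
      have := continuous_normSq
      have := continuous_re
      have := continuous_im
      fun_prop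
    exact (isClosed_le continuous_im continuous_const).inter
      ((isClosed_le continuous_norm continuous_const).inter (isClosed_le h continuous_const))
  · intro v hv
    simpa using hv.2.1

/-- The formula for `Im (jouk v)`, cleared of denominators. -/
lemma normSq_mul_im_of_joukNum {v Z : ℂ} (h : v * Z = joukNum α β κ v) :
    normSq v * Z.im = v.im * (normSq v * joukSlope α β κ v - 1) := by
  have hv := ne_zero_of_joukNum h
  rw [← (jouk_eq_iff hv).2 h, jouk_im]
  have : normSq v ≠ 0 := by simpa using hv
  field_simp

lemma mem_lowerDom_of_im_pos {v Z : ℂ} (h : v * Z = joukNum α β κ v) (hZ : 0 < Z.im)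
    (hi : v.im ≤ 0) (hn : ‖v‖ ≤ 2) : v ∈ lowerDom α β κ ∧ v.im < 0 := by
  have hv := ne_zero_of_joukNum h
  have h1 := normSq_mul_im_of_joukNum h
  have h2 : 0 < normSq v := normSq_pos.2 hv
  have h3 : 0 < normSq v * Z.im := mul_pos h2 hZ
  have h4 : v.im < 0 := by
    rcases hi.lt_or_eq with h | h
    · exact h
    · rw [h1, h] at h3; simp at h3
  refine ⟨⟨hi, hn, ?_⟩, h4⟩
  by_contra hlt
  push Not at hlt
  nlinarith

lemma im_neg_of_im_pos {v Z : ℂ} (h : v * Z = joukNum α β κ v) (hZ : 0 < Z.im)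
    (hv : v ∈ lowerDom α β κ) : v.im < 0 :=
  (mem_lowerDom_of_im_pos h hZ hv.1 hv.2.1).2

/-- Two distinct positive reals with the same image cannot both lie in `lowerDom`: `h1` says that
the divided difference vanishes and `h2` that the larger point `t` lies in `lowerDom`, and together
they give `t ≤ s` up to an error that is small compared with `t - s`. -/
lemma no_pos_pair {s t : ℝ} (hs : 0 < s) (hst : s < t) (ht : t ≤ 1.01)
    (hb : |β + κ * (s + 2 * t)| ≤ 1 / 100)
    (h1 : s * t * (1 + α + β * (s + t) + κ * (s ^ 2 + s * t + t ^ 2)) = 1)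
    (h2 : t * t * (1 + α + 2 * β * t + κ * (3 * t ^ 2)) ≤ 1) : False := by
  have k1 : s * (t * t * (1 + α + 2 * β * t + κ * (3 * t ^ 2))) =
      t + t ^ 2 * s * (t - s) * (β + κ * (s + 2 * t)) := by
    linear_combination t * h1
  have k2 : t + t ^ 2 * s * (t - s) * (β + κ * (s + 2 * t)) ≤ s := by
    rw [← k1]
    have := mul_le_mul_of_nonneg_left h2 hs.le
    linarith
  have e1 : t ^ 2 ≤ 1.03 := by nlinarith
  have e2 : t ^ 2 * s ≤ 1.2 := by nlinarith
  have e3 : t ^ 2 * s * (t - s) ≤ 1.2 * (t - s) := mul_le_mul_of_nonneg_right e2 (by linarith)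
  have e4 : 0 ≤ t ^ 2 * s * (t - s) :=
    mul_nonneg (mul_nonneg (sq_nonneg _) hs.le) (by linarith)
  rw [abs_le] at hb
  have := mul_le_mul_of_nonneg_left hb.1 e4
  linarith

lemma no_real_pair {s t : ℝ} (hpos : 0 < s * t) (hst : |s| < |t|) (ht : |t| ≤ 1.01)
    (hb : |β + κ * (s + 2 * t)| ≤ 1 / 100)
    (h1 : s * t * (1 + α + β * (s + t) + κ * (s ^ 2 + s * t + t ^ 2)) = 1)
    (h2 : t * t * (1 + α + 2 * β * t + κ * (3 * t ^ 2)) ≤ 1) : False := by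
  rcases pos_and_pos_or_neg_and_neg_of_mul_pos hpos with ⟨hs, ht'⟩ | ⟨hs, ht'⟩
  · rw [abs_of_pos hs, abs_of_pos ht'] at hst
    rw [abs_of_pos ht'] at ht
    exact no_pos_pair hs hst ht hb h1 h2
  · rw [abs_of_neg hs, abs_of_neg ht'] at hst
    rw [abs_of_neg ht'] at ht
    refine no_pos_pair (α := α) (β := -β) (κ := κ) (s := -s) (t := -t) (by linarith) hst ht ?_ ?_ ?_
    · rw [← abs_neg]; convert hb using 2; ring
    · linear_combination h1
    · linarith

/-- Injectivity of the perturbed Joukowski map on `lowerDom`, boundary included. -/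
lemma jouk_injOn (hs : SmallCoeffs e α β κ) (he : e ≤ 1 / 1000) {v w Z : ℂ}
    (hv : v ∈ lowerDom α β κ) (hw : w ∈ lowerDom α β κ)
    (hvZ : v * Z = joukNum α β κ v) (hwZ : w * Z = joukNum α β κ w) : v = w := by
  have hv0 := ne_zero_of_joukNum hvZ
  have hw0 := ne_zero_of_joukNum hwZ
  by_contra hne
  have h0 : 1 + (α : ℂ) - 1 / (v * w) + β * (v + w) + κ * (v ^ 2 + v * w + w ^ 2) = 0 := by
    have := jouk_sub (α := α) (β := β) (κ := κ) hv0 hw0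
    rw [(jouk_eq_iff hv0).2 hvZ, (jouk_eq_iff hw0).2 hwZ, sub_self] at this
    exact (mul_eq_zero.1 this.symm).resolve_left (sub_ne_zero.2 hne)
  by_cases hi : v.im + w.im < 0
  · exact dividedDiff_ne_zero hs (V := 2) (by norm_num) (by linarith) hv0 hw0 hv.2.1 hw.2.1 hv.1
      hw.1 hi h0
  -- both points are real
  have hvi : v.im = 0 := by linarith [hv.1, hw.1]
  have hwi : w.im = 0 := by linarith [hv.1, hw.1]
  have hvn := norm_le_of_mem_lowerDom hs he hv
  have hwn := norm_le_of_mem_lowerDom hs he hw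
  obtain ⟨hx1, -⟩ := abs_re_im_le hvn
  obtain ⟨hx2, -⟩ := abs_re_im_le hwn
  have h1 := hv.2.2
  have h2 := hw.2.2
  obtain ⟨x, rfl⟩ : ∃ x : ℝ, v = x := ⟨v.re, by apply Complex.ext <;> simp [hvi]⟩
  obtain ⟨y, rfl⟩ : ∃ x : ℝ, w = x := ⟨w.re, by apply Complex.ext <;> simp [hwi]⟩
  simp only [joukSlope, normSq_ofReal, ofReal_re, ofReal_im] at h1 h2 hx1 hx2
  have hx0 : x ≠ 0 := by simpa using hv0
  have hy0 : y ≠ 0 := by simpa using hw0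
  have hxy : x ≠ y := by simpa using hne
  have h3 : x * y * (1 + α + β * (x + y) + κ * (x ^ 2 + x * y + y ^ 2)) = 1 := by
    have h4 : ((x * y * (1 + α + β * (x + y) + κ * (x ^ 2 + x * y + y ^ 2)) : ℝ) : ℂ) = 1 := by
      have hxy' : (x : ℂ) * y ≠ 0 := mul_ne_zero hv0 hw0
      push_cast
      field_simp at h0
      linear_combination h0
    exact_mod_cast h4
  have he0 := hs.nonneg
  obtain ⟨ha, hb, hk⟩ := hs
  have hbound : ∀ s t : ℝ, |s| ≤ 1 + 10 * e → |t| ≤ 1 + 10 * e →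
      |β + κ * (s + 2 * t)| ≤ 1 / 100 := by
    intro s t hs ht
    have t1 : |s + 2 * t| ≤ 3.1 := by
      rw [abs_le] at *; constructor <;> linarith
    have t2 : |κ * (s + 2 * t)| ≤ e * 3.1 := by
      rw [abs_mul]; exact mul_le_mul hk t1 (abs_nonneg _) he0
    have := abs_add_le β (κ * (s + 2 * t))
    linarith
  have b1 := hbound x y hx1 hx2
  have b2 := hbound y x hx2 hx1
  rw [abs_le] at hx1 hx2 b1 b2 ha hb hk
  have hpos : 0 < x * y := by
    by_contra hlt
    push Not at hlt
    have hA : 0 < 1 + α + β * (x + y) + κ * (x ^ 2 + x * y + y ^ 2) := by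
      nlinarith [sq_nonneg (x+y), sq_nonneg (x-y)]
    nlinarith
  have habs : |x| ≠ |y| := by
    intro h
    rcases abs_eq_abs.1 h with h | h
    · exact hxy h
    · rw [h] at hpos; nlinarith [sq_nonneg y]
  rcases lt_or_gt_of_ne habs with h | h
  · exact no_real_pair hpos h (by linarith [abs_le.2 hx2]) (abs_le.2 b1) h3 (by linarith)
  · refine no_real_pair (α := α) (by linarith) h (by linarith [abs_le.2 hx1]) (abs_le.2 b2)
      (by linear_combination h3) (by linarith)

lemma continuous_joukNum : Continuous (joukNum α β κ) := by
  unfold joukNum; fun_prop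

lemma isClosed_jouk_image :
    IsClosed {Z : ℂ | ∃ v ∈ lowerDom α β κ, v * Z = joukNum α β κ v} := by
  apply IsSeqClosed.isClosed
  intro Zs Z hZs hlim
  choose v hv hvZ using hZs
  obtain ⟨w, hw, φ, hφ, hlim'⟩ := isCompact_lowerDom.tendsto_subseq hv
  refine ⟨w, hw, ?_⟩
  have h1 : Tendsto (fun n => v (φ n) * Zs (φ n)) atTop (𝓝 (w * Z)) :=
    hlim'.mul (hlim.comp hφ.tendsto_atTop)
  have h2 : Tendsto (fun n => joukNum α β κ (v (φ n))) atTop (𝓝 (joukNum α β κ w)) :=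
    (continuous_joukNum.tendsto w).comp hlim'
  refine tendsto_nhds_unique h1 ?_
  simpa only [hvZ] using h2

/-- Surjectivity onto the upper half-plane: the image of the half-disc is open by the inverse
function theorem and relatively closed by compactness. -/
lemma exists_jouk_eq_of_im_pos (hs : SmallCoeffs e α β κ) (he : e ≤ 1 / 1000) {Z : ℂ}
    (hZ : 0 < Z.im) : ∃ v ∈ lowerDom α β κ, v * Z = joukNum α β κ v := by
  have he0 := hs.nonneg
  set D : Set ℂ := {v | v.im < 0 ∧ ‖v‖ < 2 ∧ 0 < (jouk α β κ v).im} with hD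
  have hne : ∀ v ∈ D, v ≠ 0 := by
    rintro v hv rfl
    simpa using hv.1
  have hDd : ∀ v ∈ D, v ∈ lowerDom α β κ := fun v hv =>
    (mem_lowerDom_of_im_pos (joukNum_eq (hne v hv)) hv.2.2 hv.1.le hv.2.1.le).1
  have hU : IsOpen (jouk α β κ '' D) := by
    rw [isOpen_iff_mem_nhds]
    rintro _ ⟨v, hv, rfl⟩
    have hd := jouk_hasStrictDerivAt (α := α) (β := β) (κ := κ) (hne v hv)
    have hd0 := dividedDiff_ne_zero hs (V := 2) (by norm_num) (by linarith) (hne v hv) (hne v hv)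
      hv.2.1.le hv.2.1.le hv.1.le hv.1.le (by linarith [hv.1])
    rw [← hd.map_nhds_eq hd0]
    apply image_mem_map
    have h1 : ∀ᶠ w in 𝓝 v, w.im < 0 := continuous_im.continuousAt.eventually_lt_const hv.1
    have h2 : ∀ᶠ w in 𝓝 v, ‖w‖ < 2 := continuous_norm.continuousAt.eventually_lt_const hv.2.1
    have h3 : ∀ᶠ w in 𝓝 v, 0 < (jouk α β κ w).im :=
      (continuous_im.continuousAt.comp hd.hasDerivAt.continuousAt).eventually_const_lt hv.2.2
    filter_upwards [h1, h2, h3] with w a b c using ⟨a, b, c⟩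
  have hconv : IsPreconnected {Z : ℂ | 0 < Z.im} := (convex_halfSpace_im_gt 0).isPreconnected
  have hsub : {Z : ℂ | 0 < Z.im} ⊆ jouk α β κ '' D := by
    apply hconv.subset_of_closure_inter_subset hU
    · have hmem : (-(I / 2)) ∈ D := by
        have hc : joukSlope α β κ (-(I / 2)) - (normSq (-(I / 2)))⁻¹ < 0 := by
          obtain ⟨ha, hb, hk⟩ := hs
          rw [abs_le] at ha hb hk
          have h1 : normSq (-(I / 2)) = 1 / 4 := by
            rw [normSq_apply]; simp; norm_num
          rw [h1]
          simp [joukSlope]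
          nlinarith
        refine ⟨by simp, ?_, ?_⟩
        · simp; norm_num
        · rw [jouk_im]
          exact mul_pos_of_neg_of_neg (by simp) hc
      exact ⟨_, hmem.2.2, _, hmem, rfl⟩
    · rintro W ⟨hW, hWi⟩
      have hcl : W ∈ {Z : ℂ | ∃ v ∈ lowerDom α β κ, v * Z = joukNum α β κ v} := by
        refine closure_minimal ?_ isClosed_jouk_image hW
        rintro _ ⟨v, hv, rfl⟩
        exact ⟨v, hDd v hv, joukNum_eq (hne v hv)⟩
      obtain ⟨v, hv, hvW⟩ := hcl
      have hW' := (jouk_eq_iff (ne_zero_of_joukNum hvW)).2 hvW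
      refine ⟨v, ⟨im_neg_of_im_pos hvW hWi hv, ?_, ?_⟩, hW'⟩
      · linarith [norm_le_of_mem_lowerDom hs he hv]
      · rw [hW']; exact hWi
  obtain ⟨v, hv, hvZ⟩ := hsub hZ
  exact ⟨v, hDd v hv, (jouk_eq_iff (hne v hv)).1 hvZ⟩

lemma exists_jouk_eq (hs : SmallCoeffs e α β κ) (he : e ≤ 1 / 1000) {Z : ℂ}
    (hZ : 0 ≤ Z.im) : ∃ v ∈ lowerDom α β κ, v * Z = joukNum α β κ v := by
  have h : closure {Z : ℂ | 0 < Z.im} ⊆ {Z : ℂ | ∃ v ∈ lowerDom α β κ, v * Z = joukNum α β κ v} :=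
    closure_minimal (fun W hW => exists_jouk_eq_of_im_pos hs he hW) isClosed_jouk_image
  rw [Complex.closure_setOfPred_lt_im] at h
  exact h hZ

open Classical in
/-- The inverse of the perturbed Joukowski map, from the closed upper half-plane to `lowerDom`. It
takes the value `0` where there is no preimage, which does not happen there. -/
noncomputable def joukInv (α β κ : ℝ) (Z : ℂ) : ℂ :=
  if h : ∃ v ∈ lowerDom α β κ, v * Z = joukNum α β κ v then h.choose else 0

lemma joukInv_spec (hs : SmallCoeffs e α β κ) (he : e ≤ 1 / 1000) {Z : ℂ}
    (hZ : 0 ≤ Z.im) : joukInv α β κ Z ∈ lowerDom α β κ ∧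
      joukInv α β κ Z * Z = joukNum α β κ (joukInv α β κ Z) := by
  have h := exists_jouk_eq hs he hZ
  rw [joukInv, dif_pos h]
  exact h.choose_spec

lemma joukInv_unique (hs : SmallCoeffs e α β κ) (he : e ≤ 1 / 1000) {Z v : ℂ}
    (hZ : 0 ≤ Z.im) (hv : v ∈ lowerDom α β κ) (hvZ : v * Z = joukNum α β κ v) :
    v = joukInv α β κ Z :=
  jouk_injOn hs he hv (joukInv_spec hs he hZ).1 hvZ (joukInv_spec hs he hZ).2

lemma continuousOn_joukInv (hs : SmallCoeffs e α β κ) (he : e ≤ 1 / 1000) :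
    ContinuousOn (joukInv α β κ) {Z | 0 ≤ Z.im} := by
  intro Z0 hZ0
  -- every cluster point of the inverse at `Z0` is a preimage of `Z0`, hence equal to the inverse
  apply (isCompact_lowerDom (α := α) (β := β) (κ := κ)).tendsto_nhds_of_unique_mapClusterPt
  · filter_upwards [self_mem_nhdsWithin] with Z hZ using (joukInv_spec hs he hZ).1
  · intro x hx hcl
    obtain ⟨U, hU, hlim⟩ := mapClusterPt_iff_ultrafilter.1 hcl
    apply joukInv_unique hs he hZ0 hx
    have h1 : Tendsto (fun Z => joukInv α β κ Z * Z) U (𝓝 (x * Z0)) :=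
      hlim.mul (tendsto_id.mono_left (hU.trans nhdsWithin_le_nhds))
    have h2 : Tendsto (fun Z => joukNum α β κ (joukInv α β κ Z)) U (𝓝 (joukNum α β κ x)) :=
      (continuous_joukNum.tendsto x).comp hlim
    refine tendsto_nhds_unique h1 (h2.congr' ?_)
    have : ∀ᶠ Z in (U : Filter ℂ), 0 ≤ Z.im := hU self_mem_nhdsWithin
    filter_upwards [this] with Z hZ using (joukInv_spec hs he hZ).2.symm

lemma differentiableOn_joukInv (hs : SmallCoeffs e α β κ) (he : e ≤ 1 / 1000) :
    DifferentiableOn ℂ (joukInv α β κ) {Z | 0 < Z.im} := by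
  have hopen : IsOpen {Z : ℂ | 0 < Z.im} := isOpen_lt continuous_const continuous_im
  intro Z hZ
  have hnh : {Z : ℂ | 0 < Z.im} ∈ 𝓝 Z := hopen.mem_nhds hZ
  obtain ⟨hm, hsp⟩ := joukInv_spec hs he (le_of_lt hZ)
  have h0 := ne_zero_of_joukNum hsp
  have hi := im_neg_of_im_pos hsp hZ hm
  have hd0 := dividedDiff_ne_zero hs (V := 2) (by norm_num) (by linarith) h0 h0
      hm.2.1 hm.2.1 hm.1 hm.1 (by linarith)
  refine (HasDerivAt.of_local_left_inverse (f := jouk α β κ) ?_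
    (jouk_hasStrictDerivAt h0).hasDerivAt hd0 ?_).differentiableAt.differentiableWithinAt
  · apply (continuousOn_joukInv hs he).continuousAt
    filter_upwards [hnh] with W hW using le_of_lt hW
  · filter_upwards [hnh] with W hW
    have := (joukInv_spec hs he (le_of_lt hW)).2
    exact (jouk_eq_iff (ne_zero_of_joukNum this)).2 this

/-! ### Critical points of the perturbed Joukowski map -/

/-- The polynomial `v² * jouk' v`, whose real zeros near `±1` are the preimages of the spectral
edges. -/
noncomputable def joukCrit (α β κ : ℝ) (v : ℂ) : ℂ :=
  -1 + (1 + α) * v ^ 2 + 2 * β * v ^ 3 + 3 * κ * v ^ 4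

/-- The real number `a` is a critical point of the perturbed Joukowski map, close to `1` or `-1`. -/
structure IsCrit (α β κ a : ℝ) : Prop where
  crit : -1 + (1 + α) * a ^ 2 + 2 * β * a ^ 3 + 3 * κ * a ^ 4 = 0
  ge : 0.99 ≤ |a|
  le : |a| ≤ 1.01

lemma IsCrit.neg {a : ℝ} (h : IsCrit α (-β) κ a) : IsCrit α β κ (-a) where
  crit := by linear_combination h.crit
  ge := by rw [abs_neg]; exact h.ge
  le := by rw [abs_neg]; exact h.le

lemma IsCrit.ne_zero {a : ℝ} (h : IsCrit α β κ a) : a ≠ 0 := by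
  intro h0
  have := h.ge
  rw [h0] at this
  norm_num at this

lemma SmallCoeffs.neg (h : SmallCoeffs e α β κ) : SmallCoeffs e α (-β) κ :=
  ⟨h.a, by rw [abs_neg]; exact h.b, h.k⟩

/-- Existence of a critical point near `1`, by the intermediate value theorem. The one near `-1`
arises from the symmetry `v ↦ -v`, `β ↦ -β`. -/
lemma exists_isCrit_near_one (hs : SmallCoeffs e α β κ) (he : e ≤ 1 / 1000) :
    ∃ a, IsCrit α β κ a ∧ |a - 1| ≤ 5 * e := by
  have he0 := hs.nonneg
  obtain ⟨ha, hb, hk⟩ := hs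
  rw [abs_le] at ha hb hk
  have hcont : ContinuousOn (fun a : ℝ => -1 + (1 + α) * a ^ 2 + 2 * β * a ^ 3 + 3 * κ * a ^ 4)
      (Icc (1 - 5 * e) (1 + 5 * e)) := by fun_prop
  have hl : -1 + (1 + α) * (1 - 5 * e) ^ 2 + 2 * β * (1 - 5 * e) ^ 3 + 3 * κ * (1 - 5 * e) ^ 4
      ≤ 0 := by
    have h1 : (1 - 5 * e) ^ 2 ≤ 1 - 9 * e := by nlinarith
    have h2 : (1 - 5 * e) ^ 3 ≤ 1 := pow_le_one₀ (by linarith) (by linarith)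
    have h3 : (1 - 5 * e) ^ 4 ≤ 1 := pow_le_one₀ (by linarith) (by linarith)
    have h2' : 0 ≤ (1 - 5 * e) ^ 3 := pow_nonneg (by linarith) _
    have h3' : 0 ≤ (1 - 5 * e) ^ 4 := pow_nonneg (by linarith) _
    have t1 : (1 + α) * (1 - 5 * e) ^ 2 ≤ (1 + e) * (1 - 9 * e) := by
      apply mul_le_mul (by linarith) h1 (sq_nonneg _) (by linarith)
    have t2 : β * (1 - 5 * e) ^ 3 ≤ e * 1 := mul_le_mul (by linarith) h2 h2' he0
    have t3 : κ * (1 - 5 * e) ^ 4 ≤ e * 1 := mul_le_mul (by linarith) h3 h3' he0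
    nlinarith
  have hr : 0 ≤ -1 + (1 + α) * (1 + 5 * e) ^ 2 + 2 * β * (1 + 5 * e) ^ 3
      + 3 * κ * (1 + 5 * e) ^ 4 := by
    have h1 : 1 + 10 * e ≤ (1 + 5 * e) ^ 2 := by nlinarith
    have h2 : (1 + 5 * e) ^ 3 ≤ 1.005 ^ 3 := by
      apply pow_le_pow_left₀ (by linarith); linarith
    have h3 : (1 + 5 * e) ^ 4 ≤ 1.005 ^ 4 := by
      apply pow_le_pow_left₀ (by linarith); linarith
    have h2' : 0 ≤ (1 + 5 * e) ^ 3 := pow_nonneg (by linarith) _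
    have h3' : 0 ≤ (1 + 5 * e) ^ 4 := pow_nonneg (by linarith) _
    have t1 : (1 - e) * (1 + 10 * e) ≤ (1 + α) * (1 + 5 * e) ^ 2 := by
      apply mul_le_mul (by linarith) h1 (by linarith) (by linarith)
    have t2 : -β * (1 + 5 * e) ^ 3 ≤ e * 1.005 ^ 3 := mul_le_mul (by linarith) h2 h2' he0
    have t3 : -κ * (1 + 5 * e) ^ 4 ≤ e * 1.005 ^ 4 := mul_le_mul (by linarith) h3 h3' he0
    nlinarith
  obtain ⟨a, ⟨ha1, ha2⟩, hac⟩ := intermediate_value_Icc (by linarith) hcont ⟨hl, hr⟩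
  refine ⟨a, ⟨hac, ?_, ?_⟩, ?_⟩
  · exact le_trans (by linarith) (le_abs_self a)
  · rw [abs_le]; constructor <;> linarith
  · rw [abs_le]; constructor <;> linarith

/-- The quadratic cofactor in `v * (jouk v - jouk a) = (v - a)² * joukQuot v` at a critical
point `a`. -/
noncomputable def joukQuot (β κ a : ℝ) (v : ℂ) : ℂ :=
  1 / (a : ℂ) ^ 2 + (β + 2 * κ * a) * v + κ * v ^ 2

lemma IsCrit.inv_sq {a : ℝ} (h : IsCrit α β κ a) :
    1 / a ^ 2 = 1 + α + 2 * β * a + 3 * κ * a ^ 2 := by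
  have h0 := h.ne_zero
  field_simp
  linear_combination -h.crit

lemma IsCrit.jouk_sub {a : ℝ} (h : IsCrit α β κ a) {v : ℂ} (hv : v ≠ 0) :
    jouk α β κ v - jouk α β κ a = (v - a) ^ 2 * joukQuot β κ a v / v := by
  have h0 := h.ne_zero
  have h0' : (a : ℂ) ≠ 0 := by exact_mod_cast h0
  have hc : -1 + (1 + α) * (a : ℂ) ^ 2 + 2 * β * (a : ℂ) ^ 3 + 3 * κ * (a : ℂ) ^ 4 = 0 := by
    exact_mod_cast congrArg (fun x : ℝ => (x : ℂ)) h.crit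
  unfold jouk joukQuot
  field_simp
  linear_combination (v ^ 2 - a * v) * hc

lemma IsCrit.joukQuot_sub_one {a : ℝ} (h : IsCrit α β κ a) (hs : SmallCoeffs e α β κ) {v : ℂ}
    (hv : ‖v‖ ≤ 2) : ‖joukQuot β κ a v - 1‖ ≤ 17 * e := by
  have he0 := hs.nonneg
  obtain ⟨ha, hb, hk⟩ := hs
  have hle := h.le
  have ha2 : |a| ^ 2 ≤ 1.03 := by nlinarith [abs_nonneg a]
  have e1 : joukQuot β κ a v - 1 = ((α + 2 * β * a + 3 * κ * a ^ 2 : ℝ) : ℂ) +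
      ((β + 2 * κ * a : ℝ) : ℂ) * v + κ * v ^ 2 := by
    have : (1 / (a : ℂ) ^ 2) = ((1 + α + 2 * β * a + 3 * κ * a ^ 2 : ℝ) : ℂ) := by
      rw [← h.inv_sq]; push_cast; ring
    rw [joukQuot, this]
    push_cast
    ring
  have n1 : |α + 2 * β * a + 3 * κ * a ^ 2| ≤ 6.2 * e := by
    have := abs_add_three α (2 * β * a) (3 * κ * a ^ 2)
    have t1 : |2 * β * a| ≤ 2 * e * 1.01 := by
      rw [abs_mul, abs_mul, abs_two]; gcongr
    have t2 : |3 * κ * a ^ 2| ≤ 3 * e * 1.03 := by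
      rw [abs_mul, abs_mul, abs_of_pos (by norm_num : (0 : ℝ) < 3), abs_pow]; gcongr
    linarith
  have n2 : |β + 2 * κ * a| ≤ 3.02 * e := by
    have := abs_add_le β (2 * κ * a)
    have t1 : |2 * κ * a| ≤ 2 * e * 1.01 := by
      rw [abs_mul, abs_mul, abs_two]; gcongr
    linarith
  rw [e1]
  refine (norm_add₃_le).trans ?_
  have m2 : ‖((β + 2 * κ * a : ℝ) : ℂ) * v‖ ≤ 3.02 * e * 2 := by
    rw [norm_mul, Complex.norm_real, Real.norm_eq_abs]; gcongr
  have m3 : ‖(κ : ℂ) * v ^ 2‖ ≤ e * 2 ^ 2 := by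
    rw [norm_mul, Complex.norm_real, Real.norm_eq_abs, norm_pow]; gcongr
  have m1 : ‖((α + 2 * β * a + 3 * κ * a ^ 2 : ℝ) : ℂ)‖ ≤ 6.2 * e := by
    rwa [Complex.norm_real, Real.norm_eq_abs]
  linarith

lemma norm_bounds_of_sub_one {w : ℂ} {δ : ℝ} (h : ‖w - 1‖ ≤ δ) : 1 - δ ≤ ‖w‖ ∧ ‖w‖ ≤ 1 + δ := by
  have h1 : ‖w‖ ≤ ‖w - 1‖ + ‖(1 : ℂ)‖ := by simpa using norm_add_le (w - 1) 1
  have h2 : ‖(1 : ℂ)‖ ≤ ‖w‖ + ‖w - 1‖ := by simpa using norm_sub_le w (w - 1)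
  rw [norm_one] at h1 h2
  constructor <;> linarith

/-- The quadratic cofactor in `joukCrit v = (v - a) (v - c) * critQuot v` at two distinct critical
points. -/
noncomputable def critQuot (α β κ a c : ℝ) (v : ℂ) : ℂ :=
  ((1 + α - 3 * κ * a * c + (a + c) * (2 * β + 3 * κ * (a + c)) : ℝ) : ℂ)
    + ((2 * β + 3 * κ * (a + c) : ℝ) : ℂ) * v + 3 * κ * v ^ 2

lemma joukCrit_factor {a c : ℝ} (ha : IsCrit α β κ a) (hc : IsCrit α β κ c) (hac : a ≠ c) (v : ℂ) :
    joukCrit α β κ v = (v - a) * (v - c) * critQuot α β κ a c v := by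
  have h1 : -1 + (1 + α) * (a : ℂ) ^ 2 + 2 * β * (a : ℂ) ^ 3 + 3 * κ * (a : ℂ) ^ 4 = 0 := by
    exact_mod_cast congrArg (fun x : ℝ => (x : ℂ)) ha.crit
  have h2 : -1 + (1 + α) * (c : ℂ) ^ 2 + 2 * β * (c : ℂ) ^ 3 + 3 * κ * (c : ℂ) ^ 4 = 0 := by
    exact_mod_cast congrArg (fun x : ℝ => (x : ℂ)) hc.crit
  have h3 : (a : ℂ) - c ≠ 0 := sub_ne_zero.2 (by exact_mod_cast hac)
  apply mul_left_cancel₀ h3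
  unfold joukCrit critQuot
  push_cast
  linear_combination (v - c) * h1 - (v - a) * h2

lemma critQuot_sub_one {a c : ℝ} (ha : IsCrit α β κ a) (hc : IsCrit α β κ c)
    (hs : SmallCoeffs e α β κ) {v : ℂ} (hv : ‖v‖ ≤ 2) : ‖critQuot α β κ a c v - 1‖ ≤ 50 * e := by
  have he0 := hs.nonneg
  obtain ⟨hα, hβ, hκ⟩ := hs
  have hac : |a + c| ≤ 2.02 := (abs_add_le _ _).trans (by linarith [ha.le, hc.le])
  have hac' : |a| * |c| ≤ 1.03 := by
    have := mul_le_mul ha.le hc.le (abs_nonneg _) (by norm_num)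
    linarith
  have n2 : |2 * β + 3 * κ * (a + c)| ≤ 8.1 * e := by
    have := abs_add_le (2 * β) (3 * κ * (a + c))
    have t1 : |2 * β| ≤ 2 * e := by rw [abs_mul, abs_two]; gcongr
    have t2 : |3 * κ * (a + c)| ≤ 3 * e * 2.02 := by
      rw [abs_mul, abs_mul, abs_of_pos (by norm_num : (0 : ℝ) < 3)]; gcongr
    linarith
  have n1 : |α - 3 * κ * a * c + (a + c) * (2 * β + 3 * κ * (a + c))| ≤ 20.6 * e := by
    have h1 := abs_add_le (α - 3 * κ * a * c) ((a + c) * (2 * β + 3 * κ * (a + c)))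
    have h2 := abs_sub α (3 * κ * a * c)
    have t1 : |3 * κ * a * c| ≤ 3 * e * 1.03 := by
      rw [show 3 * κ * a * c = (3 * κ) * (a * c) by ring, abs_mul, abs_mul 3, abs_mul a,
        abs_of_pos (by norm_num : (0 : ℝ) < 3)]
      gcongr
    have t2 : |(a + c) * (2 * β + 3 * κ * (a + c))| ≤ 2.02 * (8.1 * e) := by
      rw [abs_mul]; gcongr
    linarith
  have e1 : critQuot α β κ a c v - 1 =
      ((α - 3 * κ * a * c + (a + c) * (2 * β + 3 * κ * (a + c)) : ℝ) : ℂ)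
      + ((2 * β + 3 * κ * (a + c) : ℝ) : ℂ) * v + ((3 * κ : ℝ) : ℂ) * v ^ 2 := by
    unfold critQuot; push_cast; ring
  rw [e1]
  refine (norm_add₃_le).trans ?_
  have m2 : ‖((2 * β + 3 * κ * (a + c) : ℝ) : ℂ) * v‖ ≤ 8.1 * e * 2 := by
    rw [norm_mul, Complex.norm_real, Real.norm_eq_abs]; gcongr
  have m3 : ‖((3 * κ : ℝ) : ℂ) * v ^ 2‖ ≤ (3 * e) * 2 ^ 2 := by
    rw [norm_mul, Complex.norm_real, Real.norm_eq_abs, norm_pow, abs_mul,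
      abs_of_pos (by norm_num : (0 : ℝ) < 3)]
    gcongr
  have m1 : ‖((α - 3 * κ * a * c + (a + c) * (2 * β + 3 * κ * (a + c)) : ℝ) : ℂ)‖ ≤ 20.6 * e := by
    rwa [Complex.norm_real, Real.norm_eq_abs]
  linarith

/-- The size of the derivative of the perturbed Joukowski map: `|v J'(v)|²` is comparable to
the product of the distances of `J(v)` to the two critical values. -/
lemma joukCrit_sq_comparable {a c : ℝ} (ha : IsCrit α β κ a) (hc : IsCrit α β κ c) (hac : a ≠ c)
    (hs : SmallCoeffs e α β κ) (he : e ≤ 1 / 1000) {v : ℂ} (hv : ‖v‖ ≤ 2) (hv0 : v ≠ 0) :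
    1 / 2 * (‖jouk α β κ v - jouk α β κ a‖ * ‖jouk α β κ v - jouk α β κ c‖)
        ≤ (‖joukCrit α β κ v‖ / ‖v‖) ^ 2 ∧
      (‖joukCrit α β κ v‖ / ‖v‖) ^ 2 ≤
        2 * (‖jouk α β κ v - jouk α β κ a‖ * ‖jouk α β κ v - jouk α β κ c‖) := by
  obtain ⟨qa1, qa2⟩ := norm_bounds_of_sub_one (ha.joukQuot_sub_one hs hv)
  obtain ⟨qc1, qc2⟩ := norm_bounds_of_sub_one (hc.joukQuot_sub_one hs hv)
  obtain ⟨r1, r2⟩ := norm_bounds_of_sub_one (critQuot_sub_one ha hc hs hv)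
  rw [ha.jouk_sub hv0, hc.jouk_sub hv0, joukCrit_factor ha hc hac]
  simp only [norm_mul, norm_div, norm_pow]
  set A := ‖joukQuot β κ a v‖
  set C := ‖joukQuot β κ c v‖
  set R := ‖critQuot α β κ a c v‖
  have hT : 0 ≤ (‖v - a‖ * ‖v - c‖ / ‖v‖) ^ 2 := sq_nonneg _
  have e1 : ‖v - ↑a‖ ^ 2 * A / ‖v‖ * (‖v - ↑c‖ ^ 2 * C / ‖v‖) =
    (‖v - a‖ * ‖v - c‖ / ‖v‖) ^ 2 * (A * C) := by field_simp
  have e2 : (‖v - ↑a‖ * ‖v - ↑c‖ * R / ‖v‖) ^ 2 = (‖v - a‖ * ‖v - c‖ / ‖v‖) ^ 2 * R ^ 2 := by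
    field_simp
  rw [e1, e2]
  have hAC : A * C ≤ 1.02 * 1.02 :=
    mul_le_mul (by linarith) (by linarith) (norm_nonneg _) (by norm_num)
  have hAC' : 0.98 * 0.98 ≤ A * C :=
    mul_le_mul (by linarith) (by linarith) (by norm_num) (norm_nonneg _)
  have hR : 0.95 ^ 2 ≤ R ^ 2 := pow_le_pow_left₀ (by norm_num) (by linarith) 2
  have hR' : R ^ 2 ≤ 1.05 ^ 2 := pow_le_pow_left₀ (norm_nonneg _) (by linarith) 2
  constructor
  · rw [mul_left_comm]
    exact mul_le_mul_of_nonneg_left (by linarith) hT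
  · rw [mul_left_comm 2]
    exact mul_le_mul_of_nonneg_left (by linarith) hT

lemma jouk_ofReal (x : ℝ) :
    jouk α β κ x = ((x⁻¹ + (1 + α) * x + β * x ^ 2 + κ * x ^ 3 : ℝ) : ℂ) := by
  unfold jouk; push_cast; ring

/-- The critical value at a critical point near `1`, to second order in the perturbation. -/
lemma IsCrit.value_near_one {a : ℝ} (h : IsCrit α β κ a) (hs : SmallCoeffs e α β κ)
    (he : e ≤ 1 / 1000) (ha : |a - 1| ≤ 5 * e) :
    |(jouk α β κ a).re - (2 + α + β + κ)| ≤ 26 * e ^ 2 := by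
  have he0 := hs.nonneg
  obtain ⟨-, q2⟩ := norm_bounds_of_sub_one (h.joukQuot_sub_one hs (v := 1) (by simp))
  have h1 := h.jouk_sub (v := 1) one_ne_zero
  have h2 : (jouk α β κ 1 - jouk α β κ a).re = (2 + α + β + κ) - (jouk α β κ a).re := by
    rw [sub_re]
    simp [jouk]
    ring
  rw [abs_sub_comm, ← h2, h1]
  refine (abs_re_le_norm _).trans ?_
  rw [div_one, norm_mul, norm_pow]
  have h3 : ‖(1 : ℂ) - a‖ = |a - 1| := by
    rw [abs_sub_comm, ← Real.norm_eq_abs, ← Complex.norm_real]; push_cast; rfl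
  rw [h3]
  calc |a - 1| ^ 2 * ‖joukQuot β κ a 1‖ ≤ (5 * e) ^ 2 * 1.02 := by
        gcongr
        linarith
    _ ≤ 26 * e ^ 2 := by nlinarith

lemma jouk_neg (v : ℂ) : jouk α β κ (-v) = -jouk α (-β) κ v := by
  unfold jouk
  push_cast
  rw [inv_neg]
  ring

/-- Real arguments beyond a critical value have a real preimage in `lowerDom`. For the critical
point near `1` the condition reads `J(a) ≤ X`, for that near `-1` it reads `X ≤ J(a)`. -/
lemma joukInv_im_eq_zero {a : ℝ} (h : IsCrit α β κ a) (hs : SmallCoeffs e α β κ)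
    (he : e ≤ 1 / 1000) {X : ℝ} (hX : a * ((jouk α β κ a).re - X) ≤ 0) :
    (joukInv α β κ X).im = 0 := by
  have he0 := hs.nonneg
  have hcont : ContinuousOn (fun t : ℝ => t * a * X - (1 + (1 + α) * (t * a) ^ 2
      + β * (t * a) ^ 3 + κ * (t * a) ^ 4)) (Icc 0 1) := by fun_prop
  have ha0 := h.ne_zero
  -- a real preimage `t a`, `0 ≤ t ≤ 1`, between `0` and the critical point
  have h1 : a * (jouk α β κ a).re = 1 + (1 + α) * a ^ 2 + β * a ^ 3 + κ * a ^ 4 := by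
    rw [jouk_ofReal, ofReal_re]; field_simp
  obtain ⟨t, ⟨ht0, ht1⟩, ht⟩ := intermediate_value_Icc (by norm_num : (0 : ℝ) ≤ 1) hcont
    (show (0 : ℝ) ∈ Icc _ _ by
      constructor
      · norm_num
      · simp only [one_mul]; linarith)
  simp only at ht
  have hv : (((t * a : ℝ) : ℂ)) * X = joukNum α β κ ((t * a : ℝ) : ℂ) := by
    unfold joukNum
    exact_mod_cast sub_eq_zero.1 ht
  have hle := h.le
  have hta : |t * a| ≤ 1.01 := by
    rw [abs_mul, abs_of_nonneg ht0]; nlinarith [abs_nonneg a]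
  have hmem : ((t * a : ℝ) : ℂ) ∈ lowerDom α β κ := by
    refine ⟨by simp, ?_, ?_⟩
    · rw [Complex.norm_real, Real.norm_eq_abs]; linarith
    · simp only [normSq_ofReal, joukSlope, ofReal_re, ofReal_im]
      have k1 : t * a * (t * a) * (1 + α + 2 * β * (t * a) + κ * (3 * (t * a) ^ 2 - 0 ^ 2)) - 1 =
          -((1 - t) * a ^ 2 * ((1 + α) * (t + 1) + 2 * β * a * (t ^ 2 + t + 1)
            + 3 * κ * a ^ 2 * (t ^ 3 + t ^ 2 + t + 1))) := by
        linear_combination h.crit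
      have k2 : 0 ≤ (1 + α) * (t + 1) + 2 * β * a * (t ^ 2 + t + 1)
            + 3 * κ * a ^ 2 * (t ^ 3 + t ^ 2 + t + 1) := by
        obtain ⟨hα, hβ, hκ⟩ := hs
        have ht2 : t ^ 2 ≤ 1 := pow_le_one₀ ht0 ht1
        have ht3 : t ^ 3 ≤ 1 := pow_le_one₀ ht0 ht1
        have ht2' : 0 ≤ t ^ 2 := by positivity
        have ht3' : 0 ≤ t ^ 3 := by positivity
        have t1 : |2 * β * a * (t ^ 2 + t + 1)| ≤ 2 * e * 1.01 * 3 := by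
          rw [abs_mul, abs_mul, abs_mul, abs_two, abs_of_nonneg (by positivity : 0 ≤ t ^ 2 + t + 1)]
          gcongr; linarith
        have t2 : |3 * κ * a ^ 2 * (t ^ 3 + t ^ 2 + t + 1)| ≤ 3 * e * 1.01 ^ 2 * 4 := by
          rw [abs_mul, abs_mul, abs_mul, abs_pow, abs_of_pos (by norm_num : (0 : ℝ) < 3),
            abs_of_nonneg (by positivity : 0 ≤ t ^ 3 + t ^ 2 + t + 1)]
          gcongr; linarith
        rw [abs_le] at t1 t2 hα
        nlinarith
      have k3 : 0 ≤ (1 - t) * a ^ 2 * ((1 + α) * (t + 1) + 2 * β * a * (t ^ 2 + t + 1)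
            + 3 * κ * a ^ 2 * (t ^ 3 + t ^ 2 + t + 1)) :=
        mul_nonneg (mul_nonneg (by linarith) (sq_nonneg _)) k2
      linarith
  rw [← joukInv_unique hs he (by simp) hmem hv]
  simp

/-! ### Imaginary part near the upper edge -/

/-- With `S = 1 - |v|² C(v)`, so that `Im J(v) = -Im v * S / |v|²`, expressed around a critical
point. -/
lemma IsCrit.one_sub_slope {a : ℝ} (h : IsCrit α β κ a) (v : ℂ) :
    1 - normSq v * joukSlope α β κ v = (a ^ 2 - normSq v) / a ^ 2
      - normSq v * (2 * β * (v.re - a) + κ * (3 * (v.re + a) * (v.re - a) - v.im ^ 2)) := by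
  have h0 := h.ne_zero
  have h1 := h.inv_sq
  rw [sub_div, div_self (pow_ne_zero _ h0), joukSlope, div_eq_mul_one_div (normSq v), h1]
  ring

/-- The deviation of `S` from its unperturbed value, in the coordinates `v = x + i y`, with
`n = |v|²`. -/
lemma slope_error_bound {a x y n : ℝ} (he0 : 0 ≤ e) (hβ : |β| ≤ e) (hκ : |κ| ≤ e)
    (ha : |a| ≤ 1.01) (hx : |x| ≤ 1.01) (hy : |y| ≤ 1.01) (hn0 : 0 ≤ n) (hn : n ≤ 1.03) :
    |n * (2 * β * (x - a) + κ * (3 * (x + a) * (x - a) - y ^ 2))| ≤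
      9 * e * |x - a| + 2 * e * |y| := by
  have hxa : |x + a| ≤ 2.02 := (abs_add_le _ _).trans (by linarith)
  have t1 : |2 * β * (x - a)| ≤ 2 * e * |x - a| := by
    rw [abs_mul, abs_mul, abs_two]; gcongr
  have t2 : |3 * (x + a) * (x - a) - y ^ 2| ≤ 6.1 * |x - a| + 1.01 * |y| := by
    refine (abs_sub _ _).trans ?_
    have q1 : |3 * (x + a) * (x - a)| ≤ 3 * 2.02 * |x - a| := by
      rw [abs_mul, abs_mul, abs_of_pos (by norm_num : (0 : ℝ) < 3)]; gcongr
    have q2 : |y ^ 2| ≤ 1.01 * |y| := by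
      rw [pow_two, abs_mul]; gcongr
    linarith [abs_nonneg (x - a)]
  have t3 : |κ * (3 * (x + a) * (x - a) - y ^ 2)| ≤ e * (6.1 * |x - a| + 1.01 * |y|) := by
    rw [abs_mul]; gcongr
  have t4 := (abs_add_le (2 * β * (x - a)) (κ * (3 * (x + a) * (x - a) - y ^ 2))).trans
    (add_le_add t1 t3)
  rw [abs_mul, abs_of_nonneg hn0]
  refine (mul_le_mul hn t4 (abs_nonneg _) (by norm_num)).trans ?_
  have := mul_nonneg he0 (abs_nonneg (x - a))
  have := mul_nonneg he0 (abs_nonneg y)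
  nlinarith

/-- The bound of `slope_lower_bound` in the case `a ≤ x`. There both constraints `0 ≤ S` and
`Re J(v) ≥ J(a)` can only hold at `v = a`. -/
lemma slope_lower_bound_right {a x y n S Er D x0 : ℝ} (hx0 : 0 < x0) (hx0x : x0 ≤ x)
    (hee : e ≤ x0 ^ 2 / 100) (ha1 : 0.99 ≤ a) (ha2 : a ≤ 1.01) (hx : x ≤ 1.01)
    (hn : n = x ^ 2 + y ^ 2) (hS : S = (a ^ 2 - n) / a ^ 2 - Er)
    (hEr : |Er| ≤ 9 * e * |x - a| + 2 * e * |y|) (hax : a ≤ x) (hS0 : 0 ≤ S)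
    (hD2 : D ^ 2 = (x - a) ^ 2 + y ^ 2)
    (hH : -(18 * e * ((x - a) ^ 2 + y ^ 2)) ≤ x * ((x - a) ^ 2 - y ^ 2) + 2 * (x - a) * y ^ 2) :
    x0 / 3 * D ≤ S := by
  have hx0' : x0 ≤ 1.01 := hx0x.trans hx
  have he1 : e ≤ 0.0103 := by nlinarith
  have hS' : a ^ 2 * S = a ^ 2 - n - a ^ 2 * Er := by
    rw [hS]
    have : a ≠ 0 := by linarith
    field_simp
  have ha2' : a ^ 2 ≤ 1.03 := by nlinarith
  have hErn : 0 ≤ |Er| := abs_nonneg _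
  have hy2 : |y| ^ 2 = y ^ 2 := sq_abs y
  have hyn := abs_nonneg y
  have haEr : a ^ 2 * |Er| ≤ 1.03 * |Er| := mul_le_mul_of_nonneg_right ha2' hErn
  have hErabs := abs_le.1 (le_refl |Er|)
  have haEr1 : -(a ^ 2 * |Er|) ≤ a ^ 2 * Er ∧ a ^ 2 * Er ≤ a ^ 2 * |Er| := by
    constructor
    · have := mul_le_mul_of_nonneg_left hErabs.1 (sq_nonneg a)
      linarith
    · exact mul_le_mul_of_nonneg_left hErabs.2 (sq_nonneg a)
  have hd : 0 ≤ x - a := by linarith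
  rw [abs_of_nonneg hd] at hEr
  set p := x - a with hp
  have hS2 : 0 ≤ a ^ 2 * S := mul_nonneg (sq_nonneg _) hS0
  have k1 : (x + a) * p + y ^ 2 ≤ 1.03 * (9 * e * p + 2 * e * |y|) := by
    have : n - a ^ 2 = (x + a) * p + y ^ 2 := by rw [hn, hp]; ring
    linarith [haEr1.1]
  have k2 : 1.98 * p ≤ (x + a) * p := mul_le_mul_of_nonneg_right (by linarith) hd
  have k3 : e * p ≤ 0.0103 * p := mul_le_mul_of_nonneg_right he1 hd
  have k4 : e * |y| ≤ 0.0103 * |y| := mul_le_mul_of_nonneg_right he1 hyn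
  have k5 : p ≤ 0.02 * |y| := by nlinarith [sq_nonneg y]
  have k6 : p ^ 2 ≤ 0.0004 * y ^ 2 := by
    rw [← hy2]
    have := mul_self_le_mul_self hd k5
    nlinarith
  have hyy := sq_nonneg y
  have k7 : p * y ^ 2 ≤ 0.03 * y ^ 2 := mul_le_mul_of_nonneg_right (by linarith) hyy
  have k8 : e * (p ^ 2 + y ^ 2) ≤ 0.0103 * (p ^ 2 + y ^ 2) :=
    mul_le_mul_of_nonneg_right he1 (by positivity)
  have k9 : x * p ^ 2 ≤ 1.01 * p ^ 2 := mul_le_mul_of_nonneg_right hx (sq_nonneg _)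
  have k10 : 0.99 * y ^ 2 ≤ x * y ^ 2 := mul_le_mul_of_nonneg_right (by linarith) hyy
  have hy0 : y ^ 2 ≤ 0 := by linarith
  have hp0 : p ^ 2 ≤ 0 := by linarith
  have hDz : D = 0 := by
    have : D ^ 2 ≤ 0 := by rw [hD2]; linarith
    exact (pow_eq_zero_iff two_ne_zero).1 (le_antisymm this (sq_nonneg D))
  rw [hDz]; simpa using hS0

/-- The bound of `slope_lower_bound` in the case `x < a`. There `Re J(v) ≥ J(a)` forces `|y|` to be
at most of the order of `a - x`, so that `S` is of the order of `x (a - x)`. -/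
lemma slope_lower_bound_left {a x y n S Er D x0 : ℝ} (he0 : 0 ≤ e) (hx0 : 0 < x0) (hx0x : x0 ≤ x)
    (hee : e ≤ x0 ^ 2 / 100) (ha1 : 0.99 ≤ a) (ha2 : a ≤ 1.01) (hx : x ≤ 1.01)
    (hn : n = x ^ 2 + y ^ 2) (hS : S = (a ^ 2 - n) / a ^ 2 - Er)
    (hEr : |Er| ≤ 9 * e * |x - a| + 2 * e * |y|) (hax : x < a) (hS0 : 0 ≤ S) (hD : 0 ≤ D)
    (hD2 : D ^ 2 = (x - a) ^ 2 + y ^ 2)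
    (hH : -(18 * e * ((x - a) ^ 2 + y ^ 2)) ≤ x * ((x - a) ^ 2 - y ^ 2) + 2 * (x - a) * y ^ 2) :
    x0 / 3 * D ≤ S := by
  have hx0' : x0 ≤ 1.01 := hx0x.trans hx
  have he1 : e ≤ 0.0103 := by nlinarith
  have hS' : a ^ 2 * S = a ^ 2 - n - a ^ 2 * Er := by
    rw [hS]
    have : a ≠ 0 := by linarith
    field_simp
  have ha2' : a ^ 2 ≤ 1.03 := by nlinarith
  have hErn : 0 ≤ |Er| := abs_nonneg _
  have hy2 : |y| ^ 2 = y ^ 2 := sq_abs y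
  have hyn := abs_nonneg y
  have haEr : a ^ 2 * |Er| ≤ 1.03 * |Er| := mul_le_mul_of_nonneg_right ha2' hErn
  have hErabs := abs_le.1 (le_refl |Er|)
  have haEr1 : -(a ^ 2 * |Er|) ≤ a ^ 2 * Er ∧ a ^ 2 * Er ≤ a ^ 2 * |Er| := by
    constructor
    · have := mul_le_mul_of_nonneg_left hErabs.1 (sq_nonneg a)
      linarith
    · exact mul_le_mul_of_nonneg_left hErabs.2 (sq_nonneg a)
  have hd : 0 < a - x := by linarith
  rw [abs_sub_comm, abs_of_pos hd] at hEr
  set p := a - x with hp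
  have e1 : (x - a) ^ 2 = p ^ 2 := by rw [hp]; ring
  have e2 : x - a = -p := by rw [hp]; ring
  rw [e1] at hH hD2
  rw [e2] at hH
  have hxpos : 0 < x := by linarith
  have hex : 100 * e ≤ x ^ 2 := by
    have := pow_le_pow_left₀ hx0.le hx0x 2
    linarith
  have hex' : 100 * e ≤ 1.01 * x := by
    have := mul_le_mul_of_nonneg_right hx hxpos.le
    linarith
  have hyy := sq_nonneg y
  have hpp := sq_nonneg p
  have hpx : p = a - x := rfl
  have k1 : y ^ 2 ≤ p ^ 2 * (1 + 0.45 * x) := by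
    have m1 : (x - 18 * e) * y ^ 2 ≤ (x + 18 * e) * p ^ 2 := by
      have := mul_nonneg hd.le hyy
      linarith
    have m2 : (x + 18 * e) ≤ (x - 18 * e) * (1 + 0.45 * x) := by
      have := mul_le_mul_of_nonneg_left hx he0
      linarith
    have m3 : (x + 18 * e) * p ^ 2 ≤ (x - 18 * e) * (1 + 0.45 * x) * p ^ 2 :=
      mul_le_mul_of_nonneg_right m2 hpp
    have m4 : (x - 18 * e) * y ^ 2 ≤ (x - 18 * e) * (p ^ 2 * (1 + 0.45 * x)) := by linarith
    exact le_of_mul_le_mul_left m4 (by linarith)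
  have k2 : y ^ 2 ≤ 1.46 * p ^ 2 := by
    have := mul_le_mul_of_nonneg_left (by linarith : 1 + 0.45 * x ≤ 1.46) hpp
    linarith
  have k3 : |y| ≤ 1.3 * p := by
    apply abs_le_of_sq_le_sq _ (by linarith)
    linarith
  have k4 : D ≤ 1.6 * p := by
    have : |D| ≤ 1.6 * p := by
      apply abs_le_of_sq_le_sq _ (by linarith)
      linarith
    exact (le_abs_self D).trans this
  have hep : e * |y| ≤ e * (1.3 * p) := mul_le_mul_of_nonneg_left k3 he0
  have hep' : 100 * e * p ≤ 1.01 * x * p := mul_le_mul_of_nonneg_right hex' hd.le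
  have k5 : |Er| ≤ 0.12 * x * p := by linarith
  have k6 : a ^ 2 - n ≥ 1.5 * x * p := by
    have m1 : a ^ 2 - n = (x + a) * p - y ^ 2 := by rw [hn, hp]; ring
    have m2 : p ^ 2 * (1 + 0.45 * x) = p * ((a - x) * (1 + 0.45 * x)) := by rw [← hpx]; ring
    have m3 : (x + a) - (a - x) * (1 + 0.45 * x) ≥ 1.5 * x := by
      have := mul_le_mul_of_nonneg_left (by linarith : a - x ≤ 1.01) hxpos.le
      linarith
    have m4 := mul_le_mul_of_nonneg_left m3 hd.le
    rw [m1]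
    linarith
  have k7 : a ^ 2 * S ≥ 1.3 * x * p := by
    have := mul_pos hxpos hd
    linarith [haEr1.2]
  have k8 : 1.2 * x * p ≤ S := by
    have := mul_le_mul_of_nonneg_right ha2' hS0
    have := mul_pos hxpos hd
    linarith
  have k9 : x0 * D ≤ x * (1.6 * p) := mul_le_mul hx0x k4 hD hxpos.le
  have := mul_pos hxpos hd
  linarith

/-- Points in `lowerDom` lying over energies to the right of the upper edge: there `S` controls the
distance `D` to the critical point. The hypothesis `hH` is the inequality `Re J(v) ≥ J(a)` as
provided by `IsCrit.re_sub_estimate`. The lower bound `x0` on `x` keeps the perturbation `e` small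
compared with the main terms, which degenerate as `x → 0`. -/
lemma slope_lower_bound {a x y n S Er D x0 : ℝ} (he0 : 0 ≤ e) (hx0 : 0 < x0) (hx0x : x0 ≤ x)
    (hee : e ≤ x0 ^ 2 / 100) (ha1 : 0.99 ≤ a) (ha2 : a ≤ 1.01) (hx : x ≤ 1.01)
    (hn : n = x ^ 2 + y ^ 2) (hS : S = (a ^ 2 - n) / a ^ 2 - Er)
    (hEr : |Er| ≤ 9 * e * |x - a| + 2 * e * |y|) (hS0 : 0 ≤ S) (hD : 0 ≤ D)
    (hD2 : D ^ 2 = (x - a) ^ 2 + y ^ 2)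
    (hH : -(18 * e * ((x - a) ^ 2 + y ^ 2)) ≤ x * ((x - a) ^ 2 - y ^ 2) + 2 * (x - a) * y ^ 2) :
    x0 / 3 * D ≤ S := by
  rcases le_or_gt a x with hax | hax
  · exact slope_lower_bound_right hx0 hx0x hee ha1 ha2 hx hn hS hEr hax hS0 hD2 hH
  · exact slope_lower_bound_left he0 hx0 hx0x hee ha1 ha2 hx hn hS hEr hax hS0 hD hD2 hH

/-- Over energies to the left of the upper edge, expressed by `hH`, the ordinate `y` controls the
distance `D` to the critical point. -/
lemma im_lower_bound {a x y D x0 : ℝ} (hx0 : 0 < x0) (hx0x : x0 ≤ x)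
    (hee : e ≤ x0 ^ 2 / 100) (ha2 : a ≤ 1.01) (hx : x ≤ 1.01)
    (hD2 : D ^ 2 = (x - a) ^ 2 + y ^ 2)
    (hH : x * ((x - a) ^ 2 - y ^ 2) + 2 * (x - a) * y ^ 2 ≤ 18 * e * ((x - a) ^ 2 + y ^ 2)) :
    x0 * D ^ 2 ≤ 6 * y ^ 2 := by
  have hxpos : 0 < x := by linarith
  have hex : 100 * e ≤ x ^ 2 := by nlinarith
  have hex' : 100 * e ≤ 1.01 * x := by nlinarith
  have hyy := sq_nonneg y
  have hpp := sq_nonneg (x - a)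
  have k1 := mul_le_mul_of_nonneg_right hex' hpp
  have k2 := mul_le_mul_of_nonneg_right hex' hyy
  have k3 := mul_le_mul_of_nonneg_right hx hyy
  have k4 := mul_le_mul_of_nonneg_right ha2 hyy
  have k5 := mul_le_mul_of_nonneg_right hx0x hpp
  have k6 := mul_le_mul_of_nonneg_right hx0x hyy
  have k7 := mul_nonneg hxpos.le hyy
  rw [hD2]
  nlinarith

/-- The sign of `Re J(v) - J(a)`, up to the perturbation, in terms of the coordinates of `v - a`. -/
lemma IsCrit.re_sub_estimate {a : ℝ} (h : IsCrit α β κ a) (hs : SmallCoeffs e α β κ)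
    {v : ℂ} (hv : ‖v‖ ≤ 1.01) (hv0 : v ≠ 0) :
    |normSq v * (jouk α β κ v - jouk α β κ a).re -
      (v.re * ((v.re - a) ^ 2 - v.im ^ 2) + 2 * (v.re - a) * v.im ^ 2)| ≤
      18 * e * ((v.re - a) ^ 2 + v.im ^ 2) := by
  have he0 := hs.nonneg
  have hq := h.joukQuot_sub_one hs (v := v) (by linarith)
  have hn : (normSq v : ℂ) = v * (starRingEnd ℂ) v := (mul_conj v).symm
  have e1 : (normSq v : ℂ) * (jouk α β κ v - jouk α β κ a) =
      (v - a) ^ 2 * (starRingEnd ℂ) v * (joukQuot β κ a v - 1)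
        + (v - a) ^ 2 * (starRingEnd ℂ) v := by
    rw [h.jouk_sub hv0, hn]
    field_simp
    ring
  have e2 : ((v - a) ^ 2 * (starRingEnd ℂ) v).re =
      v.re * ((v.re - a) ^ 2 - v.im ^ 2) + 2 * (v.re - a) * v.im ^ 2 := by
    simp only [pow_two, mul_re, mul_im, sub_re, sub_im, conj_re, conj_im, ofReal_re, ofReal_im]
    ring
  have e3 : normSq v * (jouk α β κ v - jouk α β κ a).re =
      ((normSq v : ℂ) * (jouk α β κ v - jouk α β κ a)).re := by
    rw [re_ofReal_mul]
  rw [e3, e1, add_re, e2, add_sub_cancel_right]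
  refine (abs_re_le_norm _).trans ?_
  rw [norm_mul, norm_mul, norm_pow, Complex.norm_conj]
  have e4 : ‖v - a‖ ^ 2 = (v.re - a) ^ 2 + v.im ^ 2 := by
    rw [Complex.sq_norm, normSq_apply]
    simp
    ring
  rw [← e4]
  calc ‖v - a‖ ^ 2 * ‖v‖ * ‖joukQuot β κ a v - 1‖ ≤ ‖v - a‖ ^ 2 * 1.01 * (17 * e) := by gcongr
    _ ≤ 18 * e * ‖v - a‖ ^ 2 := by
      have := mul_nonneg he0 (sq_nonneg ‖v - a‖)
      nlinarith

/-- To the right of the middle of the spectrum, points of `lowerDom` have positive real part. -/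
lemma re_lower_bound (hs : SmallCoeffs e α β κ) (he : e ≤ 1 / 1000)
    {v : ℂ} (hv : ‖v‖ ≤ 1.01) (hv0 : v ≠ 0) (hre : 0.98 ≤ (jouk α β κ v).re) :
    0.4 * ‖v‖ ^ 2 ≤ v.re := by
  have he0 := hs.nonneg
  obtain ⟨hα, hβ, hκ⟩ := hs
  rw [jouk_re] at hre
  have hn : ‖v‖ ^ 2 = v.re ^ 2 + v.im ^ 2 := by rw [Complex.sq_norm, normSq_apply]; ring
  have hns : normSq v = ‖v‖ ^ 2 := (Complex.sq_norm v).symm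
  have hn1 : ‖v‖ ^ 2 ≤ 1.03 := by nlinarith [norm_nonneg v]
  have hnpos : 0 < ‖v‖ ^ 2 := by positivity
  obtain ⟨hx, hy⟩ := abs_re_im_le hv
  set x := v.re
  set y := v.im
  set n := ‖v‖ ^ 2
  have t1 : β * (x ^ 2 - y ^ 2) ≤ e * 1.03 := by
    refine (le_abs_self _).trans ?_
    rw [abs_mul]
    refine mul_le_mul hβ ?_ (abs_nonneg _) he0
    rw [abs_le]; constructor <;> nlinarith [sq_nonneg x, sq_nonneg y]
  have t2 : κ * (x ^ 3 - 3 * x * y ^ 2) ≤ e * 4.5 := by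
    refine (le_abs_self _).trans ?_
    rw [abs_mul]
    refine mul_le_mul hκ ?_ (abs_nonneg _) he0
    rw [show x ^ 3 - 3 * x * y ^ 2 = x * (x ^ 2 - 3 * y ^ 2) by ring, abs_mul]
    have : |x ^ 2 - 3 * y ^ 2| ≤ 3.1 := by
      rw [abs_le]; constructor <;> nlinarith [sq_nonneg x, sq_nonneg y]
    have := mul_le_mul hx this (abs_nonneg _) (by norm_num)
    linarith
  rw [abs_le] at hα
  have h1 : 0.97 ≤ x * (n⁻¹ + (1 + α)) := by rw [hns] at hre; linarith
  have hi : 0 < n⁻¹ := by positivity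
  have hxpos : 0 < x := by
    by_contra hlt
    push Not at hlt
    have := mul_nonpos_of_nonpos_of_nonneg hlt (by linarith : 0 ≤ n⁻¹ + (1 + α))
    linarith
  have h2 : 0.97 * n ≤ x * (1 + (1 + α) * n) := by
    have h3 := mul_le_mul_of_nonneg_right h1 hnpos.le
    have h4 : x * (n⁻¹ + (1 + α)) * n = x * (1 + (1 + α) * n) := by
      field_simp
    linarith
  have h3 : 1 + (1 + α) * n ≤ 2.05 := by nlinarith
  have h4 := mul_le_mul_of_nonneg_left h3 hxpos.le
  linarith

/-! ### Stieltjes representation of functions on the upper half-plane -/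

lemma norm_le_div_of_mul_le {a b C : ℝ} (hb : 0 < b) (h : a * b ≤ C) : a ≤ C / b :=
  (le_div_iff₀ hb).2 h

/-- Cauchy's theorem on a half-plane, for functions decaying like `|ζ|⁻²`. -/
lemma integral_horizontal_eq_zero {h : ℂ → ℂ} {c η R C : ℝ} (hη0 : 0 < η) (hη : c < η)
    (hd : DifferentiableOn ℂ h {ζ | c < ζ.im})
    (hb : ∀ ζ : ℂ, η ≤ ζ.im → R ≤ ‖ζ‖ → ‖h ζ‖ * ‖ζ‖ ^ 2 ≤ C) :
    Integrable (fun x : ℝ => h (x + η * I)) ∧ ∫ x : ℝ, h (x + η * I) = 0 := by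
  -- a bound on the whole closed half-plane
  obtain ⟨C', hC'⟩ : ∃ C', ∀ ζ : ℂ, η ≤ ζ.im → ‖h ζ‖ * (1 + ‖ζ‖ ^ 2) ≤ C' := by
    have hK : IsCompact ({ζ : ℂ | η ≤ ζ.im} ∩ Metric.closedBall 0 (max R 1)) :=
      (isCompact_closedBall _ _).inter_left (isClosed_le continuous_const continuous_im)
    have hc : ContinuousOn (fun ζ => ‖h ζ‖ * (1 + ‖ζ‖ ^ 2))
        ({ζ : ℂ | η ≤ ζ.im} ∩ Metric.closedBall 0 (max R 1)) := by
      have : ContinuousOn h ({ζ : ℂ | η ≤ ζ.im} ∩ Metric.closedBall 0 (max R 1)) :=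
        hd.continuousOn.mono fun ζ hζ => lt_of_lt_of_le hη hζ.1
      fun_prop
    obtain ⟨B, hB⟩ := hK.bddAbove_image hc
    refine ⟨max B (2 * C), fun ζ hζ => ?_⟩
    rcases le_or_gt ‖ζ‖ (max R 1) with hle | hgt
    · exact (hB ⟨ζ, ⟨hζ, by simpa using hle⟩, rfl⟩).trans (le_max_left _ _)
    · have h1 := hb ζ hζ (le_trans (le_max_left _ _) hgt.le)
      have h2 : 1 ≤ ‖ζ‖ ^ 2 := one_le_pow₀ (le_trans (le_max_right _ _) hgt.le)
      have h3 := mul_le_mul_of_nonneg_left h2 (norm_nonneg (h ζ))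
      refine le_trans ?_ (le_max_right _ _)
      linarith
  have hcont : ∀ y : ℝ, η ≤ y → Continuous fun x : ℝ => h (x + y * I) := fun y hy =>
    hd.continuousOn.comp_continuous (by fun_prop) fun x => by
      simpa using lt_of_lt_of_le hη hy
  have hnorm : ∀ x y : ℝ, |x| ≤ ‖(x + y * I : ℂ)‖ ∧ |y| ≤ ‖(x + y * I : ℂ)‖ := fun x y =>
    ⟨by simpa using abs_re_le_norm (x + y * I : ℂ), by simpa using abs_im_le_norm (x + y * I : ℂ)⟩
  have hC0 : 0 ≤ C' := le_trans (by positivity) (hC' (η * I) (by simp))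
  have hptw : ∀ x y t : ℝ, η ≤ y → t ^ 2 ≤ ‖(x + y * I : ℂ)‖ ^ 2 →
      ‖h (x + y * I)‖ ≤ C' * (1 + t ^ 2)⁻¹ := by
    intro x y t hy ht
    rw [← div_eq_mul_inv]
    apply norm_le_div_of_mul_le (by positivity)
    refine le_trans ?_ (hC' (x + y * I) (by simpa using hy))
    gcongr
  have hint : Integrable fun x : ℝ => h (x + η * I) := by
    refine (integrable_inv_one_add_sq.const_mul C').mono' (hcont η le_rfl).aestronglyMeasurable ?_
    refine Eventually.of_forall fun x => hptw x η x le_rfl ?_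
    rw [← sq_abs x]
    exact pow_le_pow_left₀ (abs_nonneg _) (hnorm x η).1 2
  refine ⟨hint, ?_⟩
  have hlim := intervalIntegral_tendsto_integral hint tendsto_neg_atTop_atBot tendsto_id
  refine tendsto_nhds_unique hlim (squeeze_zero_norm' (a := fun T : ℝ => 4 * C' * T⁻¹) ?_ ?_)
  · filter_upwards [eventually_gt_atTop 0] with T hT
    have hrect := integral_boundary_rect_eq_zero_of_differentiableOn h
      ((-T : ℝ) + η * I) ((T : ℝ) + (η + T : ℝ) * I) (hd.mono ?_)
    · simp only [add_re, ofReal_re, mul_re, I_re, mul_zero, ofReal_im, I_im, mul_one, sub_self,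
        add_zero, add_im, mul_im, zero_add] at hrect
      have hTT : (1 + T ^ 2)⁻¹ ≤ T⁻¹ * T⁻¹ := by
        rw [← mul_inv]
        apply inv_anti₀ (by positivity)
        nlinarith
      have hTC : C' * (1 + T ^ 2)⁻¹ ≤ C' * (T⁻¹ * T⁻¹) := by gcongr
      have b1 : ‖∫ x in (-T)..T, h (x + (η + T : ℝ) * I)‖ ≤ C' * (T⁻¹ * T⁻¹) * |T - -T| := by
        apply intervalIntegral.norm_integral_le_of_norm_le_const
        intro x _
        refine (hptw x (η + T) T (by linarith) ?_).trans hTC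
        exact pow_le_pow_left₀ hT.le
          (le_trans (by rw [abs_of_pos (by linarith)]; linarith) (hnorm x (η + T)).2) 2
      have b2 : ∀ s : ℝ, |s| = T →
          ‖∫ y in η..(η + T), h (s + y * I)‖ ≤ C' * (T⁻¹ * T⁻¹) * |η + T - η| := by
        intro s hs
        apply intervalIntegral.norm_integral_le_of_norm_le_const
        intro y hy
        rw [uIoc_of_le (by linarith)] at hy
        refine (hptw s y T hy.1.le ?_).trans hTC
        rw [← hs]
        exact pow_le_pow_left₀ (abs_nonneg _) (hnorm s y).1 2
      have b2' := b2 T (abs_of_pos hT)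
      have b3' := b2 (-T) (by rw [abs_neg, abs_of_pos hT])
      have e1 : (∫ x in (-T)..T, h (x + η * I)) = (∫ x in (-T)..T, h (x + (η + T : ℝ) * I))
          - I • (∫ y in η..(η + T), h (T + y * I))
          + I • (∫ y in η..(η + T), h ((-T : ℝ) + y * I)) := by
        linear_combination hrect
      simp only [id]
      rw [e1]
      refine (norm_add_le _ _).trans ((add_le_add (norm_sub_le _ _) le_rfl).trans ?_)
      rw [norm_smul, norm_smul, norm_I, one_mul, one_mul]
      rw [show T - -T = 2 * T by ring, abs_of_pos (by linarith)] at b1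
      rw [add_sub_cancel_left, abs_of_pos hT] at b2' b3'
      have e2 : C' * (T⁻¹ * T⁻¹) * T = C' * T⁻¹ := by field_simp
      linarith
    · rintro ζ ⟨-, hζ⟩
      simp only [add_im, ofReal_im, mul_im, ofReal_re, I_im, mul_one, I_re, mul_zero, add_zero,
        zero_add, mem_preimage] at hζ
      rw [uIcc_of_le (by linarith)] at hζ
      exact lt_of_lt_of_le hη hζ.1
  · have := (tendsto_inv_atTop_zero (𝕜 := ℝ)).const_mul (4 * C')
    simpa using this

/-- The Poisson kernel of the half-plane, before normalization. -/
lemma integral_poisson (x₀ : ℝ) {y : ℝ} (hy : 0 < y) :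
    Integrable (fun x : ℝ => ((x - x₀) ^ 2 + y ^ 2)⁻¹) ∧
      ∫ x : ℝ, ((x - x₀) ^ 2 + y ^ 2)⁻¹ = Real.pi / y := by
  have hy' : y.toNNReal ≠ 0 := by simpa using hy
  have h1 := integral_cauchyPDFReal_eq_one x₀ hy'
  have h2 := integrable_cauchyPDFReal x₀ (γ := y.toNNReal)
  have e : cauchyPDFReal x₀ y.toNNReal = fun x => (Real.pi⁻¹ * y) * ((x - x₀) ^ 2 + y ^ 2)⁻¹ := by
    funext x; rw [cauchyPDFReal_def, Real.coe_toNNReal _ hy.le]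
  have hne : Real.pi⁻¹ * y ≠ 0 := by positivity
  rw [e] at h1 h2
  rw [integral_const_mul] at h1
  refine ⟨(integrable_const_mul_iff (IsUnit.mk0 _ hne) _).1 h2, ?_⟩
  field_simp at h1 ⊢
  linarith

/-- Cauchy's formula on a horizontal line, for a function decaying like `|ζ|⁻¹`. The pole is
removed with `dslope`, and the kernel at the reflection of `z` across the line eliminates the real
part. -/
lemma integral_im_div_horizontal {g : ℂ → ℂ} {A η : ℝ} {z : ℂ} (hη : 0 < η) (hz : η < z.im)
    (hd : DifferentiableOn ℂ g {ζ | 0 < ζ.im}) (hb : ∀ ζ : ℂ, 0 < ζ.im → ‖g ζ‖ * ‖ζ‖ ≤ A) :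
    ∫ x : ℝ, ((g (x + η * I)).im : ℂ) / (x + η * I - z) = Real.pi * g z := by
  set z' : ℂ := (starRingEnd ℂ) z + 2 * η * I with hz'
  have hz'im : z'.im = 2 * η - z.im := by simp [hz']; ring
  have hz0 : 0 < z.im := hη.trans hz
  have hA : 0 ≤ A := le_trans (by positivity) (hb z hz0)
  have hopen : IsOpen {ζ : ℂ | 0 < ζ.im} := isOpen_lt continuous_const continuous_im
  have hne' : ∀ ζ : ℂ, η ≤ ζ.im → ζ - z' ≠ 0 := by
    intro ζ hζ h
    have := congrArg im h
    rw [sub_im, hz'im, zero_im] at this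
    linarith
  have hfar : ∀ p ζ : ℂ, 2 * ‖p‖ ≤ ‖ζ‖ → ‖ζ‖ / 2 ≤ ‖ζ - p‖ := by
    intro p ζ h
    have := norm_sub_norm_le ζ p
    linarith
  set s : ℝ := max 0 (2 * η - z.im) with hs
  have hsη : s < η := max_lt hη (by linarith)
  have hsub : {ζ : ℂ | s < ζ.im} ⊆ {ζ : ℂ | 0 < ζ.im} := fun ζ (hζ : s < ζ.im) =>
    show 0 < ζ.im from lt_of_le_of_lt (le_max_left _ _) hζ
  have hkernel : ∀ k : ℂ → ℂ, DifferentiableOn ℂ k {ζ | 0 < ζ.im} →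
      DifferentiableOn ℂ (fun ζ => k ζ / (ζ - z')) {ζ | s < ζ.im} := by
    intro k hk
    refine (hk.mono hsub).div (by fun_prop) fun ζ hζ h => ?_
    have h1 := congrArg im h
    have h2 : s < ζ.im := hζ
    have h3 : 2 * η - z.im ≤ s := le_max_right _ _
    rw [sub_im, hz'im, zero_im] at h1
    linarith
  obtain ⟨hi2, h2⟩ := integral_horizontal_eq_zero (R := 2 * ‖z'‖) (C := 2 * A) hη hsη
    (hkernel g hd) (by
    intro ζ hζ hR
    have h1 := hb ζ (lt_of_lt_of_le hη hζ)
    have h3 := hfar z' ζ hR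
    have h4 : 0 < ‖ζ - z'‖ := norm_pos_iff.2 (hne' ζ hζ)
    rw [norm_div, div_mul_eq_mul_div, div_le_iff₀ h4]
    nlinarith [norm_nonneg ζ, norm_nonneg (g ζ)])
  have hds : DifferentiableOn ℂ (dslope g z) {ζ | 0 < ζ.im} :=
    (differentiableOn_dslope (hopen.mem_nhds hz0)).2 hd
  obtain ⟨hi1, h1⟩ := integral_horizontal_eq_zero (R := 2 * ‖z'‖ ⊔ 2 * ‖z‖ ⊔ 1)
    (C := 4 * (A + ‖g z‖)) hη hsη (hkernel _ hds) (by
    intro ζ hζ hR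
    have hR1 : 2 * ‖z'‖ ≤ ‖ζ‖ := le_trans (le_trans (le_max_left _ _) (le_max_left _ _)) hR
    have hR2 : 2 * ‖z‖ ≤ ‖ζ‖ := le_trans (le_trans (le_max_right _ _) (le_max_left _ _)) hR
    have hR3 : 1 ≤ ‖ζ‖ := le_trans (le_max_right _ _) hR
    have hzpos : 0 < ‖z‖ := norm_pos_iff.2 (by rintro rfl; simp at hz0)
    have hne : ζ ≠ z := by rintro rfl; linarith
    have h1 := hb ζ (lt_of_lt_of_le hη hζ)
    have h3 := hfar z' ζ hR1
    have h3' := hfar z ζ hR2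
    have h4 : 0 < ‖ζ - z'‖ := norm_pos_iff.2 (hne' ζ hζ)
    have h4' : 0 < ‖ζ - z‖ := norm_pos_iff.2 (sub_ne_zero.2 hne)
    rw [dslope_of_ne _ hne, slope_def_field, norm_div, norm_div, div_div, div_mul_eq_mul_div,
      div_le_iff₀ (mul_pos h4' h4)]
    have h5 : ‖g ζ‖ ≤ A := le_trans (le_mul_of_one_le_right (norm_nonneg _) hR3) h1
    have h6 : ‖g ζ - g z‖ ≤ A + ‖g z‖ := (norm_sub_le _ _).trans (by linarith)
    have h7 : ‖ζ‖ / 2 * (‖ζ‖ / 2) ≤ ‖ζ - z‖ * ‖ζ - z'‖ :=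
      mul_le_mul h3' h3 (by positivity) (norm_nonneg _)
    have h8 := mul_le_mul_of_nonneg_left h7 (by positivity : 0 ≤ 4 * (A + ‖g z‖))
    have h9 := mul_le_mul_of_nonneg_right h6 (sq_nonneg ‖ζ‖)
    linarith)
  have hyp : 0 < z.im - η := by linarith
  obtain ⟨hi3, h3⟩ := integral_poisson z.re hyp
  have hline : ∀ x : ℝ, (x + η * I - z : ℂ) ≠ 0 := by
    intro x h
    have := congrArg im h
    simp at this
    linarith
  have hline' : ∀ x : ℝ, (x + η * I - z' : ℂ) ≠ 0 := fun x => hne' _ (by simp)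
  have hconj : ∀ x : ℝ, (starRingEnd ℂ) (x + η * I - z' : ℂ) = x + η * I - z := by
    intro x
    simp [hz', map_ofNat]
    ring
  have hprod : ∀ x : ℝ, (x + η * I - z : ℂ) * (x + η * I - z') =
      (((x - z.re) ^ 2 + (z.im - η) ^ 2 : ℝ) : ℂ) := by
    intro x
    rw [← hconj x, mul_comm, mul_conj, normSq_apply]
    simp [hz']
    ring
  have hzz' : z - z' = 2 * (z.im - η) * I := by
    apply Complex.ext <;> simp [hz']
    ring
  -- `g(ζ)/(ζ - z)` in terms of the two kernels
  have hpt : ∀ x : ℝ, g (x + η * I) / (x + η * I - z) = g (x + η * I) / (x + η * I - z')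
      + (z - z') * (dslope g z (x + η * I) / (x + η * I - z')
        + g z * (((((x - z.re) ^ 2 + (z.im - η) ^ 2)⁻¹ : ℝ)) : ℂ)) := by
    intro x
    have hne : (x + η * I : ℂ) ≠ z := sub_ne_zero.1 (hline x)
    rw [dslope_of_ne _ hne, slope_def_field, ofReal_inv, ← hprod]
    have a := hline x
    have b := hline' x
    field_simp
    ring
  have hi3' : Integrable fun x : ℝ => g z * (((((x - z.re) ^ 2 + (z.im - η) ^ 2)⁻¹ : ℝ)) : ℂ) :=
    hi3.ofReal.const_mul _
  have hi4 : Integrable fun x : ℝ => dslope g z (x + η * I) / (x + η * I - z')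
      + g z * (((((x - z.re) ^ 2 + (z.im - η) ^ 2)⁻¹ : ℝ)) : ℂ) := hi1.add hi3'
  have hiA : Integrable fun x : ℝ => g (x + η * I) / (x + η * I - z) := by
    simp_rw [hpt]
    exact hi2.add (hi4.const_mul _)
  have hA' : ∫ x : ℝ, g (x + η * I) / (x + η * I - z) = 2 * Real.pi * I * g z := by
    simp_rw [hpt]
    have h4 := integral_add hi1 hi3'
    rw [integral_add hi2 (hi4.const_mul _), integral_const_mul, h4, h1, h2,
      integral_const_mul, integral_complex_ofReal, h3, hzz']
    have : ((z.im : ℂ) - η) ≠ 0 := by exact_mod_cast hyp.ne'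
    push_cast
    field_simp
    ring
  have hB : ∀ x : ℝ, (starRingEnd ℂ) (g (x + η * I)) / (x + η * I - z) =
      (starRingEnd ℂ) (g (x + η * I) / (x + η * I - z')) := by
    intro x; rw [map_div₀, hconj]
  have hiB : Integrable fun x : ℝ => (starRingEnd ℂ) (g (x + η * I)) / (x + η * I - z) := by
    simp_rw [hB]
    exact (RCLike.conjCLE (K := ℂ)).toContinuousLinearMap.integrable_comp hi2
  have hB' : ∫ x : ℝ, (starRingEnd ℂ) (g (x + η * I)) / (x + η * I - z) = 0 := by
    simp_rw [hB]
    rw [integral_conj, h2, map_zero]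
  have hfin : ∀ x : ℝ, ((g (x + η * I)).im : ℂ) / (x + η * I - z) =
      (2 * I)⁻¹ * (g (x + η * I) / (x + η * I - z)
        - (starRingEnd ℂ) (g (x + η * I)) / (x + η * I - z)) := by
    intro x
    have := Complex.sub_conj (g (x + η * I))
    rw [← sub_div, this]
    field_simp
    push_cast
    ring
  simp_rw [hfin]
  rw [integral_const_mul, integral_sub hiA hiB, hA', hB']
  field_simp
  ring

/-- Integrability of the function that dominates `1 / (√(|x| (1 + |x|)) (1 + |x|))` in
`majorant_bound`. -/
lemma integrable_majorant : Integrable fun x : ℝ =>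
    (Ioc (-1 : ℝ) 1).indicator (fun x => |x| ^ (-(1 / 2) : ℝ)) x + (1 + x ^ 2)⁻¹ := by
  refine Integrable.add ?_ integrable_inv_one_add_sq
  rw [integrable_indicator_iff measurableSet_Ioc, ← intervalIntegrable_iff_integrableOn_Ioc_of_le
    (by norm_num)]
  have h1 : IntervalIntegrable (fun x : ℝ => |x| ^ (-(1 / 2) : ℝ)) volume 0 1 := by
    refine (intervalIntegral.intervalIntegrable_rpow' (a := 0) (b := 1)
      (r := -(1 / 2)) (by norm_num)).congr ?_
    intro x hx
    rw [uIoc_of_le (by norm_num)] at hx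
    simp [abs_of_pos hx.1]
  have h2 : IntervalIntegrable (fun x : ℝ => |x| ^ (-(1 / 2) : ℝ)) volume (-1) 0 := by
    have := (IntervalIntegrable.iff_comp_neg (f := fun x : ℝ => |x| ^ (-(1 / 2) : ℝ)) (a := 0)
      (b := 1) (by simp)).1 h1
    simp only [abs_neg, neg_zero] at this
    exact this.symm
  exact h2.trans h1

lemma majorant_bound {x : ℝ} (hx : x ≠ 0) : (√(|x| * (1 + |x|)) * (1 + |x|))⁻¹ ≤
    (Ioc (-1 : ℝ) 1).indicator (fun x => |x| ^ (-(1 / 2) : ℝ)) x + (1 + x ^ 2)⁻¹ := by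
  have hp : 0 < |x| := abs_pos.2 hx
  rcases le_or_gt 1 |x| with h | h
  · have h1 : |x| ≤ √(|x| * (1 + |x|)) := by
      apply Real.le_sqrt_of_sq_le
      nlinarith
    have h2 : 1 + x ^ 2 ≤ √(|x| * (1 + |x|)) * (1 + |x|) := by
      rw [← sq_abs x]
      have := mul_le_mul_of_nonneg_right h1 (by positivity : 0 ≤ 1 + |x|)
      nlinarith
    refine (inv_anti₀ (by positivity) h2).trans (le_add_of_nonneg_left ?_)
    exact indicator_nonneg (fun y _ => by positivity) x
  · have hmem : x ∈ Ioc (-1 : ℝ) 1 := ⟨(abs_lt.1 h).1, (abs_lt.1 h).2.le⟩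
    rw [indicator_of_mem hmem]
    refine le_trans ?_ (le_add_of_nonneg_right (by positivity))
    rw [Real.rpow_neg hp.le, ← Real.sqrt_eq_rpow]
    apply inv_anti₀ (by positivity)
    have h1 : √|x| ≤ √(|x| * (1 + |x|)) := Real.sqrt_le_sqrt (by nlinarith)
    nlinarith [Real.sqrt_nonneg (|x| * (1 + |x|))]

/-- Stieltjes inversion: a holomorphic function on the upper half-plane that decays at infinity, has
boundary values and an at most inverse-square-root singularity at the origin is the Cauchy
transform of the imaginary part of its boundary values. -/
lemma integral_boundary_im_div {g : ℂ → ℂ} {g0 : ℝ → ℂ} {A : ℝ} {z : ℂ} (hz : 0 < z.im)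
    (hd : DifferentiableOn ℂ g {ζ | 0 < ζ.im})
    (hb : ∀ ζ : ℂ, 0 < ζ.im → ‖g ζ‖ ^ 2 * (‖ζ‖ * (1 + ‖ζ‖)) ≤ A)
    (hlim : ∀ x : ℝ, x ≠ 0 → Tendsto (fun η : ℝ => g (x + η * I)) (𝓝[>] 0) (𝓝 (g0 x))) :
    ∫ x : ℝ, ((g0 x).im : ℂ) / (x - z) = Real.pi * g z := by
  have hA : 0 ≤ A := le_trans (by positivity) (hb z hz)
  have hb1 : ∀ ζ : ℂ, 0 < ζ.im → ‖g ζ‖ * ‖ζ‖ ≤ √A := by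
    intro ζ hζ
    apply Real.le_sqrt_of_sq_le
    refine le_trans ?_ (hb ζ hζ)
    rw [mul_pow]
    gcongr
    nlinarith [norm_nonneg ζ]
  have hev : ∀ᶠ η : ℝ in 𝓝[>] 0, 0 < η ∧ η < z.im / 2 := by
    filter_upwards [Ioo_mem_nhdsGT (by linarith : 0 < z.im / 2)] with η hη using hη
  set C1 : ℝ := (1 + |z.re|) / (z.im / 2) + 1 with hC1
  have hC1pos : 0 < C1 := by positivity
  have hker : ∀ x η : ℝ, 0 < η → η < z.im / 2 → 1 + |x| ≤ C1 * ‖(x + η * I - z : ℂ)‖ := by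
    intro x η h0 h1
    have hr := abs_re_le_norm (x + η * I - z : ℂ)
    have hi := abs_im_le_norm (x + η * I - z : ℂ)
    simp only [sub_re, add_re, ofReal_re, mul_re, I_re, mul_zero, ofReal_im, I_im, mul_one,
      sub_self, add_zero] at hr
    simp only [sub_im, add_im, ofReal_im, mul_im, ofReal_re, I_im, mul_one, I_re, mul_zero,
      add_zero, zero_add] at hi
    rw [abs_sub_comm, abs_of_pos (by linarith)] at hi
    have h2 := abs_sub_abs_le_abs_sub x z.re
    have h3 : (1 + |z.re|) ≤ (1 + |z.re|) / (z.im / 2) * ‖(x + η * I - z : ℂ)‖ := by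
      rw [div_mul_eq_mul_div, le_div_iff₀ (by linarith)]
      exact mul_le_mul_of_nonneg_left (by linarith) (by positivity)
    rw [hC1, add_mul, one_mul]
    linarith
  have hconv := tendsto_integral_filter_of_dominated_convergence (μ := volume) (l := 𝓝[>] (0 : ℝ))
    (F := fun (η : ℝ) (x : ℝ) => ((g (x + η * I)).im : ℂ) / (x + η * I - z))
    (f := fun x : ℝ => ((g0 x).im : ℂ) / (x - z))
    (fun x => √A * C1 * ((Ioc (-1 : ℝ) 1).indicator (fun x => |x| ^ (-(1 / 2) : ℝ)) x
      + (1 + x ^ 2)⁻¹)) ?_ ?_ (integrable_majorant.const_mul _) ?_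
  · refine tendsto_nhds_unique hconv (Tendsto.congr' ?_ tendsto_const_nhds)
    filter_upwards [hev] with η hη
    exact (integral_im_div_horizontal hη.1 (by linarith [hη.2]) hd hb1).symm
  · filter_upwards [hev] with η hη
    have hc : Continuous fun x : ℝ => g (x + η * I) :=
      hd.continuousOn.comp_continuous (by fun_prop) fun x => by simpa using hη.1
    have hne : ∀ x : ℝ, (x + η * I - z : ℂ) ≠ 0 := by
      intro x h
      have := congrArg im h
      simp at this
      linarith [hη.2]
    refine Continuous.aestronglyMeasurable (Continuous.div ?_ (by fun_prop) hne)
    exact continuous_ofReal.comp (continuous_im.comp hc)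
  · filter_upwards [hev] with η hη
    have hae : ∀ᵐ x : ℝ, x ≠ 0 := by
      simp [ae_iff]
    filter_upwards [hae] with x hx
    have hxp : 0 < |x| := abs_pos.2 hx
    have hk := hker x η hη.1 hη.2
    have hkpos : 0 < ‖(x + η * I - z : ℂ)‖ := by
      by_contra hlt
      push Not at hlt
      have := mul_nonpos_of_nonneg_of_nonpos hC1pos.le hlt
      linarith
    have hζ : |x| ≤ ‖(x + η * I : ℂ)‖ := by simpa using abs_re_le_norm (x + η * I : ℂ)
    have hb' := hb (x + η * I) (by simpa using hη.1)
    have hg : ‖g (x + η * I)‖ * √(|x| * (1 + |x|)) ≤ √A := by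
      apply Real.le_sqrt_of_sq_le
      rw [mul_pow, Real.sq_sqrt (by positivity)]
      refine le_trans ?_ hb'
      gcongr
    have hs : 0 < √(|x| * (1 + |x|)) := Real.sqrt_pos.2 (by positivity)
    refine le_trans ?_ (mul_le_mul_of_nonneg_left (majorant_bound hx) (by positivity))
    rw [norm_div, ← div_eq_mul_inv, div_le_div_iff₀ hkpos (by positivity)]
    have h1 : ‖((g (x + η * I)).im : ℂ)‖ ≤ ‖g (x + η * I)‖ := by
      rw [Complex.norm_real, Real.norm_eq_abs]; exact abs_im_le_norm _
    calc ‖((g (x + η * I)).im : ℂ)‖ * (√(|x| * (1 + |x|)) * (1 + |x|))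
        ≤ ‖g (x + η * I)‖ * (√(|x| * (1 + |x|)) * (1 + |x|)) := by gcongr
      _ = (‖g (x + η * I)‖ * √(|x| * (1 + |x|))) * (1 + |x|) := by ring
      _ ≤ √A * (C1 * ‖(x + η * I - z : ℂ)‖) := by gcongr
      _ = √A * C1 * ‖(x + η * I - z : ℂ)‖ := by ring
  · have hae : ∀ᵐ x : ℝ, x ≠ 0 := by
      simp [ae_iff]
    filter_upwards [hae] with x hx
    have h1 : Tendsto (fun η : ℝ => ((g (x + η * I)).im : ℂ)) (𝓝[>] 0) (𝓝 ((g0 x).im : ℂ)) :=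
      (continuous_ofReal.tendsto _).comp ((continuous_im.tendsto _).comp (hlim x hx))
    have h2 : Tendsto (fun η : ℝ => (x + η * I - z : ℂ)) (𝓝[>] 0) (𝓝 (x - z)) := by
      have : Continuous fun η : ℝ => (x + η * I - z : ℂ) := by fun_prop
      have := this.tendsto 0
      simp only [ofReal_zero, zero_mul, add_zero] at this
      exact this.mono_left nhdsWithin_le_nhds
    refine h1.div h2 ?_
    intro h
    have := congrArg im h
    simp at this
    linarith

/-! ### Measures with a prescribed Stieltjes transform -/

lemma stieltjes_withDensity {f : ℝ → ℝ} (hf : Measurable f) (hf0 : ∀ x, 0 ≤ f x) (z : ℂ) :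
    stieltjes (volume.withDensity fun x => ENNReal.ofReal (f x)) z =
      ∫ x : ℝ, (f x : ℂ) / (x - z) := by
  unfold stieltjes
  rw [integral_withDensity_eq_integral_toReal_smul hf.ennreal_ofReal
    (Eventually.of_forall fun x => ENNReal.ofReal_lt_top)]
  refine integral_congr_ae (Eventually.of_forall fun x => ?_)
  simp only [ENNReal.toReal_ofReal (hf0 x), Complex.real_smul]
  ring

/-- The mass of a density is read off from its Cauchy transform along the imaginary axis. -/
lemma tendsto_mass {f : ℝ → ℝ} (hf : Integrable f) :
    Tendsto (fun y : ℝ => (y * I) * ∫ x : ℝ, (f x : ℂ) / (x - y * I)) atTop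
      (𝓝 (-((∫ x, f x : ℝ) : ℂ))) := by
  have hne : ∀ x y : ℝ, 0 < y → (x - y * I : ℂ) ≠ 0 := by
    intro x y hy h
    have := congrArg im h
    simp at this
    linarith
  have h1 : Tendsto (fun y : ℝ => ∫ x : ℝ, (y * I) * ((f x : ℂ) / (x - y * I))) atTop
      (𝓝 (∫ x : ℝ, -(f x : ℂ))) := by
    apply tendsto_integral_filter_of_dominated_convergence (fun x => ‖f x‖)
    · filter_upwards [eventually_gt_atTop 0] with y hy
      refine AEStronglyMeasurable.const_mul ?_ _
      have hc : Continuous fun x : ℝ => (x - y * I : ℂ)⁻¹ :=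
        Continuous.inv₀ (by fun_prop) fun x => hne x y hy
      simp_rw [div_eq_mul_inv]
      exact hf.ofReal.aestronglyMeasurable.mul hc.aestronglyMeasurable
    · filter_upwards [eventually_gt_atTop 0] with y hy
      filter_upwards with x
      have hpos : 0 < ‖(x - y * I : ℂ)‖ := norm_pos_iff.2 (hne x y hy)
      have him : |y| ≤ ‖(x - y * I : ℂ)‖ := by simpa using abs_im_le_norm (x - y * I : ℂ)
      rw [norm_mul, norm_mul, norm_I, mul_one, norm_div, Complex.norm_real, Complex.norm_real,
        mul_div_left_comm]
      refine mul_le_of_le_one_right (norm_nonneg _) ?_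
      rw [div_le_one hpos]
      exact him
    · exact hf.norm
    · filter_upwards with x
      have h2 : Tendsto (fun y : ℝ => ((x : ℂ) * (y : ℂ)⁻¹ - I)) atTop (𝓝 (x * 0 - I)) := by
        refine (Tendsto.const_mul _ ?_).sub_const _
        have := (continuous_ofReal.tendsto (0 : ℝ)).comp (tendsto_inv_atTop_zero (𝕜 := ℝ))
        simpa [Function.comp_def] using this
      have h3 : Tendsto (fun y : ℝ => (f x : ℂ) * I / ((x : ℂ) * (y : ℂ)⁻¹ - I)) atTop
          (𝓝 ((f x : ℂ) * I / (x * 0 - I))) := tendsto_const_nhds.div h2 (by simp)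
      have h4 : (f x : ℂ) * I / (x * 0 - I) = -(f x : ℂ) := by
        have := I_ne_zero
        rw [mul_zero, zero_sub, div_neg, mul_div_assoc, div_self this, mul_one]
      rw [h4] at h3
      refine h3.congr' ?_
      filter_upwards [eventually_gt_atTop 0] with y hy
      have hy' : (y : ℂ) ≠ 0 := by exact_mod_cast hy.ne'
      have := hne x y hy
      have h5 : (x : ℂ) * (y : ℂ)⁻¹ - I ≠ 0 := by
        intro h
        apply this
        field_simp at h
        linear_combination h
      field_simp
  simp_rw [integral_const_mul] at h1
  rwa [integral_neg, integral_complex_ofReal] at h1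

/-- A function of bounded support with at most an inverse-square-root singularity at the origin is
integrable. -/
lemma integrable_of_sqrt_singularity {f : ℝ → ℝ} {A c : ℝ} (hf : Measurable f)
    (hb : ∀ x : ℝ, x ≠ 0 → f x ^ 2 * (|x| * (1 + |x|)) ≤ A) (hc : ∀ x : ℝ, c < |x| → f x = 0)
    (hc0 : 0 ≤ c) : Integrable f := by
  refine Integrable.mono' (integrable_majorant.const_mul (√A * (1 + c))) hf.aestronglyMeasurable ?_
  have hae : ∀ᵐ x : ℝ, x ≠ 0 := by simp [ae_iff]
  filter_upwards [hae] with x hx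
  have hxp : 0 < |x| := abs_pos.2 hx
  have hs : 0 < √(|x| * (1 + |x|)) := Real.sqrt_pos.2 (by positivity)
  refine le_trans ?_ (mul_le_mul_of_nonneg_left (majorant_bound hx) (by positivity))
  rw [← div_eq_mul_inv, le_div_iff₀ (by positivity)]
  rcases le_or_gt |x| c with h | h
  · have h1 : ‖f x‖ * √(|x| * (1 + |x|)) ≤ √A := by
      apply Real.le_sqrt_of_sq_le
      rw [mul_pow, Real.sq_sqrt (by positivity), Real.norm_eq_abs, sq_abs]
      exact hb x hx
    rw [← mul_assoc]
    exact mul_le_mul h1 (by linarith) (by positivity) (Real.sqrt_nonneg _)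
  · rw [hc x h, norm_zero, zero_mul]
    positivity

/-! ### The spectral parametrization -/

/-- The inverse of the perturbed Joukowski map at the rescaled spectral parameter
`Z = (z - 1 - r²) / r`. -/
noncomputable def vInv (r ε : ℝ) (z : ℂ) : ℂ :=
  joukInv (ε * (1 + r ^ 2)) (2 * ε * r) (ε ^ 2 * r ^ 2) ((z - 1 - r ^ 2) / r)

/-- The inverse `u(z)` of the parametrization `z = (r² + u + ε u²) (1 + u + ε u²) / u`, obtained
from the perturbed Joukowski map by the substitution `u = r v`, `z = 1 + r² + r Z`. -/
noncomputable def uInv (r ε : ℝ) (z : ℂ) : ℂ :=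
  r * vInv r ε z

/-- Admissible parameters: `r` stands for `1/√d` and `ε` for the sparsity correction. The condition
`gap` bounds `1 + u + ε u²` away from `0` if `r < 1`, when the spectrum stays away from `0`. -/
structure Admissible (r ε : ℝ) : Prop where
  r_pos : 0 < r
  r_le : r ≤ 1
  eps : |ε| ≤ 1 / 2000
  gap : r = 1 ∨ 44 * |ε| ≤ 1 - r

variable {r ε : ℝ}

lemma Admissible.smallCoeffs (h : Admissible r ε) :
    SmallCoeffs (2 * |ε|) (ε * (1 + r ^ 2)) (2 * ε * r) (ε ^ 2 * r ^ 2) := by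
  have h0 := h.r_pos
  have h1 := h.r_le
  have h2 := h.eps
  have hr2 : r ^ 2 ≤ 1 := pow_le_one₀ h0.le h1
  have hε := abs_nonneg ε
  constructor
  · rw [abs_mul, abs_of_pos (by positivity : 0 < 1 + r ^ 2)]; nlinarith
  · rw [abs_mul, abs_mul, abs_two, abs_of_pos h0]; nlinarith
  · rw [abs_of_nonneg (by positivity), ← sq_abs ε]
    have : |ε| ^ 2 * r ^ 2 ≤ |ε| ^ 2 * 1 := by gcongr
    nlinarith

lemma Admissible.two_eps (h : Admissible r ε) : 2 * |ε| ≤ 1 / 1000 := by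
  linarith [h.eps]

lemma scaled_im (r : ℝ) (z : ℂ) : ((z - 1 - (r : ℂ) ^ 2) / r).im = z.im / r := by
  rw [div_ofReal_im, sub_im, sub_im, one_im, ← ofReal_pow, ofReal_im]
  ring

lemma scaled_re (r : ℝ) (z : ℂ) :
    ((z - 1 - (r : ℂ) ^ 2) / r).re = (z.re - 1 - r ^ 2) / r := by
  rw [div_ofReal_re, sub_re, sub_re, one_re, ← ofReal_pow, ofReal_re]

/-- The relation between `u` and `z` is the equation `J(v) = Z` for the perturbed Joukowski map in
the rescaled variables. -/
lemma uInv_relation_iff (hr : 0 < r) {v z : ℂ} :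
    (r * v) * z = (r ^ 2 + r * v + ε * (r * v) ^ 2) * (1 + r * v + ε * (r * v) ^ 2) ↔
      v * ((z - 1 - r ^ 2) / r) = joukNum (ε * (1 + r ^ 2)) (2 * ε * r) (ε ^ 2 * r ^ 2) v := by
  have hr' : (r : ℂ) ≠ 0 := by exact_mod_cast hr.ne'
  unfold joukNum
  push_cast
  constructor
  · intro h
    field_simp
    apply mul_left_cancel₀ hr'
    linear_combination h
  · intro h
    field_simp at h
    linear_combination (r : ℂ) * h

section
variable (h : Admissible r ε) {z : ℂ} (hz : 0 ≤ z.im)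
include h hz

lemma vInv_spec :
    vInv r ε z ∈ lowerDom (ε * (1 + r ^ 2)) (2 * ε * r) (ε ^ 2 * r ^ 2) ∧
    vInv r ε z * ((z - 1 - r ^ 2) / r) =
      joukNum (ε * (1 + r ^ 2)) (2 * ε * r) (ε ^ 2 * r ^ 2) (vInv r ε z) :=
  joukInv_spec h.smallCoeffs h.two_eps (by rw [scaled_im r]; exact div_nonneg hz h.r_pos.le)

lemma uInv_relation : uInv r ε z * z =
    (r ^ 2 + uInv r ε z + ε * uInv r ε z ^ 2) * (1 + uInv r ε z + ε * uInv r ε z ^ 2) :=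
  (uInv_relation_iff h.r_pos).2 (vInv_spec h hz).2

lemma uInv_ne_zero : uInv r ε z ≠ 0 :=
  mul_ne_zero (by exact_mod_cast h.r_pos.ne') (ne_zero_of_joukNum (vInv_spec h hz).2)

lemma norm_uInv_le : ‖uInv r ε z‖ ≤ r * (1 + 20 * |ε|) := by
  have := norm_le_of_mem_lowerDom h.smallCoeffs h.two_eps (vInv_spec h hz).1
  rw [uInv, norm_mul, Complex.norm_real, Real.norm_eq_abs, abs_of_pos h.r_pos]
  exact mul_le_mul_of_nonneg_left (by linarith) h.r_pos.le

lemma norm_uInv_le_one : ‖uInv r ε z‖ ≤ 1.01 := by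
  have h1 := norm_uInv_le h hz
  have h2 := mul_le_mul_of_nonneg_right h.r_le (by positivity : 0 ≤ 1 + 20 * |ε|)
  linarith [h.eps]

lemma uInv_im_nonpos : (uInv r ε z).im ≤ 0 := by
  rw [uInv, im_ofReal_mul]
  exact mul_nonpos_of_nonneg_of_nonpos h.r_pos.le (vInv_spec h hz).1.1

lemma norm_quad_bounds (t : ℝ) (ht : |t| ≤ 1) :
    ‖(t : ℂ) + uInv r ε z + ε * uInv r ε z ^ 2‖ ≤ 2.1 := by
  have h1 := norm_uInv_le_one h hz
  have h2 := h.eps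
  refine (norm_add₃_le).trans ?_
  rw [norm_mul, norm_pow, Complex.norm_real, Complex.norm_real, Real.norm_eq_abs, Real.norm_eq_abs]
  have : |ε| * ‖uInv r ε z‖ ^ 2 ≤ 1 / 2000 * 1.01 ^ 2 := by gcongr
  linarith

lemma norm_uInv_mul_le : ‖uInv r ε z‖ * ‖z‖ ≤ 5 := by
  rw [← norm_mul, uInv_relation h hz, norm_mul]
  have h1 := norm_quad_bounds h hz (r ^ 2) (by
    rw [abs_of_nonneg (by positivity)]; exact pow_le_one₀ h.r_pos.le h.r_le)
  have h2 := norm_quad_bounds h hz 1 (by simp)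
  push_cast at h1 h2
  have := mul_le_mul h1 h2 (norm_nonneg _) (by norm_num)
  linarith

lemma one_add_ne_zero (hz0 : z ≠ 0) : 1 + uInv r ε z + ε * uInv r ε z ^ 2 ≠ 0 := by
  intro h0
  have := uInv_relation h hz
  rw [h0, mul_zero] at this
  exact (mul_ne_zero (uInv_ne_zero h hz) hz0) this

lemma sq_add_ne_zero (hz0 : z ≠ 0) : r ^ 2 + uInv r ε z + ε * uInv r ε z ^ 2 ≠ 0 := by
  intro h0
  have := uInv_relation h hz
  rw [h0, zero_mul] at this
  exact (mul_ne_zero (uInv_ne_zero h hz) hz0) this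

end

lemma uInv_im_neg (h : Admissible r ε) {z : ℂ} (hz : 0 < z.im) : (uInv r ε z).im < 0 := by
  obtain ⟨h1, h2⟩ := vInv_spec h hz.le
  rw [uInv, im_ofReal_mul]
  refine mul_neg_of_pos_of_neg h.r_pos (im_neg_of_im_pos h2 ?_ h1)
  rw [scaled_im r]
  exact div_pos hz h.r_pos

lemma continuousOn_uInv (h : Admissible r ε) : ContinuousOn (uInv r ε) {z | 0 ≤ z.im} := by
  have h1 := continuousOn_joukInv h.smallCoeffs h.two_eps
  refine continuousOn_const.mul (h1.comp (by fun_prop) fun z hz => ?_)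
  change 0 ≤ ((z - 1 - (r : ℂ) ^ 2) / r).im
  rw [scaled_im r]
  exact div_nonneg hz h.r_pos.le

lemma differentiableOn_uInv (h : Admissible r ε) :
    DifferentiableOn ℂ (uInv r ε) {z | 0 < z.im} := by
  have h1 := differentiableOn_joukInv h.smallCoeffs h.two_eps
  refine (h1.comp (by fun_prop) fun z hz => ?_).const_mul (r : ℂ)
  change 0 < ((z - 1 - (r : ℂ) ^ 2) / r).im
  rw [scaled_im r]
  exact div_pos hz h.r_pos

/-- The solution of the quartic equation, in terms of the parameter `u`. -/
noncomputable def mSol (r ε : ℝ) (z : ℂ) : ℂ :=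
  -uInv r ε z / (r ^ 2 + uInv r ε z + ε * uInv r ε z ^ 2)

/-- The companion transform `m(z) + (1 - r²)/z`. It has no pole at the origin; at worst, for
`r = 1`, it has an inverse-square-root singularity there. -/
noncomputable def mComp (r ε : ℝ) (z : ℂ) : ℂ :=
  -uInv r ε z / (1 + uInv r ε z + ε * uInv r ε z ^ 2)

lemma im_neg_div_quad (u : ℂ) (t : ℝ) :
    (-u / (t + u + ε * u ^ 2)).im = -u.im * (t - ε * normSq u) / normSq (t + u + ε * u ^ 2) := by
  rw [div_im, ← sub_div]
  congr 1
  simp only [neg_im, neg_re, add_re, add_im, ofReal_re, ofReal_im, mul_re, mul_im, pow_two,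
    normSq_apply]
  ring

lemma mSol_eq (h : Admissible r ε) {z : ℂ} (hz : 0 ≤ z.im) (hz0 : z ≠ 0) :
    mSol r ε z = mComp r ε z - (1 - r ^ 2) / z := by
  have h1 := one_add_ne_zero h hz hz0
  have h2 := sq_add_ne_zero h hz hz0
  have h3 := uInv_relation h hz
  unfold mSol mComp
  rw [div_sub_div _ _ h1 hz0, div_eq_div_iff h2 (mul_ne_zero h1 hz0)]
  linear_combination (-(1 - (r : ℂ) ^ 2)) * h3

lemma mComp_mul (h : Admissible r ε) {z : ℂ} (hz : 0 ≤ z.im) (hz0 : z ≠ 0) :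
    z * mComp r ε z = -(r ^ 2 + uInv r ε z + ε * uInv r ε z ^ 2) := by
  have h1 := one_add_ne_zero h hz hz0
  have h3 := uInv_relation h hz
  unfold mComp
  rw [mul_div_assoc', div_eq_iff h1]
  linear_combination -h3

/-- Decay at infinity and the size at the origin of the companion transform. For `r = 1` the bound
comes from `m² z = u`, for `r < 1` from the denominator `1 + u + ε u²` being bounded below. -/
lemma mComp_bound (h : Admissible r ε) : ∃ A : ℝ, ∀ z : ℂ, 0 ≤ z.im → z ≠ 0 →
    ‖mComp r ε z‖ ^ 2 * (‖z‖ * (1 + ‖z‖)) ≤ A := by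
  have hU : ∀ z : ℂ, 0 ≤ z.im → ‖uInv r ε z‖ * (1 + ‖z‖) ≤ 7 := fun z hz => by
    linarith [norm_uInv_mul_le h hz, norm_uInv_le_one h hz]
  by_cases hr1 : r = 1
  · subst hr1
    refine ⟨7, fun z hz hz0 => ?_⟩
    have h1 := one_add_ne_zero h hz hz0
    have h3 := uInv_relation h hz
    have h4 : mComp 1 ε z ^ 2 * z = uInv 1 ε z := by
      push_cast at h3
      unfold mComp
      rw [div_pow, neg_sq, div_mul_eq_mul_div, div_eq_iff (pow_ne_zero 2 h1)]
      linear_combination uInv 1 ε z * h3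
    have h5 := congrArg norm h4
    rw [norm_mul, norm_pow] at h5
    rw [← mul_assoc, h5]
    exact hU z hz
  · have hgap := h.gap.resolve_left hr1
    have hrlt : 0 < 1 - r := sub_pos.2 (lt_of_le_of_ne h.r_le hr1)
    refine ⟨(2 / (1 - r)) ^ 2 * 49, fun z hz hz0 => ?_⟩
    have hp : (1 - r) / 2 ≤ ‖1 + uInv r ε z + ε * uInv r ε z ^ 2‖ := by
      have a1 := norm_uInv_le h hz
      have a2 := norm_uInv_le_one h hz
      have a3 : ‖(ε : ℂ) * uInv r ε z ^ 2‖ ≤ |ε| * 1.01 ^ 2 := by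
        rw [norm_mul, norm_pow, Complex.norm_real, Real.norm_eq_abs]
        gcongr
      have a4 : ‖(1 : ℂ)‖ ≤ ‖1 + uInv r ε z + ε * uInv r ε z ^ 2‖ +
          ‖uInv r ε z + ε * uInv r ε z ^ 2‖ := by
        have := norm_sub_le (1 + uInv r ε z + ε * uInv r ε z ^ 2)
          (uInv r ε z + ε * uInv r ε z ^ 2)
        rwa [add_assoc, add_sub_cancel_right, ← add_assoc] at this
      have a5 := norm_add_le (uInv r ε z) (ε * uInv r ε z ^ 2)
      have a6 := mul_le_mul_of_nonneg_right h.r_le (by positivity : 0 ≤ 20 * |ε|)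
      rw [norm_one] at a4
      have := abs_nonneg ε
      linarith
    have hb : ‖mComp r ε z‖ ≤ 2 / (1 - r) * ‖uInv r ε z‖ := by
      unfold mComp
      rw [norm_div, norm_neg, div_le_iff₀ (lt_of_lt_of_le (by linarith) hp)]
      have := mul_le_mul_of_nonneg_left hp (by positivity : 0 ≤ 2 / (1 - r) * ‖uInv r ε z‖)
      have e1 : 2 / (1 - r) * ‖uInv r ε z‖ * ((1 - r) / 2) = ‖uInv r ε z‖ := by field_simp
      linarith
    calc ‖mComp r ε z‖ ^ 2 * (‖z‖ * (1 + ‖z‖))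
        ≤ (2 / (1 - r) * ‖uInv r ε z‖) ^ 2 * ((1 + ‖z‖) * (1 + ‖z‖)) := by
          gcongr
          linarith
      _ = (2 / (1 - r)) ^ 2 * (‖uInv r ε z‖ * (1 + ‖z‖)) ^ 2 := by ring
      _ ≤ (2 / (1 - r)) ^ 2 * 7 ^ 2 := by
          gcongr
          exact hU z hz
      _ = _ := by norm_num

lemma continuousAt_within_mComp (h : Admissible r ε) {z : ℂ} (hz : 0 ≤ z.im) (hz0 : z ≠ 0) :
    ContinuousWithinAt (mComp r ε) {z | 0 ≤ z.im} z := by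
  have h1 := continuousOn_uInv h z hz
  unfold mComp
  exact h1.neg.div ((continuousWithinAt_const.add h1).add (continuousWithinAt_const.mul (h1.pow 2)))
    (one_add_ne_zero h hz hz0)

lemma differentiableOn_mComp (h : Admissible r ε) :
    DifferentiableOn ℂ (mComp r ε) {z | 0 < z.im} := by
  have h1 := differentiableOn_uInv h
  unfold mComp
  refine h1.neg.div ((h1.const_add _).add ((h1.pow 2).const_mul _)) fun z hz => ?_
  have hz' : 0 < z.im := hz
  exact one_add_ne_zero h hz'.le (by rintro rfl; simp at hz')

lemma differentiableOn_mSol (h : Admissible r ε) :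
    DifferentiableOn ℂ (mSol r ε) {z | 0 < z.im} := by
  have h1 := differentiableOn_uInv h
  unfold mSol
  refine h1.neg.div ((h1.const_add _).add ((h1.pow 2).const_mul _)) fun z hz => ?_
  have hz' : 0 < z.im := hz
  exact sq_add_ne_zero h hz'.le (by rintro rfl; simp at hz')

/-! ### The limiting spectral measure -/

/-- The density of the absolutely continuous part: the boundary values of `Im mComp / π`. -/
noncomputable def specDensity (r ε : ℝ) (x : ℝ) : ℝ := (mComp r ε x).im / Real.pi

/-- The limiting spectral measure: an atom of mass `1 - r²` at the origin and the density. -/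
noncomputable def specMeasure (r ε : ℝ) : Measure ℝ :=
  ENNReal.ofReal (1 - r ^ 2) • Measure.dirac 0
    + volume.withDensity fun x => ENNReal.ofReal (specDensity r ε x)

lemma mComp_im (z : ℂ) : (mComp r ε z).im = -(uInv r ε z).im * (1 - ε * normSq (uInv r ε z))
    / normSq (1 + uInv r ε z + ε * uInv r ε z ^ 2) := by
  simpa [mComp] using im_neg_div_quad (ε := ε) (uInv r ε z) 1

lemma eps_mul_normSq_le (h : Admissible r ε) {z : ℂ} (hz : 0 ≤ z.im) :
    |ε * normSq (uInv r ε z)| ≤ 2 * |ε| * r ^ 2 := by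
  have h1 := norm_uInv_le h hz
  have h2 := h.eps
  have h3 : ‖uInv r ε z‖ ^ 2 ≤ (r * (1 + 20 * |ε|)) ^ 2 := by gcongr
  have h4 : (1 + 20 * |ε|) ^ 2 ≤ 2 := by nlinarith [abs_nonneg ε]
  rw [abs_mul, ← Complex.sq_norm, abs_of_nonneg (sq_nonneg ‖uInv r ε z‖)]
  have h5 : ‖uInv r ε z‖ ^ 2 ≤ 2 * r ^ 2 := by
    rw [mul_pow] at h3
    nlinarith [sq_nonneg r]
  nlinarith [abs_nonneg ε]

lemma specDensity_nonneg (h : Admissible r ε) (x : ℝ) : 0 ≤ specDensity r ε x := by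
  unfold specDensity
  rw [mComp_im]
  have h1 := uInv_im_nonpos h (z := x) (by simp)
  have h2 := eps_mul_normSq_le h (z := x) (by simp)
  have h3 : r ^ 2 ≤ 1 := pow_le_one₀ h.r_pos.le h.r_le
  have h4 : 2 * |ε| * r ^ 2 ≤ 1 := by nlinarith [h.eps, abs_nonneg ε, sq_nonneg r]
  rw [abs_le] at h2
  exact div_nonneg (div_nonneg (mul_nonneg (by linarith) (by linarith)) (normSq_nonneg _))
    Real.pi_pos.le

lemma specDensity_eq_zero {x : ℝ} (hx : (uInv r ε x).im = 0) : specDensity r ε x = 0 := by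
  rw [specDensity, mComp_im, hx]; simp

lemma measurable_specDensity (h : Admissible r ε) : Measurable (specDensity r ε) := by
  refine measurable_of_continuousOn_compl_singleton 0 fun x hx => ?_
  have hx' : (x : ℂ) ≠ 0 := by simpa using hx
  have h1 := continuousAt_within_mComp h (z := x) (by simp) hx'
  have h2 : ContinuousAt (fun y : ℝ => mComp r ε y) x := by
    rw [← continuousWithinAt_univ]
    exact h1.comp (t := {z : ℂ | 0 ≤ z.im}) continuous_ofReal.continuousWithinAt
      (fun y _ => by simp)
  exact ((continuous_im.continuousAt.comp h2).div_const _).continuousWithinAt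

lemma integrable_specDensity (h : Admissible r ε) {c : ℝ} (hc0 : 0 ≤ c)
    (hc : ∀ x : ℝ, c < |x| → (uInv r ε x).im = 0) : Integrable (specDensity r ε) := by
  obtain ⟨A, hA⟩ := mComp_bound h
  refine integrable_of_sqrt_singularity (A := A) (c := c) (measurable_specDensity h) ?_
    (fun x hx => specDensity_eq_zero (hc x hx)) hc0
  intro x hx
  have h1 := hA x (by simp) (by simpa using hx)
  rw [Complex.norm_real, Real.norm_eq_abs] at h1
  refine le_trans ?_ h1
  have h2 : specDensity r ε x ^ 2 ≤ ‖mComp r ε x‖ ^ 2 := by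
    rw [← sq_abs]
    refine pow_le_pow_left₀ (abs_nonneg _) ?_ 2
    rw [specDensity, abs_div, abs_of_pos Real.pi_pos]
    refine (div_le_self (abs_nonneg _) (by linarith [Real.pi_gt_three])).trans (abs_im_le_norm _)
  gcongr

lemma integral_specDensity_div (h : Admissible r ε) {z : ℂ} (hz : 0 < z.im) :
    ∫ x : ℝ, (specDensity r ε x : ℂ) / (x - z) = mComp r ε z := by
  obtain ⟨A, hA⟩ := mComp_bound h
  have h1 := integral_boundary_im_div (g := mComp r ε) (g0 := fun x => mComp r ε x) hz
    (differentiableOn_mComp h) (A := A)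
    (fun ζ hζ => hA ζ hζ.le (by rintro rfl; simp at hζ)) ?_
  · have e : ∀ x : ℝ, (specDensity r ε x : ℂ) / (x - z) =
        (Real.pi : ℂ)⁻¹ * (((mComp r ε x).im : ℂ) / (x - z)) := by
      intro x
      unfold specDensity
      push_cast
      ring
    simp_rw [e]
    rw [integral_const_mul, h1]
    have : (Real.pi : ℂ) ≠ 0 := by exact_mod_cast Real.pi_ne_zero
    field_simp
  · intro x hx
    have h2 := continuousAt_within_mComp h (z := x) (by simp) (by simpa using hx)
    refine h2.tendsto.comp (tendsto_nhdsWithin_iff.2 ⟨?_, ?_⟩)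
    · have : Continuous fun η : ℝ => (x + η * I : ℂ) := by fun_prop
      have := this.tendsto 0
      simp only [ofReal_zero, zero_mul, add_zero] at this
      exact this.mono_left nhdsWithin_le_nhds
    · filter_upwards [self_mem_nhdsWithin] with η hη
      have : 0 < η := hη
      simpa using this.le

lemma tendsto_uInv_zero (h : Admissible r ε) :
    Tendsto (fun y : ℝ => uInv r ε (y * I)) atTop (𝓝 0) := by
  have h1 : Tendsto (fun y : ℝ => 5 * y⁻¹) atTop (𝓝 0) := by
    simpa using (tendsto_inv_atTop_zero (𝕜 := ℝ)).const_mul 5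
  refine squeeze_zero_norm' ?_ h1
  filter_upwards [eventually_gt_atTop 0] with y hy
  have := norm_uInv_mul_le h (z := y * I) (by simpa using hy.le)
  rw [norm_mul (y : ℂ), norm_I, mul_one, Complex.norm_real, Real.norm_eq_abs, abs_of_pos hy] at this
  rw [← div_eq_mul_inv]
  exact norm_le_div_of_mul_le hy this

/-- The mass of the density, read off from `z * mComp z → -r²` at infinity. -/
lemma integral_specDensity (h : Admissible r ε) (hi : Integrable (specDensity r ε)) :
    ∫ x, specDensity r ε x = r ^ 2 := by
  have h1 := tendsto_mass hi
  have hu := tendsto_uInv_zero h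
  have h2 : Tendsto (fun y : ℝ => -(r ^ 2 + uInv r ε (y * I) + ε * uInv r ε (y * I) ^ 2)) atTop
      (𝓝 (-((r : ℂ) ^ 2 + 0 + ε * 0 ^ 2))) :=
    ((hu.const_add _).add ((hu.pow 2).const_mul _)).neg
  have h3 := tendsto_nhds_unique (h1.congr' ?_) h2
  · have h4 : ((∫ x, specDensity r ε x : ℝ) : ℂ) = ((r ^ 2 : ℝ) : ℂ) := by
      push_cast
      simpa using h3
    exact_mod_cast h4
  · filter_upwards [eventually_gt_atTop 0] with y hy
    rw [integral_specDensity_div h (by simpa using hy), mComp_mul h (by simpa using hy.le)]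
    simpa using hy.ne'

lemma isFiniteMeasure_density (hi : Integrable (specDensity r ε)) :
    IsFiniteMeasure (volume.withDensity fun x => ENNReal.ofReal (specDensity r ε x)) :=
  isFiniteMeasure_withDensity_ofReal hi.2

lemma isProbabilityMeasure_specMeasure (h : Admissible r ε) (hi : Integrable (specDensity r ε)) :
    IsProbabilityMeasure (specMeasure r ε) := by
  constructor
  have h3 : r ^ 2 ≤ 1 := pow_le_one₀ h.r_pos.le h.r_le
  rw [specMeasure, Measure.add_apply, Measure.smul_apply, withDensity_apply _ MeasurableSet.univ,
    Measure.restrict_univ, ← ofReal_integral_eq_lintegral_ofReal hi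
      (Eventually.of_forall (specDensity_nonneg h)), integral_specDensity h hi]
  simp only [measure_univ, smul_eq_mul, mul_one]
  rw [← ENNReal.ofReal_add (by linarith) (sq_nonneg r)]
  simp

lemma integrable_resolvent {μ : Measure ℝ} [IsFiniteMeasure μ] {z : ℂ} (hz : 0 < z.im) :
    Integrable (fun x : ℝ => 1 / ((x : ℂ) - z)) μ := by
  have hne : ∀ x : ℝ, (x - z : ℂ) ≠ 0 := by
    intro x h
    have := congrArg im h
    simp at this
    linarith
  refine Integrable.of_bound (C := 1 / z.im) ?_ (Eventually.of_forall fun x => ?_)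
  · exact Continuous.aestronglyMeasurable (Continuous.div (by fun_prop) (by fun_prop) hne)
  · rw [norm_div, norm_one]
    apply one_div_le_one_div_of_le hz
    have := abs_im_le_norm (x - z : ℂ)
    simp only [sub_im, ofReal_im, zero_sub, abs_neg] at this
    exact (le_abs_self _).trans this

lemma stieltjes_specMeasure (h : Admissible r ε) (hi : Integrable (specDensity r ε)) {z : ℂ}
    (hz : 0 < z.im) : stieltjes (specMeasure r ε) z = mSol r ε z := by
  have h3 : r ^ 2 ≤ 1 := pow_le_one₀ h.r_pos.le h.r_le
  have hf := isFiniteMeasure_density hi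
  have h1 := stieltjes_withDensity (measurable_specDensity h) (specDensity_nonneg h) z
  unfold stieltjes at h1 ⊢
  have hd : IsFiniteMeasure (ENNReal.ofReal (1 - r ^ 2) • Measure.dirac (0 : ℝ)) :=
    Measure.smul_finite _ ENNReal.ofReal_ne_top
  rw [specMeasure, integral_add_measure (integrable_resolvent hz) (integrable_resolvent hz), h1,
    integral_smul_measure, integral_dirac, integral_specDensity_div h hz,
    ENNReal.toReal_ofReal (by linarith), mSol_eq h hz.le (by rintro rfl; simp at hz)]
  simp only [ofReal_zero, zero_sub, real_smul]
  push_cast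
  rw [div_neg, mul_neg]
  ring

/-! ### Square-root behaviour at the upper edge -/

/-- Quadratic behaviour of the perturbed Joukowski map at a critical point. -/
lemma IsCrit.dist_comparable {a : ℝ} (h : IsCrit α β κ a) (hs : SmallCoeffs e α β κ)
    (he : e ≤ 1 / 1000) {v : ℂ} (hv : ‖v‖ ≤ 2) (hv0 : v ≠ 0) :
    0.98 * ‖v - a‖ ^ 2 ≤ ‖v‖ * ‖jouk α β κ v - jouk α β κ a‖ ∧
      ‖v‖ * ‖jouk α β κ v - jouk α β κ a‖ ≤ 1.02 * ‖v - a‖ ^ 2 := by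
  obtain ⟨q1, q2⟩ := norm_bounds_of_sub_one (h.joukQuot_sub_one hs hv)
  have hpos : 0 < ‖v‖ := norm_pos_iff.2 hv0
  have e1 : ‖v‖ * ‖jouk α β κ v - jouk α β κ a‖ = ‖v - a‖ ^ 2 * ‖joukQuot β κ a v‖ := by
    rw [h.jouk_sub hv0, norm_div, norm_mul, norm_pow]
    field_simp
  rw [e1]
  have h0 := sq_nonneg ‖v - a‖
  constructor
  · rw [mul_comm]
    exact mul_le_mul_of_nonneg_left (by linarith) h0
  · rw [mul_comm 1.02]
    exact mul_le_mul_of_nonneg_left (by linarith) h0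

lemma sq_norm_sub_ofReal (v : ℂ) (a : ℝ) : ‖v - a‖ ^ 2 = (v.re - a) ^ 2 + v.im ^ 2 := by
  rw [Complex.sq_norm, normSq_apply]
  simp
  ring

/-- To the left of the upper edge the imaginary part controls the distance to the critical
point. -/
lemma IsCrit.im_sq_ge {a x0 : ℝ} (h : IsCrit α β κ a) (hs : SmallCoeffs e α β κ)
    (ha2 : a ≤ 1.01) {v : ℂ} (hv : ‖v‖ ≤ 1.01) (hv0 : v ≠ 0) (hx0 : 0 < x0) (hx : x0 ≤ v.re)
    (hee : e ≤ x0 ^ 2 / 100) (hre : (jouk α β κ v).re ≤ (jouk α β κ a).re) :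
    x0 * ‖v - a‖ ^ 2 ≤ 6 * v.im ^ 2 := by
  refine im_lower_bound hx0 hx hee ha2 ((le_abs_self _).trans (abs_re_im_le hv).1)
    (sq_norm_sub_ofReal v a) ?_
  have h1 := (abs_le.1 (h.re_sub_estimate hs hv hv0)).1
  have h2 : normSq v * (jouk α β κ v - jouk α β κ a).re ≤ 0 :=
    mul_nonpos_of_nonneg_of_nonpos (normSq_nonneg _) (by rw [sub_re]; linarith)
  linarith

/-- To the right of the upper edge the quantity `S` with `Im J(v) = -Im v * S / |v|²` controls the
distance to the critical point. -/
lemma IsCrit.slope_ge {a x0 : ℝ} (h : IsCrit α β κ a) (hs : SmallCoeffs e α β κ)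
    (ha1 : 0.99 ≤ a) {v : ℂ} (hv : ‖v‖ ≤ 1.01) (hv0 : v ≠ 0) (hx0 : 0 < x0)
    (hx : x0 ≤ v.re) (hee : e ≤ x0 ^ 2 / 100) (hdom : v ∈ lowerDom α β κ)
    (hre : (jouk α β κ a).re ≤ (jouk α β κ v).re) :
    x0 / 3 * ‖v - a‖ ≤ 1 - normSq v * joukSlope α β κ v := by
  obtain ⟨hvx, hvy⟩ := abs_re_im_le hv
  have hn : normSq v = v.re ^ 2 + v.im ^ 2 := by rw [normSq_apply]; ring
  have hn1 : normSq v ≤ 1.03 := by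
    rw [← Complex.sq_norm]; nlinarith [norm_nonneg v]
  refine slope_lower_bound hs.nonneg hx0 hx hee ha1 ((le_abs_self _).trans h.le)
    ((le_abs_self _).trans hvx) hn (h.one_sub_slope v)
    (slope_error_bound hs.nonneg hs.b hs.k h.le hvx hvy (normSq_nonneg _) hn1)
    (by linarith [hdom.2.2]) (norm_nonneg _) (sq_norm_sub_ofReal v a) ?_
  have h1 := (abs_le.1 (h.re_sub_estimate hs hv hv0)).2
  have h2 : 0 ≤ normSq v * (jouk α β κ v - jouk α β κ a).re :=
    mul_nonneg (normSq_nonneg _) (by rw [sub_re]; linarith)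
  linarith

lemma IsCrit.slope_le {a : ℝ} (h : IsCrit α β κ a) (hs : SmallCoeffs e α β κ)
    (he : e ≤ 1 / 1000) {v : ℂ} (hv : ‖v‖ ≤ 1.01) :
    1 - normSq v * joukSlope α β κ v ≤ 4 * ‖v - a‖ := by
  obtain ⟨hvx, hvy⟩ := abs_re_im_le hv
  have he0 := hs.nonneg
  have hn : normSq v = v.re ^ 2 + v.im ^ 2 := by rw [normSq_apply]; ring
  have hn1 : normSq v ≤ 1.03 := by
    rw [← Complex.sq_norm]; nlinarith [norm_nonneg v]
  have hEr := slope_error_bound hs.nonneg hs.b hs.k h.le hvx hvy (normSq_nonneg _) hn1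
  rw [h.one_sub_slope v]
  have hd1 : |v.re - a| ≤ ‖v - a‖ := by simpa using abs_re_le_norm (v - a)
  have hd2 : |v.im| ≤ ‖v - a‖ := by simpa using abs_im_le_norm (v - a)
  have hD := norm_nonneg (v - a)
  have ha2 : 0.98 ≤ a ^ 2 := by
    rw [← sq_abs]; nlinarith [h.ge]
  have h1 : a ^ 2 - normSq v ≤ 3.1 * ‖v - a‖ := by
    have e1 : a ^ 2 - normSq v = -((v.re + a) * (v.re - a)) - v.im ^ 2 := by rw [hn]; ring
    have e2 : |(v.re + a) * (v.re - a)| ≤ 2.02 * ‖v - a‖ := by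
      rw [abs_mul]
      refine mul_le_mul ((abs_add_le _ _).trans (by linarith [h.le])) hd1 (abs_nonneg _)
        (by norm_num)
    rw [e1]
    have := (abs_le.1 e2).1
    nlinarith [sq_nonneg v.im]
  have h2 : (a ^ 2 - normSq v) / a ^ 2 ≤ 3.2 * ‖v - a‖ := by
    rw [div_le_iff₀ (by linarith)]
    have := mul_le_mul_of_nonneg_left ha2 (by positivity : 0 ≤ 3.2 * ‖v - a‖)
    linarith
  have h3 := (abs_le.1 hEr).1
  have h4 : e * |v.re - a| ≤ 1 / 1000 * ‖v - a‖ := mul_le_mul he hd1 (abs_nonneg _) (by norm_num)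
  have h5 : e * |v.im| ≤ 1 / 1000 * ‖v - a‖ := mul_le_mul he hd2 (abs_nonneg _) (by norm_num)
  linarith

/-- A bounded image keeps a point away from the pole of the perturbed Joukowski map. -/
lemma norm_lower_bound (hs : SmallCoeffs e α β κ) (he : e ≤ 1 / 1000) {v Z : ℂ}
    (h : v * Z = joukNum α β κ v) {B : ℝ} (hB : 2 ≤ B) (hZ : ‖Z‖ ≤ B) : 1 / (2 * B) ≤ ‖v‖ := by
  have he0 := hs.nonneg
  obtain ⟨ha, hb, hk⟩ := hs
  rcases le_or_gt (1 / 2) ‖v‖ with h1 | h1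
  · refine le_trans ?_ h1
    apply one_div_le_one_div_of_le <;> linarith
  have e1 : (1 : ℂ) = v * Z - ((1 + α : ℝ) * v ^ 2 + β * v ^ 3 + κ * v ^ 4) := by
    rw [h, joukNum]; push_cast; ring
  have h2 := congrArg norm e1
  rw [norm_one] at h2
  have h3 : ‖((1 + α : ℝ) : ℂ) * v ^ 2 + β * v ^ 3 + κ * v ^ 4‖ ≤ 1 / 2 := by
    refine (norm_add₃_le).trans ?_
    simp only [norm_mul, norm_pow, Complex.norm_real, Real.norm_eq_abs]
    have p2 : ‖v‖ ^ 2 ≤ (1 / 2) ^ 2 := pow_le_pow_left₀ (norm_nonneg _) h1.le 2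
    have p3 : ‖v‖ ^ 3 ≤ (1 / 2) ^ 3 := pow_le_pow_left₀ (norm_nonneg _) h1.le 3
    have p4 : ‖v‖ ^ 4 ≤ (1 / 2) ^ 4 := pow_le_pow_left₀ (norm_nonneg _) h1.le 4
    have a1 : |1 + α| ≤ 1.001 := by
      rw [abs_le] at ha ⊢; constructor <;> linarith
    have t1 := mul_le_mul a1 p2 (by positivity) (by norm_num)
    have t2 := mul_le_mul hb p3 (by positivity) he0
    have t3 := mul_le_mul hk p4 (by positivity) he0
    linarith
  have h4 := norm_sub_le (v * Z) (((1 + α : ℝ) : ℂ) * v ^ 2 + β * v ^ 3 + κ * v ^ 4)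
  rw [norm_mul] at h4
  have h5 : ‖v‖ * ‖Z‖ ≤ ‖v‖ * B := by gcongr
  rw [div_le_iff₀ (by linarith)]
  linarith

/-! ### Comparisons -/

lemma Comparable.mono {K K' a b : ℝ} (h : Comparable K a b) (hK : 0 < K) (hKK : K ≤ K')
    (hb : 0 ≤ b) : Comparable K' a b :=
  ⟨(mul_le_mul_of_nonneg_right (inv_anti₀ hK hKK) hb).trans h.1,
    h.2.trans (mul_le_mul_of_nonneg_right hKK hb)⟩

lemma Comparable.trans {K K' a b c : ℝ} (h : Comparable K a b) (h' : Comparable K' b c)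
    (hK : 0 < K) : Comparable (K * K') a c := by
  refine ⟨?_, ?_⟩
  · rw [mul_inv, mul_assoc]
    exact (mul_le_mul_of_nonneg_left h'.1 (inv_nonneg.2 hK.le)).trans h.1
  · rw [mul_assoc]
    exact h.2.trans (mul_le_mul_of_nonneg_left h'.2 hK.le)

lemma comparable_of_le {K a b : ℝ} (hK : 0 < K) (h1 : b ≤ K * a) (h2 : a ≤ K * b) :
    Comparable K a b :=
  ⟨by rw [inv_mul_le_iff₀ hK]; exact h1, h2⟩

lemma comparable_sqrt {K a D : ℝ} (hK : 1 ≤ K) (ha : 0 ≤ a) (hD : 0 ≤ D) (h1 : D ≤ K * a ^ 2)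
    (h2 : a ^ 2 ≤ K * D) : Comparable K a (√D) := by
  have hs := Real.sq_sqrt hD
  have hs0 := Real.sqrt_nonneg D
  have hKK : K ≤ K ^ 2 := by nlinarith
  apply comparable_of_le (by linarith)
  · apply le_of_sq_le_sq _ (by positivity)
    rw [hs, mul_pow]
    exact h1.trans (mul_le_mul_of_nonneg_right hKK (sq_nonneg _))
  · apply le_of_sq_le_sq _ (by positivity)
    rw [mul_pow, hs]
    exact h2.trans (mul_le_mul_of_nonneg_right hKK hD)

lemma comparable_sqrt_two {a b : ℝ} (ha : 0 ≤ a) (h1 : a ≤ b) (h2 : b ≤ 2 * a) :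
    Comparable 2 (√a) (√b) := by
  have hsa := Real.sq_sqrt ha
  apply comparable_sqrt (by norm_num) (Real.sqrt_nonneg _) (by linarith) <;> rw [hsa] <;> linarith

/-! ### Spectral edges -/

/-- Parameters for which the perturbation is also small compared with the square of the lower bound
on `Re v` from `re_vInv_ge`, as the analysis of imaginary parts needs. -/
structure Regime (r ε : ℝ) : Prop extends Admissible r ε where
  small : 2 * |ε| ≤ r ^ 4 / 10 ^ 8

/-- The critical points `a` near `1` and `c` near `-1` of the perturbed Joukowski map. -/
structure EdgePair (r ε a c : ℝ) : Prop where
  upper : IsCrit (ε * (1 + r ^ 2)) (2 * ε * r) (ε ^ 2 * r ^ 2) a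
  lower : IsCrit (ε * (1 + r ^ 2)) (2 * ε * r) (ε ^ 2 * r ^ 2) c
  upper_near : |a - 1| ≤ 10 * |ε|
  lower_near : |c + 1| ≤ 10 * |ε|

lemma exists_edgePair (h : Admissible r ε) : ∃ a c, EdgePair r ε a c := by
  obtain ⟨a, ha, ha1⟩ := exists_isCrit_near_one h.smallCoeffs h.two_eps
  obtain ⟨c, hc, hc1⟩ := exists_isCrit_near_one h.smallCoeffs.neg h.two_eps
  refine ⟨a, -c, ha, hc.neg, by linarith, ?_⟩
  rw [← abs_neg]
  convert hc1 using 1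
  · congr 1; ring
  · ring

/-- The edge of the spectrum belonging to the critical point `a`: the energy `z = 1 + r² + r Z` at
the critical value `Z = J(a)`. -/
noncomputable def edge (r ε a : ℝ) : ℝ :=
  1 + r ^ 2 + r * (jouk (ε * (1 + r ^ 2)) (2 * ε * r) (ε ^ 2 * r ^ 2) a).re

lemma edge_ofReal (a : ℝ) : (edge r ε a : ℂ) =
    1 + r ^ 2 + r * jouk (ε * (1 + r ^ 2)) (2 * ε * r) (ε ^ 2 * r ^ 2) a := by
  rw [edge, jouk_ofReal, ofReal_re]
  push_cast
  ring

lemma EdgePair.upper_value {a c : ℝ} (E : EdgePair r ε a c) (h : Admissible r ε) :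
    |(jouk (ε * (1 + r ^ 2)) (2 * ε * r) (ε ^ 2 * r ^ 2) a).re
      - (2 + ε * (1 + r ^ 2) + 2 * ε * r + ε ^ 2 * r ^ 2)| ≤ 104 * ε ^ 2 := by
  have := E.upper.value_near_one h.smallCoeffs h.two_eps (by linarith [E.upper_near])
  rw [← sq_abs ε]
  rw [← sq_abs ε] at this
  linarith

lemma EdgePair.upper_approx {a c : ℝ} (E : EdgePair r ε a c) (h : Admissible r ε) :
    |(jouk (ε * (1 + r ^ 2)) (2 * ε * r) (ε ^ 2 * r ^ 2) a).re - 2| ≤ 8 * |ε| := by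
  have h1 := E.upper_value h
  obtain ⟨ha, hb, hk⟩ := h.smallCoeffs
  have h2 : ε ^ 2 ≤ |ε| * (1 / 2000) := by
    rw [← sq_abs, pow_two]; exact mul_le_mul_of_nonneg_left h.eps (abs_nonneg _)
  rw [abs_le] at *
  constructor <;> linarith

lemma EdgePair.lower_approx {a c : ℝ} (E : EdgePair r ε a c) (h : Admissible r ε) :
    |(jouk (ε * (1 + r ^ 2)) (2 * ε * r) (ε ^ 2 * r ^ 2) c).re + 2| ≤ 8 * |ε| := by
  have hc : IsCrit (ε * (1 + r ^ 2)) (-(2 * ε * r)) (ε ^ 2 * r ^ 2) (-c) :=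
    IsCrit.neg (by rw [neg_neg]; exact E.lower)
  have hn : |-c - 1| ≤ 5 * (2 * |ε|) := by
    rw [← abs_neg]
    convert E.lower_near using 1
    · congr 1; ring
    · ring
  have h1 := hc.value_near_one h.smallCoeffs.neg h.two_eps hn
  obtain ⟨ha, hb, hk⟩ := h.smallCoeffs
  have h2 : |ε| ^ 2 ≤ |ε| * (1 / 2000) := by
    rw [pow_two]; exact mul_le_mul_of_nonneg_left h.eps (abs_nonneg _)
  have h3 : (jouk (ε * (1 + r ^ 2)) (-(2 * ε * r)) (ε ^ 2 * r ^ 2) ((-c : ℝ) : ℂ)).re =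
      -(jouk (ε * (1 + r ^ 2)) (2 * ε * r) (ε ^ 2 * r ^ 2) c).re := by
    rw [ofReal_neg, jouk_neg, neg_neg, neg_re]
  rw [h3] at h1
  rw [abs_le] at *
  constructor <;> linarith

lemma EdgePair.upper_bounds {a c : ℝ} (E : EdgePair r ε a c) (h : Admissible r ε) :
    1 + r ^ 2 + 1.99 * r ≤ edge r ε a ∧ edge r ε a ≤ 1 + r ^ 2 + 2.01 * r := by
  have h1 := abs_le.1 (E.upper_approx h)
  have h2 := h.eps
  have h3 := h.r_pos
  unfold edge
  constructor
  · have := mul_le_mul_of_nonneg_left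
      (by linarith : 1.99 ≤ (jouk (ε * (1 + r ^ 2)) (2 * ε * r) (ε ^ 2 * r ^ 2) a).re) h3.le
    linarith
  · have := mul_le_mul_of_nonneg_left
      (by linarith : (jouk (ε * (1 + r ^ 2)) (2 * ε * r) (ε ^ 2 * r ^ 2) a).re ≤ 2.01) h3.le
    linarith

lemma EdgePair.lower_bounds {a c : ℝ} (E : EdgePair r ε a c) (h : Admissible r ε) :
    edge r ε c ≤ 1 + r ^ 2 - 1.99 * r := by
  have h1 := abs_le.1 (E.lower_approx h)
  have h2 := h.eps
  have h3 := h.r_pos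
  unfold edge
  have := mul_le_mul_of_nonneg_left
    (by linarith : (jouk (ε * (1 + r ^ 2)) (2 * ε * r) (ε ^ 2 * r ^ 2) c).re ≤ -1.99) h3.le
  linarith

/-- Expansion of the upper edge to first order in the sparsity correction. -/
lemma EdgePair.upper_expansion {a c : ℝ} (E : EdgePair r ε a c) (h : Admissible r ε) :
    |edge r ε a - ((1 + r) ^ 2 + r * (1 + r) ^ 2 * ε)| ≤ 105 * ε ^ 2 := by
  have h1 := E.upper_value h
  have h0 := h.r_pos
  have hr1 := h.r_le
  have e1 : edge r ε a - ((1 + r) ^ 2 + r * (1 + r) ^ 2 * ε) =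
      r * ((jouk (ε * (1 + r ^ 2)) (2 * ε * r) (ε ^ 2 * r ^ 2) a).re
      - (2 + ε * (1 + r ^ 2) + 2 * ε * r + ε ^ 2 * r ^ 2)) + r * (ε ^ 2 * r ^ 2) := by
    unfold edge; ring
  rw [e1]
  refine (abs_add_le _ _).trans ?_
  rw [abs_mul, abs_of_pos h0, abs_of_nonneg (by positivity : 0 ≤ r * (ε ^ 2 * r ^ 2))]
  have t1 := mul_le_mul hr1 h1 (abs_nonneg _) (by norm_num)
  have t2 : r ^ 2 ≤ 1 := pow_le_one₀ h0.le hr1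
  have t3 : r * (ε ^ 2 * r ^ 2) ≤ 1 * (ε ^ 2 * 1) := by gcongr
  linarith

lemma EdgePair.upper_ge_of_nonneg {a c : ℝ} (E : EdgePair r ε a c) (h : Admissible r ε)
    (hε : 0 ≤ ε) : (1 + r) ^ 2 ≤ edge r ε a := by
  have h0 := h.r_pos
  have ha : 0 < a := by
    have := abs_le.1 E.upper_near
    linarith [h.eps]
  have h1 : 2 ≤ (jouk (ε * (1 + r ^ 2)) (2 * ε * r) (ε ^ 2 * r ^ 2) a).re := by
    rw [jouk_ofReal, ofReal_re]
    have t1 : 2 ≤ a⁻¹ + a := by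
      rw [inv_eq_one_div, div_add' _ _ _ ha.ne', le_div_iff₀ ha]
      nlinarith [sq_nonneg (a - 1)]
    have t2 : 0 ≤ ε * (1 + r ^ 2) * a + 2 * ε * r * a ^ 2 + ε ^ 2 * r ^ 2 * a ^ 3 := by positivity
    linarith
  unfold edge
  have := mul_le_mul_of_nonneg_left h1 h0.le
  linarith

/-- The lower edge is nonnegative: `z = 0` corresponds to a zero `v < 0` of `r + v + ε r v²`, and
`J(v) ≤ J(c)` at such a point by `IsCrit.jouk_sub`. -/
lemma EdgePair.lower_nonneg {a c : ℝ} (E : EdgePair r ε a c) (h : Admissible r ε) :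
    0 ≤ edge r ε c := by
  have h0 := h.r_pos
  have hr1 := h.r_le
  have hr2 : r ^ 2 ≤ 1 := pow_le_one₀ h0.le hr1
  have hε := abs_le.1 h.eps
  have hcont : ContinuousOn (fun v : ℝ => r + v + ε * r * v ^ 2) (Icc (-2 * r) 0) := by fun_prop
  obtain ⟨v, ⟨hv1, hv2⟩, hv⟩ := intermediate_value_Icc (by linarith) hcont
    (show (0 : ℝ) ∈ Icc _ _ by
      constructor
      · have : ε * r ^ 2 ≤ 1 / 2000 := by nlinarith [sq_nonneg r]
        have := mul_le_mul_of_nonneg_left this h0.le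
        linarith
      · simp [h0.le])
  simp only at hv
  have hvne : v ≠ 0 := by
    rintro rfl
    simp at hv
    linarith
  have hvc : (v : ℂ) ≠ 0 := by exact_mod_cast hvne
  have hvn : ‖(v : ℂ)‖ ≤ 2 := by
    rw [Complex.norm_real, Real.norm_eq_abs, abs_le]; constructor <;> linarith
  have h1 : (v : ℂ) * (((0 : ℂ) - 1 - r ^ 2) / r) =
      joukNum (ε * (1 + r ^ 2)) (2 * ε * r) (ε ^ 2 * r ^ 2) v := by
    rw [← uInv_relation_iff h0]
    have h2 : (r : ℂ) + v + ε * r * v ^ 2 = 0 := by exact_mod_cast hv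
    linear_combination (-(r : ℂ)) * (1 + r * v + ε * (r * v) ^ 2) * h2
  have h2 := (jouk_eq_iff hvc).2 h1
  have h3 := E.lower.jouk_sub hvc
  have hq := E.lower.joukQuot_sub_one h.smallCoeffs hvn
  have hqre : 0 ≤ (joukQuot (2 * ε * r) (ε ^ 2 * r ^ 2) c v).re := by
    have := abs_le.1 ((abs_re_le_norm _).trans hq)
    rw [sub_re, one_re] at this
    linarith [h.eps]
  have h4 : ((v : ℂ) - c) ^ 2 * joukQuot (2 * ε * r) (ε ^ 2 * r ^ 2) c v / v =
      (((v - c) ^ 2 / v : ℝ) : ℂ) * joukQuot (2 * ε * r) (ε ^ 2 * r ^ 2) c v := by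
    push_cast; ring
  have h5 := congrArg re h3
  rw [h4, re_ofReal_mul, sub_re, h2, scaled_re, zero_re] at h5
  have h6 : (v - c) ^ 2 / v ≤ 0 := div_nonpos_of_nonneg_of_nonpos (sq_nonneg _) hv2
  have h7 := mul_nonpos_of_nonpos_of_nonneg h6 hqre
  rw [← h5, sub_nonpos, div_le_iff₀ h0] at h7
  unfold edge
  linarith

lemma uInv_im_eq (z : ℂ) : (uInv r ε z).im = r * (vInv r ε z).im := by
  rw [uInv, im_ofReal_mul]

lemma norm_uInv_eq (h : Admissible r ε) (z : ℂ) : ‖uInv r ε z‖ = r * ‖vInv r ε z‖ := by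
  rw [uInv, norm_mul, Complex.norm_real, Real.norm_eq_abs, abs_of_pos h.r_pos]

section
variable (h : Admissible r ε) {z : ℂ} (hz : 0 ≤ z.im)
include h hz

lemma vInv_ne_zero : vInv r ε z ≠ 0 := ne_zero_of_joukNum (vInv_spec h hz).2

lemma norm_vInv_le : ‖vInv r ε z‖ ≤ 1.01 := by
  have := norm_le_of_mem_lowerDom h.smallCoeffs h.two_eps (vInv_spec h hz).1
  linarith [h.eps]

lemma jouk_vInv : jouk (ε * (1 + r ^ 2)) (2 * ε * r) (ε ^ 2 * r ^ 2) (vInv r ε z) =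
    (z - 1 - r ^ 2) / r :=
  (jouk_eq_iff (vInv_ne_zero h hz)).2 (vInv_spec h hz).2

lemma sub_edge (a : ℝ) : z - edge r ε a =
    r * (jouk (ε * (1 + r ^ 2)) (2 * ε * r) (ε ^ 2 * r ^ 2) (vInv r ε z)
      - jouk (ε * (1 + r ^ 2)) (2 * ε * r) (ε ^ 2 * r ^ 2) a) := by
  have hr : (r : ℂ) ≠ 0 := by exact_mod_cast h.r_pos.ne'
  rw [edge_ofReal, jouk_vInv h hz]
  field_simp
  ring

lemma norm_sub_edge (a : ℝ) : ‖z - edge r ε a‖ =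
    r * ‖jouk (ε * (1 + r ^ 2)) (2 * ε * r) (ε ^ 2 * r ^ 2) (vInv r ε z)
      - jouk (ε * (1 + r ^ 2)) (2 * ε * r) (ε ^ 2 * r ^ 2) a‖ := by
  rw [sub_edge h hz, norm_mul, Complex.norm_real, Real.norm_eq_abs, abs_of_pos h.r_pos]

lemma norm_vInv_ge (hn : ‖z‖ ≤ 8) : r / 20 ≤ ‖vInv r ε z‖ := by
  have h0 := h.r_pos
  have hZ : ‖(z - 1 - (r : ℂ) ^ 2) / r‖ ≤ 10 / r := by
    rw [norm_div, Complex.norm_real, Real.norm_eq_abs, abs_of_pos h0]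
    apply div_le_div_of_nonneg_right _ h0.le
    have h1 := norm_sub_le (z - 1) ((r : ℂ) ^ 2)
    have h2 := norm_sub_le z 1
    rw [norm_one] at h2
    have h3 : ‖(r : ℂ) ^ 2‖ ≤ 1 := by
      rw [norm_pow, Complex.norm_real, Real.norm_eq_abs, abs_of_pos h0]
      exact pow_le_one₀ h0.le h.r_le
    linarith
  have h1 := norm_lower_bound h.smallCoeffs h.two_eps (vInv_spec h hz).2
    (B := 10 / r) (by rw [le_div_iff₀ h0]; linarith [h.r_le]) hZ
  have e1 : 1 / (2 * (10 / r)) = r / 20 := by field_simp; norm_num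
  rwa [e1] at h1

lemma sqrt_dist_bounds {a c : ℝ} (E : EdgePair r ε a c) (hn : ‖z‖ ≤ 8) :
    ‖vInv r ε z - a‖ ^ 2 * r ≤ 1.04 * ‖z - edge r ε a‖ ∧
      ‖z - edge r ε a‖ ≤ 21 * ‖vInv r ε z - a‖ ^ 2 := by
  have h0 := h.r_pos
  have hv := norm_vInv_le h hz
  obtain ⟨h1, h2⟩ := E.upper.dist_comparable h.smallCoeffs h.two_eps (v := vInv r ε z)
    (by linarith) (vInv_ne_zero h hz)
  have h3 := norm_vInv_ge h hz hn
  rw [norm_sub_edge h hz]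
  set J := ‖jouk (ε * (1 + r ^ 2)) (2 * ε * r) (ε ^ 2 * r ^ 2) (vInv r ε z)
      - jouk (ε * (1 + r ^ 2)) (2 * ε * r) (ε ^ 2 * r ^ 2) a‖
  have hJ : 0 ≤ J := norm_nonneg _
  have h4 := mul_le_mul_of_nonneg_right hv hJ
  have h5 := mul_le_mul_of_nonneg_right h3 hJ
  constructor
  · have h6 : ‖vInv r ε z - a‖ ^ 2 ≤ 1.04 * J := by linarith
    have := mul_le_mul_of_nonneg_right h6 h0.le
    linarith
  · linarith [sq_nonneg ‖vInv r ε z - a‖]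

lemma re_vInv_ge {a c : ℝ} (E : EdgePair r ε a c) (hn : ‖z‖ ≤ 8) (hre : edge r ε a - r ≤ z.re) :
    r ^ 2 / 1000 ≤ (vInv r ε z).re := by
  have h0 := h.r_pos
  have h1 := (E.upper_bounds h).1
  have h2 : 0.98 ≤ (jouk (ε * (1 + r ^ 2)) (2 * ε * r) (ε ^ 2 * r ^ 2) (vInv r ε z)).re := by
    rw [jouk_vInv h hz, scaled_re, le_div_iff₀ h0]
    linarith
  have h3 := re_lower_bound h.smallCoeffs h.two_eps (norm_vInv_le h hz) (vInv_ne_zero h hz) h2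
  have h4 := pow_le_pow_left₀ (by positivity) (norm_vInv_ge h hz hn) 2
  nlinarith

end

/-- Square-root growth of the imaginary part inside the spectrum, near the upper edge. -/
lemma im_uInv_inside (h : Regime r ε) {a c : ℝ} (E : EdgePair r ε a c) {z : ℂ} (hz : 0 ≤ z.im)
    (hn : ‖z‖ ≤ 8) (h1 : edge r ε a - r ≤ z.re) (h2 : z.re ≤ edge r ε a) :
    Comparable (126000 / r ^ 4) (-(uInv r ε z).im) (√‖z - edge r ε a‖) := by
  have hA := h.toAdmissible
  have h0 := hA.r_pos
  have hr1 := hA.r_le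
  have hr4 : r ^ 4 ≤ 1 := pow_le_one₀ h0.le hr1
  have hx := re_vInv_ge hA hz E hn h1
  have hre : (jouk (ε * (1 + r ^ 2)) (2 * ε * r) (ε ^ 2 * r ^ 2) (vInv r ε z)).re ≤
      (jouk (ε * (1 + r ^ 2)) (2 * ε * r) (ε ^ 2 * r ^ 2) a).re := by
    rw [jouk_vInv hA hz, scaled_re, div_le_iff₀ h0]
    unfold edge at h2
    linarith
  have hkey := E.upper.im_sq_ge hA.smallCoeffs ((le_abs_self _).trans E.upper.le)
    (norm_vInv_le hA hz) (vInv_ne_zero hA hz) (by positivity) hx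
    (h.small.trans (le_of_eq (by ring))) hre
  obtain ⟨d1, d2⟩ := sqrt_dist_bounds hA hz E hn
  have hvim : (vInv r ε z).im ^ 2 ≤ ‖vInv r ε z - a‖ ^ 2 := by
    rw [sq_norm_sub_ofReal]; linarith [sq_nonneg ((vInv r ε z).re - a)]
  have him : (-(uInv r ε z).im) ^ 2 = r ^ 2 * (vInv r ε z).im ^ 2 := by
    rw [uInv_im_eq]; ring
  have hK : 1 ≤ 126000 / r ^ 4 := by
    rw [le_div_iff₀ (by positivity)]; linarith
  apply comparable_sqrt hK (by linarith [uInv_im_nonpos hA hz]) (norm_nonneg _)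
  · rw [him, div_mul_eq_mul_div, le_div_iff₀ (by positivity)]
    have t1 : r ^ 2 * ‖vInv r ε z - a‖ ^ 2 ≤ 6000 * (vInv r ε z).im ^ 2 := by linarith
    have t2 := mul_le_mul_of_nonneg_left t1 (by positivity : 0 ≤ 21 * r ^ 2)
    have t3 := mul_le_mul_of_nonneg_right d2 (by positivity : 0 ≤ r ^ 4)
    linarith
  · rw [him]
    have t1 := mul_le_mul_of_nonneg_left hvim (by positivity : 0 ≤ r ^ 2)
    have t2 : r * (‖vInv r ε z - a‖ ^ 2 * r) ≤ 1 * (1.04 * ‖z - edge r ε a‖) :=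
      mul_le_mul hr1 d1 (by positivity) (by norm_num)
    have t3 : 1.04 ≤ 126000 / r ^ 4 := by
      rw [le_div_iff₀ (by positivity)]; linarith
    have t4 := mul_le_mul_of_nonneg_right t3 (norm_nonneg (z - edge r ε a))
    linarith

/-- Size of the imaginary part outside the spectrum, to the right of the upper edge. -/
lemma im_uInv_outside (h : Regime r ε) {a c : ℝ} (E : EdgePair r ε a c) {z : ℂ} (hz : 0 ≤ z.im)
    (hn : ‖z‖ ≤ 8) (h1 : edge r ε a < z.re) :
    Comparable (16000 / r ^ 3) (-(uInv r ε z).im) (z.im / √‖z - edge r ε a‖) := by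
  have hA := h.toAdmissible
  have h0 := hA.r_pos
  have hr1 := hA.r_le
  have hr3 : r ^ 3 ≤ 1 := pow_le_one₀ h0.le hr1
  have hr2 : r ^ 2 ≤ 1 := pow_le_one₀ h0.le hr1
  have hx := re_vInv_ge hA hz E hn (by linarith)
  have hre : (jouk (ε * (1 + r ^ 2)) (2 * ε * r) (ε ^ 2 * r ^ 2) a).re ≤
      (jouk (ε * (1 + r ^ 2)) (2 * ε * r) (ε ^ 2 * r ^ 2) (vInv r ε z)).re := by
    rw [jouk_vInv hA hz, scaled_re, le_div_iff₀ h0]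
    unfold edge at h1
    linarith
  have ha1 : 0.99 ≤ a := by
    have := abs_le.1 E.upper_near
    linarith [hA.eps]
  have hS1 := E.upper.slope_ge hA.smallCoeffs ha1 (norm_vInv_le hA hz) (vInv_ne_zero hA hz)
    (by positivity) hx (h.small.trans (le_of_eq (by ring))) (vInv_spec hA hz).1 hre
  have hS2 := E.upper.slope_le hA.smallCoeffs hA.two_eps (norm_vInv_le hA hz)
  have hrel := normSq_mul_im_of_joukNum (vInv_spec hA hz).2
  rw [scaled_im] at hrel
  set S := 1 - normSq (vInv r ε z) *
    joukSlope (ε * (1 + r ^ 2)) (2 * ε * r) (ε ^ 2 * r ^ 2) (vInv r ε z) with hS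
  obtain ⟨d1, d2⟩ := sqrt_dist_bounds hA hz E hn
  set D := ‖vInv r ε z - a‖
  set q := √‖z - edge r ε a‖ with hq
  have hq2 : q ^ 2 = ‖z - edge r ε a‖ := Real.sq_sqrt (norm_nonneg _)
  have hqpos : 0 < q := by
    apply Real.sqrt_pos.2
    apply norm_pos_iff.2
    intro h'
    have := congrArg re h'
    simp at this
    linarith
  rw [← hq2] at d1 d2
  have hD0 : 0 ≤ D := norm_nonneg _
  have hDl : q ≤ 5 * D := by
    apply le_of_sq_le_sq _ (by positivity)
    linarith [sq_nonneg D]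
  have hDu : r * D ≤ 2 * q := by
    apply le_of_sq_le_sq _ (by positivity)
    have := mul_le_mul_of_nonneg_left d1 h0.le
    have := mul_le_mul_of_nonneg_right hr1 (sq_nonneg q)
    linarith [sq_nonneg q]
  -- `η |v|² = t S` with `t = -Im u`
  have hts : z.im * normSq (vInv r ε z) = -(uInv r ε z).im * S := by
    rw [uInv_im_eq, hS]
    have e : z.im / r * r = z.im := div_mul_cancel₀ _ h0.ne'
    linear_combination r * hrel - normSq (vInv r ε z) * e
  set t := -(uInv r ε z).im
  have ht0 : 0 ≤ t := by linarith [uInv_im_nonpos hA hz]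
  have hv1 : normSq (vInv r ε z) ≤ 1.03 := by
    rw [← Complex.sq_norm]
    have := pow_le_pow_left₀ (norm_nonneg _) (norm_vInv_le hA hz) 2
    linarith
  have hv2 : r ^ 2 / 400 ≤ normSq (vInv r ε z) := by
    rw [← Complex.sq_norm]
    have := pow_le_pow_left₀ (by positivity) (norm_vInv_ge hA hz hn) 2
    linarith
  apply comparable_of_le (by positivity)
  · rw [div_le_iff₀ hqpos, div_mul_eq_mul_div, div_mul_eq_mul_div, le_div_iff₀ (by positivity)]
    have k1 := mul_le_mul_of_nonneg_left hv2 hz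
    have k2 := mul_le_mul_of_nonneg_left hS2 ht0
    have k3 := mul_le_mul_of_nonneg_left hDu ht0
    have k4 : z.im * (r ^ 2 / 400) * r ≤ t * (4 * D) * r :=
      mul_le_mul_of_nonneg_right (by linarith) h0.le
    have := mul_nonneg ht0 hqpos.le
    linarith
  · rw [div_mul_div_comm, le_div_iff₀ (by positivity)]
    have k1 := mul_le_mul_of_nonneg_left hv1 hz
    have k2 := mul_le_mul_of_nonneg_left hS1 ht0
    have k3 := mul_le_mul_of_nonneg_left hDl (by positivity : 0 ≤ t * r ^ 2)
    have k4 : t * q * r ^ 2 ≤ 16000 * z.im := by linarith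
    have k5 := mul_le_mul_of_nonneg_left hr1 (by positivity : 0 ≤ t * q * r ^ 2)
    linarith

/-- The imaginary parts of the solution and of the parameter `u` are comparable. -/
lemma im_mSol_comparable (h : Admissible r ε) {z : ℂ} (hz : 0 ≤ z.im) (hz0 : z ≠ 0) (hn : ‖z‖ ≤ 8)
    {R : ℝ} (hR : 1 ≤ R) (hm : ‖mSol r ε z‖ ≤ R) :
    Comparable (800 * R ^ 2 / r ^ 2) (mSol r ε z).im (-(uInv r ε z).im) := by
  have h0 := h.r_pos
  have hr1 := h.r_le
  have hr2 : r ^ 2 ≤ 1 := pow_le_one₀ h0.le hr1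
  have hY0 := sq_add_ne_zero h hz hz0
  have hY1 := norm_quad_bounds h hz (r ^ 2) (by rw [abs_of_nonneg (by positivity)]; exact hr2)
  have hYl : r ^ 2 / 20 ≤ R * ‖r ^ 2 + uInv r ε z + ε * uInv r ε z ^ 2‖ := by
    have h1 : ‖mSol r ε z‖ * ‖r ^ 2 + uInv r ε z + ε * uInv r ε z ^ 2‖ = ‖uInv r ε z‖ := by
      rw [mSol, norm_div, norm_neg]
      exact div_mul_cancel₀ _ (norm_ne_zero_iff.2 hY0)
    have h2 := norm_vInv_ge h hz hn
    have h3 := mul_le_mul_of_nonneg_right hm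
      (norm_nonneg (r ^ 2 + uInv r ε z + ε * uInv r ε z ^ 2))
    rw [h1, norm_uInv_eq h] at h3
    have := mul_le_mul_of_nonneg_left h2 h0.le
    linarith
  have him : (mSol r ε z).im = -(uInv r ε z).im * (r ^ 2 - ε * normSq (uInv r ε z))
      / normSq (r ^ 2 + uInv r ε z + ε * uInv r ε z ^ 2) := by
    have := im_neg_div_quad (ε := ε) (uInv r ε z) (r ^ 2)
    push_cast at this
    exact this
  have hε := abs_le.1 (eps_mul_normSq_le h hz)
  have hε2 : 2 * |ε| * r ^ 2 ≤ 1 / 1000 * r ^ 2 :=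
    mul_le_mul_of_nonneg_right h.two_eps (sq_nonneg _)
  rw [him, ← Complex.sq_norm (r ^ 2 + uInv r ε z + ε * uInv r ε z ^ 2)]
  push_cast at hY1
  have hYp := norm_pos_iff.2 hY0
  set Y := ‖r ^ 2 + uInv r ε z + ε * uInv r ε z ^ 2‖
  set t := -(uInv r ε z).im
  have ht0 : 0 ≤ t := by linarith [uInv_im_nonpos h hz]
  set g := r ^ 2 - ε * normSq (uInv r ε z)
  have hr2pos : 0 < r ^ 2 := by positivity
  have hg1 : r ^ 2 / 2 ≤ g := by linarith
  have hg2 : g ≤ 2 * r ^ 2 := by linarith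
  have hYsq : Y ^ 2 ≤ 2.1 ^ 2 := pow_le_pow_left₀ hYp.le hY1 2
  have hYsq2 := pow_le_pow_left₀ (by positivity) hYl 2
  have hRR : 1 ≤ R ^ 2 := one_le_pow₀ hR
  apply comparable_of_le (by positivity)
  · rw [div_mul_div_comm, le_div_iff₀ (by positivity)]
    have k1 := mul_le_mul_of_nonneg_left hg1 ht0
    have k2 : r ^ 2 * Y ^ 2 ≤ r ^ 2 * 2.1 ^ 2 := mul_le_mul_of_nonneg_left hYsq hr2pos.le
    have k3 := mul_le_mul_of_nonneg_left k2 ht0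
    have k4 := mul_le_mul_of_nonneg_right hRR (mul_nonneg ht0 (by linarith) : 0 ≤ t * g)
    have k5 : 0 ≤ t * r ^ 2 := by positivity
    linarith
  · rw [div_le_iff₀ (by positivity), div_mul_eq_mul_div, div_mul_eq_mul_div,
      le_div_iff₀ (by positivity)]
    have k1 := mul_le_mul_of_nonneg_left hg2 (by positivity : 0 ≤ t * r ^ 2)
    have k2 := mul_le_mul_of_nonneg_left hYsq2 ht0
    linarith

/-! ### The quartic equation -/

/-- The quartic polynomial in terms of `r` and `ε`. -/
def quarticP (r ε : ℝ) (z w : ℂ) : ℂ :=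
  1 + (z + 1 - r ^ 2) * w + z * w ^ 2 + ε * w ^ 2 * (z * w + 1 - r ^ 2) ^ 2

lemma mul_mSol_add (h : Admissible r ε) {z : ℂ} (hz : 0 ≤ z.im) (hz0 : z ≠ 0) :
    z * mSol r ε z + 1 - r ^ 2 = -(r ^ 2 + uInv r ε z + ε * uInv r ε z ^ 2) := by
  have h2 := sq_add_ne_zero h hz hz0
  have h3 := uInv_relation h hz
  have h4 : z * mSol r ε z = -(1 + uInv r ε z + ε * uInv r ε z ^ 2) := by
    unfold mSol
    rw [mul_div_assoc', div_eq_iff h2]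
    linear_combination -h3
  rw [h4]; ring

lemma mSol_mul (h : Admissible r ε) {z : ℂ} (hz : 0 ≤ z.im) (hz0 : z ≠ 0) :
    mSol r ε z * (z * mSol r ε z + 1 - r ^ 2) = uInv r ε z := by
  have h2 := sq_add_ne_zero h hz hz0
  rw [mul_mSol_add h hz hz0, mSol, div_mul_eq_mul_div, div_eq_iff h2]
  ring

lemma quarticP_eq (z w : ℂ) : quarticP r ε z w = r ^ 2 + (z * w + 1 - r ^ 2)
    + w * (z * w + 1 - r ^ 2) + ε * (w * (z * w + 1 - r ^ 2)) ^ 2 := by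
  unfold quarticP; ring

lemma quarticP_mSol (h : Admissible r ε) {z : ℂ} (hz : 0 ≤ z.im) (hz0 : z ≠ 0) :
    quarticP r ε z (mSol r ε z) = 0 := by
  rw [quarticP_eq, mSol_mul h hz hz0, mul_mSol_add h hz hz0]
  ring

lemma mSol_im_pos (h : Admissible r ε) {z : ℂ} (hz : 0 < z.im) : 0 < (mSol r ε z).im := by
  have hz0 : z ≠ 0 := by rintro rfl; simp at hz
  have him := im_neg_div_quad (ε := ε) (uInv r ε z) (r ^ 2)
  push_cast at him
  rw [mSol, him]
  have hε := abs_le.1 (eps_mul_normSq_le h hz.le)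
  have hr2 : 0 < r ^ 2 := by have := h.r_pos; positivity
  have hε2 : 2 * |ε| * r ^ 2 ≤ 1 / 1000 * r ^ 2 :=
    mul_le_mul_of_nonneg_right h.two_eps (sq_nonneg _)
  have hu := uInv_im_neg h hz
  exact div_pos (mul_pos (by linarith) (by linarith)) (normSq_pos.2 (sq_add_ne_zero h hz.le hz0))

/-- Uniqueness among bounded solutions with positive imaginary part. For a solution `w` the number
`u = w (z w + 1 - r²)` satisfies the relation defining `uInv`, and `Im w > 0` forces `Im u ≤ 0`. It
need not lie in the region where `uInv` takes its values, but it is bounded, and a second point with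
the same image is excluded by `dividedDiff_ne_zero`. -/
lemma quarticP_unique (h : Admissible r ε) {z w : ℂ} (hz : 0 < z.im) (hn : ‖z‖ ≤ 8) {R : ℝ}
    (hR : 1 ≤ R) (hε : 200 * |ε| * (R * (8 * R + 1)) ^ 2 ≤ r ^ 2) (hw : quarticP r ε z w = 0)
    (hwi : 0 < w.im) (hwR : ‖w‖ ≤ R) : w = mSol r ε z := by
  have h0 := h.r_pos
  have hr1 := h.r_le
  have hrc : (r : ℂ) ≠ 0 := by exact_mod_cast h0.ne'
  have hz0 : z ≠ 0 := by rintro rfl; simp at hz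
  have hw0 : w ≠ 0 := by rintro rfl; simp at hwi
  set y : ℂ := z * w + 1 - r ^ 2 with hy
  set u : ℂ := w * y with hu
  have hyu : y = -(r ^ 2 + u + ε * u ^ 2) := by
    rw [quarticP_eq] at hw
    linear_combination hw
  have hu0 : u ≠ 0 := by
    intro hu0
    have hy0 : y = 0 := by
      rw [hu] at hu0
      exact (mul_eq_zero.1 hu0).resolve_left hw0
    rw [hy0, hu0] at hyu
    have : (r : ℂ) ^ 2 = 0 := by linear_combination hyu
    exact hrc (pow_eq_zero_iff two_ne_zero |>.1 this)
  have hy0 : y ≠ 0 := by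
    intro hy0
    rw [hu, hy0, mul_zero] at hu0
    exact hu0 rfl
  have hrel : u * z = (r ^ 2 + u + ε * u ^ 2) * (1 + u + ε * u ^ 2) := by
    have e1 : u * z = y * (y - (1 - r ^ 2)) := by rw [hu, hy]; ring
    rw [e1]
    linear_combination (y - (r ^ 2 + u + ε * u ^ 2) - (1 - (r : ℂ) ^ 2)) * hyu
  have hY0 : (r : ℂ) ^ 2 + u + ε * u ^ 2 ≠ 0 := by
    intro h'
    rw [h', neg_zero] at hyu
    exact hy0 hyu
  have hwu : w = -u / (r ^ 2 + u + ε * u ^ 2) := by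
    rw [eq_div_iff hY0]
    linear_combination w * hyu + hu
  have hU : ‖u‖ ≤ R * (8 * R + 1) := by
    rw [hu, norm_mul]
    have hr2 : r ^ 2 ≤ 1 := pow_le_one₀ h0.le hr1
    have h1 : ‖y‖ ≤ 8 * R + 1 := by
      have e1 : y = z * w + ((1 - r ^ 2 : ℝ) : ℂ) := by rw [hy]; push_cast; ring
      rw [e1]
      refine (norm_add_le _ _).trans (add_le_add ?_ ?_)
      · rw [norm_mul]; gcongr
      · rw [Complex.norm_real, Real.norm_eq_abs, abs_le]
        constructor <;> linarith [sq_nonneg r]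
    exact mul_le_mul hwR h1 (norm_nonneg _) (by linarith)
  have hU1 : 9 ≤ R * (8 * R + 1) := by nlinarith
  have hεu : |ε * normSq u| < r ^ 2 := by
    rw [abs_mul, ← Complex.sq_norm, abs_of_nonneg (sq_nonneg ‖u‖)]
    have h1 := pow_le_pow_left₀ (norm_nonneg _) hU 2
    have h2 := mul_le_mul_of_nonneg_left h1 (abs_nonneg ε)
    have h3 : 0 < r ^ 2 := by positivity
    linarith
  have hui : u.im ≤ 0 := by
    have him := im_neg_div_quad (ε := ε) u (r ^ 2)
    push_cast at him
    rw [← hwu] at him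
    by_contra hlt
    push Not at hlt
    have h1 := (abs_lt.1 hεu).2
    have h2 : -u.im * (r ^ 2 - ε * normSq u) / normSq (r ^ 2 + u + ε * u ^ 2) ≤ 0 :=
      div_nonpos_of_nonpos_of_nonneg
        (mul_nonpos_of_nonpos_of_nonneg (by linarith) (by linarith)) (normSq_nonneg _)
    linarith
  -- compare with the distinguished solution in the Joukowski coordinate
  have huv : u = uInv r ε z := by
    by_contra hne
    set v : ℂ := u / r with hv
    have hrv : (r : ℂ) * v = u := by rw [hv]; field_simp
    have hvZ := (uInv_relation_iff h0 (v := v) (z := z) (ε := ε)).1 (by rw [hrv]; exact hrel)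
    have hv0 := ne_zero_of_joukNum hvZ
    have hvne : v ≠ vInv r ε z := by
      intro h'
      exact hne (by rw [← hrv, h', uInv])
    have hvi : v.im ≤ 0 := by
      rw [hv, div_ofReal_im]; exact div_nonpos_of_nonpos_of_nonneg hui h0.le
    have hvi' := im_neg_of_im_pos (vInv_spec h hz.le).2
      (by rw [scaled_im]; exact div_pos hz h0) (vInv_spec h hz.le).1
    set V : ℝ := R * (8 * R + 1) / r with hV
    have hV9 : 9 ≤ V := by rw [hV, le_div_iff₀ h0]; linarith
    have hvV : ‖v‖ ≤ V := by
      rw [hv, norm_div, Complex.norm_real, Real.norm_eq_abs, abs_of_pos h0, hV]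
      exact div_le_div_of_nonneg_right hU h0.le
    have hd := dividedDiff_ne_zero h.smallCoeffs (V := V) (by linarith)
      (by
        rw [hV, div_pow, mul_div_assoc', div_le_one (by positivity)]
        linarith) hv0 (vInv_ne_zero h hz.le) hvV
      ((norm_vInv_le h hz.le).trans (by linarith)) hvi hvi'.le (by linarith)
    have hs := jouk_sub (α := ε * (1 + r ^ 2)) (β := 2 * ε * r) (κ := ε ^ 2 * r ^ 2) hv0
      (vInv_ne_zero h hz.le)
    rw [(jouk_eq_iff hv0).2 hvZ, jouk_vInv h hz.le, sub_self] at hs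
    exact (mul_ne_zero (sub_ne_zero.2 hvne) hd) hs.symm
  rw [hwu, huv, mSol]

lemma hasDerivAt_quarticP (z w : ℂ) : HasDerivAt (quarticP r ε z)
    ((z + 1 - r ^ 2) + 2 * z * w
      + 2 * ε * (w * (z * w + 1 - r ^ 2)) * (2 * z * w + 1 - r ^ 2)) w := by
  have h1 : HasDerivAt (fun w : ℂ => z * w + 1 - r ^ 2) z w := by
    simpa using (((hasDerivAt_id w).const_mul z).add_const (1 : ℂ)).sub_const ((r : ℂ) ^ 2)
  have h2 := ((((hasDerivAt_id w).const_mul (z + 1 - (r : ℂ) ^ 2)).const_add 1).add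
    (((hasDerivAt_id w).pow 2).const_mul z)).add
    ((((hasDerivAt_id w).pow 2).const_mul (ε : ℂ)).mul (h1.pow 2))
  refine HasDerivAt.congr_deriv (f := quarticP r ε z) h2 ?_
  simp only [id, Pi.pow_apply]
  push_cast
  ring

/-- The derivative of the quartic at the solution is the derivative of the perturbed Joukowski map
in disguise. -/
lemma deriv_quarticP_mSol (h : Admissible r ε) {z : ℂ} (hz : 0 ≤ z.im) (hz0 : z ≠ 0) :
    deriv (quarticP r ε z) (mSol r ε z) =
      -(r * (joukCrit (ε * (1 + r ^ 2)) (2 * ε * r) (ε ^ 2 * r ^ 2) (vInv r ε z)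
        / vInv r ε z)) := by
  have hrc : (r : ℂ) ≠ 0 := by exact_mod_cast h.r_pos.ne'
  have h1 := mul_mSol_add h hz hz0
  have h2 := mSol_mul h hz hz0
  have h3 := uInv_relation h hz
  have hv := vInv_ne_zero h hz
  rw [(hasDerivAt_quarticP z _).deriv, h2]
  have e1 : 2 * z * mSol r ε z + 1 - r ^ 2 =
      -(r ^ 2 + uInv r ε z + ε * uInv r ε z ^ 2) - (1 + uInv r ε z + ε * uInv r ε z ^ 2) := by
    linear_combination 2 * h1
  have e2 : (z + 1 - r ^ 2) + 2 * z * mSol r ε z =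
      z - (r ^ 2 + uInv r ε z + ε * uInv r ε z ^ 2) - (1 + uInv r ε z + ε * uInv r ε z ^ 2) := by
    linear_combination e1
  rw [e1, e2]
  have hu : uInv r ε z = r * vInv r ε z := rfl
  rw [hu] at h3 ⊢
  apply mul_left_cancel₀ (mul_ne_zero hrc hv)
  unfold joukCrit
  push_cast
  field_simp
  field_simp at h3
  linear_combination h3

/-! ### The spectral measure and its edges -/

/-- Beyond the edges the parameter `u` is real. For the critical point near `1` the condition reads
`edge ≤ x`, for that near `-1` it reads `x ≤ edge`. -/
lemma uInv_ofReal_im (h : Admissible r ε) {a x : ℝ}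
    (ha : IsCrit (ε * (1 + r ^ 2)) (2 * ε * r) (ε ^ 2 * r ^ 2) a)
    (hx : a * (edge r ε a - x) ≤ 0) : (uInv r ε x).im = 0 := by
  have h0 := h.r_pos
  have e1 : (((x : ℂ) - 1 - (r : ℂ) ^ 2) / r) = (((x - 1 - r ^ 2) / r : ℝ) : ℂ) := by push_cast; rfl
  have e2 : a * ((jouk (ε * (1 + r ^ 2)) (2 * ε * r) (ε ^ 2 * r ^ 2) a).re - (x - 1 - r ^ 2) / r)
      = a * (edge r ε a - x) / r := by
    rw [edge, eq_div_iff h0.ne', mul_assoc, sub_mul, div_mul_cancel₀ _ h0.ne']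
    ring
  rw [uInv_im_eq, vInv, e1, joukInv_im_eq_zero ha h.smallCoeffs h.two_eps, mul_zero]
  rw [e2]
  exact div_nonpos_of_nonpos_of_nonneg hx h0.le

lemma EdgePair.uInv_im_eq_zero {a c x : ℝ} (E : EdgePair r ε a c) (h : Admissible r ε)
    (hx : x ∉ Icc (edge r ε c) (edge r ε a)) : (uInv r ε x).im = 0 := by
  have hε := h.eps
  have ha := (abs_le.1 E.upper_near).1
  have hc := (abs_le.1 E.lower_near).2
  by_cases h1 : edge r ε c ≤ x
  · have h2 : edge r ε a < x := by
      by_contra h'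
      exact hx ⟨h1, not_lt.1 h'⟩
    exact uInv_ofReal_im h E.upper
      (mul_nonpos_of_nonneg_of_nonpos (by linarith) (by linarith))
  · exact uInv_ofReal_im h E.lower
      (mul_nonpos_of_nonpos_of_nonneg (by linarith) (by linarith))

lemma EdgePair.integrable_specDensity {a c : ℝ} (E : EdgePair r ε a c) (h : Admissible r ε) :
    Integrable (specDensity r ε) := by
  refine SparseCov.integrable_specDensity h (c := 5) (by norm_num) fun x hx => ?_
  refine E.uInv_im_eq_zero h fun hx' => ?_
  have h1 := E.lower_nonneg h
  have h2 := (E.upper_bounds h).2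
  have h3 : r ^ 2 ≤ 1 := pow_le_one₀ h.r_pos.le h.r_le
  rw [abs_of_nonneg (h1.trans hx'.1)] at hx
  linarith [hx'.2, h.r_le]

lemma EdgePair.specMeasure_compl {a c : ℝ} (E : EdgePair r ε a c) (h : Admissible r ε) :
    specMeasure r ε ({0} ∪ Icc (edge r ε c) (edge r ε a))ᶜ = 0 := by
  have hm : MeasurableSet ({0} ∪ Icc (edge r ε c) (edge r ε a))ᶜ :=
    ((measurableSet_singleton 0).union measurableSet_Icc).compl
  rw [specMeasure, Measure.add_apply, Measure.smul_apply, Measure.dirac_apply' _ hm,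
    withDensity_apply _ hm]
  have h1 : ∫⁻ x in ({0} ∪ Icc (edge r ε c) (edge r ε a))ᶜ,
      ENNReal.ofReal (specDensity r ε x) = 0 := by
    rw [setLIntegral_congr_fun hm (g := fun _ => 0), lintegral_zero]
    intro x hx
    have hx' : x ∉ Icc (edge r ε c) (edge r ε a) := fun h' => hx (Or.inr h')
    simp only [SparseCov.specDensity_eq_zero (E.uInv_im_eq_zero h hx'), ENNReal.ofReal_zero]
  rw [h1]
  simp

lemma restrict_specMeasure {S : Set ℝ} (hS : MeasurableSet S) (h0 : (0 : ℝ) ∉ S) :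
    (specMeasure r ε).restrict S =
      (volume.restrict S).withDensity fun x => ENNReal.ofReal (specDensity r ε x) := by
  classical
  rw [specMeasure, Measure.restrict_add, Measure.restrict_smul, MeasureTheory.restrict_dirac' hS,
    if_neg h0, smul_zero, zero_add, restrict_withDensity hS]

lemma specDensity_eq (h : Admissible r ε) {x : ℝ} (hx : x ≠ 0) :
    specDensity r ε x = (mSol r ε x).im / Real.pi := by
  have h1 : ((1 - (r : ℂ) ^ 2) / x).im = 0 := by
    have : ((1 - (r : ℂ) ^ 2) / x) = (((1 - r ^ 2) / x : ℝ) : ℂ) := by push_cast; rfl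
    rw [this, ofReal_im]
  rw [specDensity, mSol_eq h (by simp) (by simpa using hx), sub_im, h1, sub_zero]

lemma norm_mul_mSol_le (h : Admissible r ε) {z : ℂ} (hz : 0 ≤ z.im) (hz0 : z ≠ 0) :
    ‖z‖ * ‖mSol r ε z‖ ≤ 2.1 := by
  have h1 := norm_quad_bounds h hz 1 (by simp)
  have h2 : z * mSol r ε z = -(((1 : ℝ) : ℂ) + uInv r ε z + ε * uInv r ε z ^ 2) := by
    push_cast
    linear_combination mul_mSol_add h hz hz0
  rwa [← norm_mul, h2, norm_neg]

lemma Comparable.div_left {K a b η : ℝ} (h : Comparable K a b) (hK : 0 < K) (ha : 0 < a)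
    (hb : 0 < b) (hη : 0 ≤ η) : Comparable K (η / a) (η / b) := by
  obtain ⟨h1, h2⟩ := h
  rw [inv_mul_le_iff₀ hK] at h1
  apply comparable_of_le hK
  · rw [mul_div_assoc', div_le_div_iff₀ hb ha]
    have := mul_le_mul_of_nonneg_left h2 hη
    linarith
  · rw [mul_div_assoc', div_le_div_iff₀ ha hb]
    have := mul_le_mul_of_nonneg_left h1 hη
    linarith

lemma comparable_div_pi {x : ℝ} (hx : 0 ≤ x) : Comparable 4 (x / Real.pi) x := by
  have h3 := Real.pi_gt_three
  have h4 := Real.pi_le_four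
  have hp := Real.pi_pos
  apply comparable_of_le (by norm_num)
  · rw [mul_div_assoc', le_div_iff₀ hp]
    have := mul_le_mul_of_nonneg_left h4 hx
    linarith
  · rw [div_le_iff₀ hp]
    have := mul_le_mul_of_nonneg_left h3.le hx
    linarith

/-- The imaginary part of the solution near the upper edge, inside the spectrum. -/
lemma im_mSol_inside (h : Regime r ε) {a c : ℝ} (E : EdgePair r ε a c) {z : ℂ} (hz : 0 ≤ z.im)
    (hz0 : z ≠ 0) (hn : ‖z‖ ≤ 8) {R : ℝ} (hR : 1 ≤ R) (hm : ‖mSol r ε z‖ ≤ R)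
    (h1 : edge r ε a - r ≤ z.re) (h2 : z.re ≤ edge r ε a) :
    Comparable (800 * R ^ 2 / r ^ 2 * (126000 / r ^ 4)) (mSol r ε z).im
      (√‖z - edge r ε a‖) := by
  have := h.r_pos
  exact (im_mSol_comparable h.toAdmissible hz hz0 hn hR hm).trans
    (im_uInv_inside h E hz hn h1 h2) (by positivity)

/-- The imaginary part of the solution to the right of the upper edge. -/
lemma im_mSol_outside (h : Regime r ε) {a c : ℝ} (E : EdgePair r ε a c) {z : ℂ} (hz : 0 ≤ z.im)
    (hz0 : z ≠ 0) (hn : ‖z‖ ≤ 8) {R : ℝ} (hR : 1 ≤ R) (hm : ‖mSol r ε z‖ ≤ R)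
    (h1 : edge r ε a < z.re) :
    Comparable (800 * R ^ 2 / r ^ 2 * (16000 / r ^ 3)) (mSol r ε z).im
      (z.im / √‖z - edge r ε a‖) := by
  have := h.r_pos
  exact (im_mSol_comparable h.toAdmissible hz hz0 hn hR hm).trans
    (im_uInv_outside h E hz hn h1) (by positivity)

/-- Square-root decay of the density at the upper edge. -/
lemma specDensity_comparable (h : Regime r ε) {a c : ℝ} (E : EdgePair r ε a c) {x R : ℝ}
    (hR : 3 ≤ R) (hx : x ∈ Icc (edge r ε a - r) (edge r ε a)) :
    Comparable (4 * (800 * R ^ 2 / r ^ 2 * (126000 / r ^ 4))) (specDensity r ε x)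
      (√(edge r ε a - x)) := by
  have hA := h.toAdmissible
  have h0 := hA.r_pos
  have hr1 := hA.r_le
  have hr2 : r ^ 2 ≤ 1 := pow_le_one₀ h0.le hr1
  obtain ⟨b1, b2⟩ := E.upper_bounds hA
  obtain ⟨x1, x2⟩ := hx
  have hx1 : 1 ≤ x := by linarith [sq_nonneg r]
  have hx0 : (x : ℂ) ≠ 0 := by exact_mod_cast (by linarith : x ≠ 0)
  have hxn : ‖(x : ℂ)‖ = x := by
    rw [Complex.norm_real, Real.norm_eq_abs, abs_of_nonneg (by linarith)]
  have hm : ‖mSol r ε x‖ ≤ R := by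
    have h1 := norm_mul_mSol_le hA (z := x) (by simp) hx0
    rw [hxn] at h1
    have := mul_le_mul_of_nonneg_right hx1 (norm_nonneg (mSol r ε x))
    linarith
  have hc := im_mSol_inside h E (z := x) (by simp) hx0 (by rw [hxn]; linarith)
    (R := R) (by linarith) hm (by simpa using x1) (by simpa using x2)
  have e1 : ‖(x : ℂ) - edge r ε a‖ = edge r ε a - x := by
    rw [← ofReal_sub, Complex.norm_real, Real.norm_eq_abs, abs_of_nonpos (by linarith)]
    ring
  rw [e1] at hc
  rw [specDensity_eq hA (by linarith)]
  refine (comparable_div_pi ?_).trans hc (by norm_num)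
  exact (mul_nonneg (by positivity) (Real.sqrt_nonneg _)).trans hc.1

/-! ### Distances to the edges -/

lemma norm_sub_ofReal_le (z : ℂ) (x : ℝ) (hz : 0 ≤ z.im) : ‖z - x‖ ≤ |z.re - x| + z.im := by
  have := norm_le_abs_re_add_abs_im (z - x)
  simpa [abs_of_nonneg hz] using this

lemma abs_re_sub_le (z : ℂ) (x : ℝ) : |z.re - x| ≤ ‖z - x‖ := by
  simpa using abs_re_le_norm (z - x)

lemma im_le_norm_sub (z : ℂ) (x : ℝ) : z.im ≤ ‖z - x‖ := by
  simpa using im_le_norm (z - x)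

lemma edgeDist_eq {Lm L E : ℝ} (h : Lm + L ≤ 2 * E) (h' : Lm ≤ L) : edgeDist Lm L E = |E - L| := by
  refine min_eq_right (abs_le.2 ⟨?_, ?_⟩)
  · have := le_abs_self (E - Lm)
    linarith
  · have := le_abs_self (E - Lm)
    linarith

lemma comparable_sqrt_edgeDist {Lm L : ℝ} {z : ℂ} (hz : 0 ≤ z.im) (h : Lm + L ≤ 2 * z.re)
    (h' : Lm ≤ L) : Comparable 2 (√‖z - L‖) (√(edgeDist Lm L z.re + z.im)) := by
  rw [edgeDist_eq h h']
  refine comparable_sqrt_two (norm_nonneg _) (norm_sub_ofReal_le z L hz) ?_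
  linarith [abs_re_sub_le z L, im_le_norm_sub z L]

/-- The product of the distances to the two edges is comparable to the distance to the nearer
one. -/
lemma norm_mul_norm_bounds {Lm L : ℝ} {z : ℂ} (hz : 0 ≤ z.im) {g B : ℝ} (hg : 2 * g ≤ L - Lm)
    (hg0 : 0 ≤ g) (h1 : ‖z - L‖ ≤ B) (h2 : ‖z - Lm‖ ≤ B) :
    g / 2 * (edgeDist Lm L z.re + z.im) ≤ ‖z - L‖ * ‖z - Lm‖ ∧
      ‖z - L‖ * ‖z - Lm‖ ≤ B * (edgeDist Lm L z.re + z.im) := by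
  have a1 := abs_re_sub_le z L
  have a2 := abs_re_sub_le z Lm
  have i1 := im_le_norm_sub z L
  have i2 := im_le_norm_sub z Lm
  have n1 := norm_sub_ofReal_le z L hz
  have n2 := norm_sub_ofReal_le z Lm hz
  have m1 := min_le_left |z.re - Lm| |z.re - L|
  have m2 := min_le_right |z.re - Lm| |z.re - L|
  have hsum : L - Lm ≤ ‖z - L‖ + ‖z - Lm‖ := by
    linarith [neg_abs_le (z.re - L), le_abs_self (z.re - Lm)]
  have hD0 : 0 ≤ edgeDist Lm L z.re + z.im :=
    add_nonneg (le_min (abs_nonneg _) (abs_nonneg _)) hz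
  have p0 := norm_nonneg (z - (L : ℂ))
  have p1 := norm_nonneg (z - (Lm : ℂ))
  constructor
  · have hD1 : edgeDist Lm L z.re + z.im ≤ 2 * ‖z - L‖ := by unfold edgeDist; linarith
    have hD2 : edgeDist Lm L z.re + z.im ≤ 2 * ‖z - Lm‖ := by unfold edgeDist; linarith
    rcases le_total ‖z - (L : ℂ)‖ ‖z - (Lm : ℂ)‖ with hle | hle
    · have t1 := mul_le_mul_of_nonneg_left hD1 hg0
      have t2 := mul_le_mul_of_nonneg_right (by linarith : g ≤ ‖z - (Lm : ℂ)‖) p0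
      linarith
    · have t1 := mul_le_mul_of_nonneg_left hD2 hg0
      have t2 := mul_le_mul_of_nonneg_right (by linarith : g ≤ ‖z - (L : ℂ)‖) p1
      linarith
  · unfold edgeDist at hD0 ⊢
    rcases min_choice |z.re - Lm| |z.re - L| with hmin | hmin <;> rw [hmin] at hD0 ⊢
    · exact mul_le_mul h1 n2 p1 (p0.trans h1)
    · have := mul_le_mul h2 n1 p0 (p0.trans h1)
      linarith

/-- Size of the derivative of the quartic at the solution. -/
lemma norm_deriv_quarticP_comparable (h : Admissible r ε) {a c : ℝ} (E : EdgePair r ε a c) {z : ℂ}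
    (hz : 0 ≤ z.im) (hz0 : z ≠ 0) (hn : ‖z‖ ≤ 8) :
    Comparable (26 / r) ‖deriv (quarticP r ε z) (mSol r ε z)‖
      (√(edgeDist (edge r ε c) (edge r ε a) z.re + z.im)) := by
  have h0 := h.r_pos
  have hr1 := h.r_le
  have hr2 : r ^ 2 ≤ 1 := pow_le_one₀ h0.le hr1
  have hv := vInv_ne_zero h hz
  obtain ⟨b1, b2⟩ := E.upper_bounds h
  have b3 := E.lower_bounds h
  have b4 := E.lower_nonneg h
  have hac : a ≠ c := by
    have h1 := (abs_le.1 E.upper_near).1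
    have h2 := (abs_le.1 E.lower_near).2
    have := h.eps
    intro h'
    linarith
  obtain ⟨k1, k2⟩ := joukCrit_sq_comparable E.upper E.lower hac h.smallCoeffs h.two_eps
    (v := vInv r ε z) ((norm_vInv_le h hz).trans (by norm_num)) hv
  have hnorm : ∀ x : ℝ, 0 ≤ x → x ≤ 5 → ‖z - x‖ ≤ 13 := by
    intro x hx0 hx
    have := norm_sub_le z (x : ℂ)
    rw [Complex.norm_real, Real.norm_eq_abs, abs_of_nonneg hx0] at this
    linarith
  obtain ⟨p1, p2⟩ := norm_mul_norm_bounds (Lm := edge r ε c) (L := edge r ε a) hz (g := r) (B := 13)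
    (by linarith) h0.le (hnorm _ (by linarith [sq_nonneg r]) (by linarith))
    (hnorm _ b4 (by linarith [sq_nonneg r]))
  rw [norm_sub_edge h hz, norm_sub_edge h hz] at p1 p2
  have hsq : ‖deriv (quarticP r ε z) (mSol r ε z)‖ ^ 2 = r ^ 2 *
      (‖joukCrit (ε * (1 + r ^ 2)) (2 * ε * r) (ε ^ 2 * r ^ 2) (vInv r ε z)‖
        / ‖vInv r ε z‖) ^ 2 := by
    rw [deriv_quarticP_mSol h hz hz0, norm_neg, norm_mul, norm_div, Complex.norm_real,
      Real.norm_eq_abs, abs_of_pos h0, mul_pow]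
  have hr2' : 0 ≤ r ^ 2 := sq_nonneg r
  have t1 := mul_le_mul_of_nonneg_left k1 hr2'
  have t2 := mul_le_mul_of_nonneg_left k2 hr2'
  rw [← hsq] at t1 t2
  have hD0 : 0 ≤ edgeDist (edge r ε c) (edge r ε a) z.re + z.im :=
    add_nonneg (le_min (abs_nonneg _) (abs_nonneg _)) hz
  have hK : 26 ≤ 26 / r := by rw [le_div_iff₀ h0]; linarith
  apply comparable_sqrt (by linarith) (norm_nonneg _) hD0
  · rw [div_mul_eq_mul_div, le_div_iff₀ h0]
    have := sq_nonneg ‖deriv (quarticP r ε z) (mSol r ε z)‖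
    linarith
  · have := mul_le_mul_of_nonneg_right hK hD0
    linarith

/-! ### The spectral domain -/

lemma lamMinus_pos {d : ℝ} (h1 : 1 < d) : 0 < lamMinus d := by
  have h2 : 1 / √d < 1 := by
    rw [div_lt_one (Real.sqrt_pos.2 (by linarith))]
    exact Real.lt_sqrt_of_sq_lt (by linarith)
  unfold lamMinus
  have : 0 < 1 - 1 / √d := by linarith
  positivity

lemma domainE_re_pos {d : ℝ} {z : ℂ} (hz : z ∈ domainE d) : 0 < z.re := by
  refine lt_of_lt_of_le ?_ hz.1
  split_ifs with h1
  · exact half_pos (lamMinus_pos h1)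
  · norm_num

section
variable {d : ℝ} (hd : 1 ≤ d)
include hd

lemma inv_sqrt_pos : 0 < 1 / √d := by
  have : 0 < √d := Real.sqrt_pos.2 (by linarith)
  positivity

lemma inv_sqrt_le_one : 1 / √d ≤ 1 := by
  rw [div_le_one (Real.sqrt_pos.2 (by linarith))]
  exact Real.one_le_sqrt.2 hd

lemma inv_sqrt_sq : (1 / √d) ^ 2 = 1 / d := by
  rw [div_pow, one_pow, Real.sq_sqrt (by linarith)]

lemma quartic_eq (s q t : ℝ) : quartic d s q t = quarticP (1 / √d) (corr s q t) := by
  have h : (((1 / √d : ℝ) : ℂ)) ^ 2 = 1 / (d : ℂ) := by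
    rw [← ofReal_pow, inv_sqrt_sq hd]; push_cast; rfl
  funext z w
  rw [quartic, quarticP, h]

lemma domainE_norm_le {z : ℂ} (hz : z ∈ domainE d) : ‖z‖ ≤ 8 := by
  have h1 := norm_le_abs_re_add_abs_im z
  have h2 := domainE_re_pos hz
  obtain ⟨-, h3, h4, h5⟩ := hz
  rw [abs_of_pos h2, abs_of_pos h4] at h1
  have h6 : lamPlus d ≤ (1 + 1) ^ 2 := by
    unfold lamPlus
    have := (inv_sqrt_pos hd).le
    have := inv_sqrt_le_one hd
    gcongr
  linarith

lemma norm_mSol_le_solBound {ε : ℝ} (h : Admissible (1 / √d) ε) {z : ℂ} (hz : z ∈ domainE d) :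
    ‖mSol (1 / √d) ε z‖ ≤ solBound d := by
  have hre := domainE_re_pos hz
  have hz0 : z ≠ 0 := by rintro rfl; simp at hre
  have hzi : 0 ≤ z.im := hz.2.2.1.le
  have hn : z.re ≤ ‖z‖ := re_le_norm z
  have hlow := hz.1
  unfold solBound
  split_ifs at hlow ⊢ with h1
  · have hl := lamMinus_pos h1
    have h2 := norm_mul_mSol_le h hzi hz0
    have h3 : 1 ≤ lamPlus d := by
      unfold lamPlus
      exact one_le_pow₀ (by linarith [inv_sqrt_pos hd])
    have h4 := mul_le_mul_of_nonneg_right (hlow.trans hn) (norm_nonneg (mSol (1 / √d) ε z))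
    rw [le_div_iff₀ hl]
    linarith
  · have hd1 : d = 1 := le_antisymm (not_lt.1 h1) hd
    have h2 := mSol_mul h hzi hz0
    have h3 := norm_uInv_le_one h hzi
    rw [← h2, hd1] at h3
    norm_num at h3
    rw [hd1]
    norm_num
    have h4 := mul_le_mul_of_nonneg_right (hlow.trans hn) (sq_nonneg ‖mSol 1 ε z‖)
    by_contra hlt
    push Not at hlt
    have h5 : (10 : ℝ) ^ 2 ≤ ‖mSol 1 ε z‖ ^ 2 := by gcongr
    linarith

end

lemma one_le_solBound {d : ℝ} (hd : 1 ≤ d) : 1 ≤ solBound d := by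
  unfold solBound
  split_ifs with h1
  · have hl := lamMinus_pos h1
    rw [le_div_iff₀ hl]
    have h2 : lamMinus d ≤ lamPlus d := by
      unfold lamMinus lamPlus
      linarith [inv_sqrt_pos hd]
    linarith
  · norm_num

/-! ### The deterministic statement -/

/-- All smallness conditions hold once the sparsity correction is below a threshold depending only
on `r` and `R`. -/
lemma exists_regime {r R : ℝ} (h0 : 0 < r) (hr : r ≤ 1) (hR : 1 ≤ R) :
    ∃ e₀ : ℝ, 0 < e₀ ∧ ∀ ε : ℝ, |ε| ≤ e₀ →
      Regime r ε ∧ 200 * |ε| * (R * (8 * R + 1)) ^ 2 ≤ r ^ 2 := by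
  have hg : 0 < (if r = 1 then 1 else (1 - r) / 44) := by
    split_ifs with h1
    · norm_num
    · have : r < 1 := lt_of_le_of_ne hr h1
      linarith
  have hR2 : 0 < 200 * (R * (8 * R + 1)) ^ 2 := by positivity
  refine ⟨min (min (1 / 2000) (if r = 1 then 1 else (1 - r) / 44))
    (min (r ^ 4 / (2 * 10 ^ 8)) (r ^ 2 / (200 * (R * (8 * R + 1)) ^ 2))),
    lt_min (lt_min (by norm_num) hg) (lt_min (by positivity) (by positivity)), fun ε hε => ?_⟩
  simp only [le_min_iff] at hε
  obtain ⟨⟨h1, h2⟩, h3, h4⟩ := hε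
  refine ⟨⟨⟨h0, hr, h1, ?_⟩, ?_⟩, ?_⟩
  · by_cases h' : r = 1
    · exact Or.inl h'
    · rw [if_neg h'] at h2
      exact Or.inr (by linarith)
  · linarith
  · rw [le_div_iff₀ hR2] at h4
    linarith

/-- The statement for a deterministic, sufficiently small coefficient `ε` of the correction. -/
lemma exists_solution {d : ℝ} (hd : 1 ≤ d) :
    ∃ e₀ : ℝ, 0 < e₀ ∧ ∃ K : ℝ, 1 ≤ K ∧ ∀ s q t : ℝ, |corr s q t| ≤ e₀ →
      ∃ w : ℂ → ℂ,
        (∀ z ∈ domainE d, IsSolution d s q t z (w z) ∧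
          ∀ w' : ℂ, IsSolution d s q t z w' → w' = w z) ∧
        ∃ (ρ : Measure ℝ) (Lm L : ℝ), IsProbabilityMeasure ρ ∧
          (∃ m : ℂ → ℂ, DifferentiableOn ℂ m {z : ℂ | 0 < z.im} ∧
            (∀ z ∈ domainE d, m z = w z) ∧ ∀ z : ℂ, 0 < z.im → m z = stieltjes ρ z) ∧
          0 ≤ Lm ∧ Lm ≤ L ∧ ρ ({0} ∪ Icc Lm L)ᶜ = 0 ∧
          (0 ≤ corr s q t → lamPlus d ≤ L) ∧
          (∃ f : ℝ → ℝ, Measurable f ∧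
            ρ.restrict (Icc (L - 1 / √d) L) =
              (volume.restrict (Icc (L - 1 / √d) L)).withDensity
                (fun x => ENNReal.ofReal (f x)) ∧
            ∀ E ∈ Icc (L - 1 / √d) L, Comparable K (f E) (√(L - E))) ∧
          |L - (lamPlus d + 1 / √d * (1 + 1 / √d) ^ 2 * corr s q t)| ≤ 105 * corr s q t ^ 2 ∧
          ∀ z ∈ domainE d,
            Comparable K ‖deriv (quartic d s q t z) (w z)‖ (√(edgeDist Lm L z.re + z.im)) ∧
            (L < z.re → Comparable K (w z).im (z.im / √(edgeDist Lm L z.re + z.im))) ∧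
            (L - 1 / √d ≤ z.re → z.re ≤ L →
              Comparable K (w z).im (√(edgeDist Lm L z.re + z.im))) ∧
            (z.re < L - 1 / √d → (w z).im ≤ K) := by
  have h0 := inv_sqrt_pos hd
  have hr1 := inv_sqrt_le_one hd
  have hS := one_le_solBound hd
  have hnorm := fun (ε : ℝ) (h : Admissible (1 / √d) ε) (z : ℂ) (hz : z ∈ domainE d) =>
    norm_mSol_le_solBound hd h hz
  -- `R ≥ 3` also bounds the solution on the real axis near the upper edge, where `z ≥ 1`
  obtain ⟨R, hRdef⟩ : ∃ R, R = solBound d + 2 := ⟨_, rfl⟩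
  have hR3 : 3 ≤ R := by linarith
  obtain ⟨e₀, he₀, hreg⟩ := exists_regime (R := R) h0 hr1 (by linarith)
  have hq := quartic_eq hd
  have hlam : lamPlus d = (1 + 1 / √d) ^ 2 := rfl
  unfold IsSolution
  simp only [hq, hlam]
  generalize 1 / √d = r at *
  have hA : 0 < 800 * R ^ 2 / r ^ 2 * (126000 / r ^ 4) := by positivity
  have hB : 0 < 800 * R ^ 2 / r ^ 2 * (16000 / r ^ 3) := by positivity
  have hC : 0 < 26 / r := by positivity
  refine ⟨e₀, he₀, 4 * (800 * R ^ 2 / r ^ 2 * (126000 / r ^ 4))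
    + 2 * (800 * R ^ 2 / r ^ 2 * (16000 / r ^ 3)) + 26 / r + R, by linarith, ?_⟩
  intro s q t hε
  obtain ⟨hreg, hun⟩ := hreg _ hε
  generalize corr s q t = ε at *
  have h := hreg.toAdmissible
  obtain ⟨a, c, E⟩ := exists_edgePair h
  obtain ⟨b1, b2⟩ := E.upper_bounds h
  have b3 := E.lower_bounds h
  have b4 := E.lower_nonneg h
  have hle : edge r ε c ≤ edge r ε a := by linarith
  have hi := E.integrable_specDensity h
  have hz0 : ∀ z ∈ domainE d, z ≠ 0 := by
    rintro z hz rfl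
    simpa using domainE_re_pos hz
  refine ⟨mSol r ε, fun z hz => ⟨⟨quarticP_mSol h hz.2.2.1.le (hz0 z hz),
    mSol_im_pos h hz.2.2.1, hnorm ε h z hz⟩, fun w' hw' => ?_⟩,
    specMeasure r ε, edge r ε c, edge r ε a, isProbabilityMeasure_specMeasure h hi,
    ⟨mSol r ε, differentiableOn_mSol h, fun _ _ => rfl,
      fun z hz => (stieltjes_specMeasure h hi hz).symm⟩,
    b4, hle, E.specMeasure_compl h, E.upper_ge_of_nonneg h,
    ⟨specDensity r ε, measurable_specDensity h, restrict_specMeasure measurableSet_Icc ?_, ?_⟩,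
    E.upper_expansion h, fun z hz => ?_⟩
  · exact quarticP_unique h hz.2.2.1 (domainE_norm_le hd hz) (by linarith) hun hw'.1 hw'.2.1
      (hw'.2.2.trans (by linarith))
  · intro h'
    linarith [h'.1, sq_nonneg r]
  · intro x hx
    exact (specDensity_comparable hreg E hR3 hx).mono (by positivity) (by linarith)
      (Real.sqrt_nonneg _)
  · have hzi := hz.2.2.1
    have hn8 := domainE_norm_le hd hz
    have hm : ‖mSol r ε z‖ ≤ R := (hnorm ε h z hz).trans (by linarith)
    refine ⟨?_, fun hE => ?_, fun hE1 hE2 => ?_, fun _ => ?_⟩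
    · exact (norm_deriv_quarticP_comparable h E hzi.le (hz0 z hz) hn8).mono hC (by linarith)
        (Real.sqrt_nonneg _)
    · have hcmp := comparable_sqrt_edgeDist (Lm := edge r ε c) (L := edge r ε a) hzi.le
        (by linarith) hle
      have hp : 0 < √‖z - (edge r ε a : ℂ)‖ :=
        Real.sqrt_pos.2 (hzi.trans_le (im_le_norm_sub z _))
      have hp' : 0 < √(edgeDist (edge r ε c) (edge r ε a) z.re + z.im) :=
        Real.sqrt_pos.2 (add_pos_of_nonneg_of_pos (le_min (abs_nonneg _) (abs_nonneg _)) hzi)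
      exact ((im_mSol_outside hreg E hzi.le (hz0 z hz) hn8 (by linarith) hm hE).trans
        (hcmp.div_left (by norm_num) hp hp' hzi.le) hB).mono (by positivity) (by linarith)
        (by positivity)
    · have hcmp := comparable_sqrt_edgeDist (Lm := edge r ε c) (L := edge r ε a) hzi.le
        (by linarith) hle
      exact ((im_mSol_inside hreg E hzi.le (hz0 z hz) hn8 (by linarith) hm hE1 hE2).trans
        hcmp hA).mono (by positivity) (by linarith) (Real.sqrt_nonneg _)
    · exact ((le_abs_self _).trans (abs_im_le_norm _)).trans (hm.trans (by linarith))

/-! ### The sparsity correction -/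

lemma corr_mul (s q t : ℝ) : corr s q t = Real.exp (-t) * (qt q t ^ 2)⁻¹ * s := by
  unfold corr; ring

lemma corr_sq (s q t : ℝ) :
    corr s q t ^ 2 = s ^ 2 * (Real.exp (-2 * t) * (qt q t ^ 4)⁻¹) := by
  have h : Real.exp (-2 * t) = Real.exp (-t) ^ 2 := by
    rw [← Real.exp_nat_mul]; congr 1; push_cast; ring
  rw [corr_mul, h]
  ring

lemma abs_corr_le {s q t S : ℝ} (hq : 0 < q) (ht : 0 ≤ t) (hs : |s| ≤ S) :
    |corr s q t| ≤ S * (q ^ 2)⁻¹ := by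
  have h1 : Real.exp (-t) ≤ 1 := Real.exp_le_one_iff.2 (by linarith)
  have h2 : 1 ≤ Real.exp (t / 2) := Real.one_le_exp (by linarith)
  have h3 : q ^ 2 ≤ qt q t ^ 2 := by
    unfold qt
    rw [mul_pow]
    exact le_mul_of_one_le_right (sq_nonneg q) (one_le_pow₀ h2)
  have h4 : 0 ≤ Real.exp (-t) * (qt q t ^ 2)⁻¹ := by positivity
  have h5 : Real.exp (-t) * (qt q t ^ 2)⁻¹ ≤ 1 * (q ^ 2)⁻¹ := by gcongr
  rw [corr_mul, abs_mul, abs_of_nonneg h4, mul_comm]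
  rw [one_mul] at h5
  exact mul_le_mul hs h5 h4 ((abs_nonneg s).trans hs)

/-- The normalized fourth cumulant of a sparse matrix is bounded, uniformly in the dimension: for a
centered entry it is `N q² 𝔼X⁴ - 3 q²/N`, and `q² ≤ N`. -/
lemma abs_normFourthCumulant_le {Ω : Type*} [MeasurableSpace Ω] {P : Measure Ω} {M N : ℕ}
    {φ C c q : ℝ} {X : Fin M → Fin N → Ω → ℝ} (h : IsSparseMatrix P M N φ C c q X)
    (hN : 0 < N) (hC : 0 < C) (α : Fin M) (i : Fin N) :
    |normFourthCumulant P N q (X α i)| ≤ (C * 4) ^ (c * 4) + 3 := by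
  have hNr : (0 : ℝ) < N := by exact_mod_cast hN
  have hq : 0 < q := (Real.rpow_pos_of_pos hNr φ).trans_le h.sparsity_lower
  have hqN : q ^ 2 ≤ N := by
    have h1 := pow_le_pow_left₀ hq.le h.sparsity_upper 2
    rwa [← Real.rpow_natCast, ← Real.rpow_natCast, ← Real.rpow_mul hNr.le,
      show (1 / 2 : ℝ) * ((2 : ℕ) : ℝ) = 1 by norm_num, Real.rpow_one, Real.rpow_natCast] at h1
  have hmom := h.moments α i 4 (by norm_num)
  have habs : ∀ ω, |X α i ω| ^ 4 = X α i ω ^ 4 := fun ω => Even.pow_abs (by decide) _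
  simp only [habs] at hmom
  have hpos : 0 ≤ ∫ ω, X α i ω ^ 4 ∂P :=
    integral_nonneg fun ω => Even.pow_nonneg (by decide) _
  norm_num at hmom
  rw [le_div_iff₀ (by positivity)] at hmom
  have e1 : normFourthCumulant P N q (X α i) =
      (∫ ω, X α i ω ^ 4 ∂P) * (N * q ^ 2) - 3 * (q ^ 2 / N) := by
    rw [normFourthCumulant, fourthCumulant, h.mean, h.variance]
    field_simp
    ring
  have h1 : 0 ≤ q ^ 2 / N := by positivity
  have h2 : q ^ 2 / N ≤ 1 := (div_le_one hNr).2 hqN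
  have h3 : 0 ≤ (∫ ω, X α i ω ^ 4 ∂P) * (N * q ^ 2) := by positivity
  have h4 : 0 ≤ (C * 4) ^ (c * 4) := by positivity
  rw [e1, abs_le]
  constructor <;> linarith

lemma exists_nat_rpow_small {φ S e : ℝ} (hφ : 0 < φ) (he : 0 < e) :
    ∃ N₀ : ℕ, 0 < N₀ ∧ ∀ N : ℕ, N₀ ≤ N → ∀ q : ℝ, (N : ℝ) ^ φ ≤ q → S * (q ^ 2)⁻¹ ≤ e := by
  have h1 : Tendsto (fun N : ℕ => (N : ℝ) ^ φ) atTop atTop :=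
    (tendsto_rpow_atTop hφ).comp tendsto_natCast_atTop_atTop
  obtain ⟨N₀, hN₀⟩ := eventually_atTop.1 (h1.eventually_ge_atTop (max 1 (S / e)))
  refine ⟨max N₀ 1, by simp, fun N hN q hq => ?_⟩
  have h2 := (hN₀ N ((le_max_left _ _).trans hN)).trans hq
  have h3 : 1 ≤ q := (le_max_left _ _).trans h2
  have h4 : S / e ≤ q := (le_max_right _ _).trans h2
  rw [div_le_iff₀ he] at h4
  rw [← div_eq_mul_inv, div_le_iff₀ (by positivity)]
  have h5 : q ≤ q ^ 2 := le_self_pow₀ h3 two_ne_zero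
  have := mul_le_mul_of_nonneg_right h5 he.le
  linarith

end SparseCov

theorem lemma3p1 (d φ C c : ℝ) (hd : 1 ≤ d) (hφ : 0 < φ) (hC : 0 < C) (hc : 0 < c) :
    ∃ N₀ : ℕ, ∃ K : ℝ, 1 ≤ K ∧
      ∀ (M N : ℕ), N₀ ≤ N → (N : ℝ) / M = d →
      ∀ (Ω : Type*) [MeasurableSpace Ω] (P : Measure Ω) [IsProbabilityMeasure P]
        (q : ℝ) (X : Fin M → Fin N → Ω → ℝ),
      SparseCov.IsSparseMatrix P M N φ C c q X →
      ∀ (α : Fin M) (i : Fin N) (s : ℝ), s = SparseCov.normFourthCumulant P N q (X α i) →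
      ∀ t : ℝ, 0 ≤ t →
      -- existence and uniqueness of the solution on the spectral domain
      ∃ w : ℂ → ℂ,
        (∀ z ∈ SparseCov.domainE d,
          SparseCov.IsSolution d s q t z (w z) ∧
          ∀ w' : ℂ, SparseCov.IsSolution d s q t z w' → w' = w z) ∧
        ∃ (ρ : Measure ℝ) (Lm L : ℝ), IsProbabilityMeasure ρ ∧
          -- (1) the analytic continuation of the solution is the Stieltjes transform of `ρ`
          (∃ m : ℂ → ℂ, DifferentiableOn ℂ m {z : ℂ | 0 < z.im} ∧
            (∀ z ∈ SparseCov.domainE d, m z = w z) ∧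
            ∀ z : ℂ, 0 < z.im → m z = SparseCov.stieltjes ρ z) ∧
          -- (2) support, square-root decay at the upper edge, expansion of the upper edge
          0 ≤ Lm ∧ Lm ≤ L ∧
          ρ ({0} ∪ Set.Icc Lm L)ᶜ = 0 ∧
          (0 ≤ s → SparseCov.lamPlus d ≤ L) ∧
          (∃ f : ℝ → ℝ, Measurable f ∧
            ρ.restrict (Set.Icc (L - 1 / Real.sqrt d) L) =
              (volume.restrict (Set.Icc (L - 1 / Real.sqrt d) L)).withDensity
                (fun x => ENNReal.ofReal (f x)) ∧
            ∀ E ∈ Set.Icc (L - 1 / Real.sqrt d) L,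
              SparseCov.Comparable K (f E) (Real.sqrt (L - E))) ∧
          |L - (SparseCov.lamPlus d + 1 / Real.sqrt d * (1 + 1 / Real.sqrt d) ^ 2 *
              Real.exp (-t) * (SparseCov.qt q t ^ 2)⁻¹ * s)|
            ≤ K * (Real.exp (-2 * t) * (SparseCov.qt q t ^ 4)⁻¹) ∧
          -- (3) size of the derivative and of the imaginary part
          ∀ z ∈ SparseCov.domainE d,
            SparseCov.Comparable K ‖deriv (SparseCov.quartic d s q t z) (w z)‖
              (Real.sqrt (SparseCov.edgeDist Lm L z.re + z.im)) ∧
            (L < z.re →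
              SparseCov.Comparable K (w z).im
                (z.im / Real.sqrt (SparseCov.edgeDist Lm L z.re + z.im))) ∧
            (L - 1 / Real.sqrt d ≤ z.re → z.re ≤ L →
              SparseCov.Comparable K (w z).im
                (Real.sqrt (SparseCov.edgeDist Lm L z.re + z.im))) ∧
            (z.re < L - 1 / Real.sqrt d → (w z).im ≤ K) := by
  open SparseCov in
  obtain ⟨e₀, he₀, K, hK, hsol⟩ := exists_solution hd
  obtain ⟨N₀, hN₀, hsmall⟩ := exists_nat_rpow_small (S := (C * 4) ^ (c * 4) + 3) hφ he₀
  have hS : 0 ≤ (C * 4) ^ (c * 4) + 3 := by positivity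
  refine ⟨N₀, K + 105 * ((C * 4) ^ (c * 4) + 3) ^ 2,
    by linarith [sq_nonneg ((C * 4) ^ (c * 4) + 3)], ?_⟩
  intro M N hN _ Ω _ P _ q X hX α i s hs t ht
  have hNpos : 0 < N := hN₀.trans_le hN
  have hq : 0 < q := (Real.rpow_pos_of_pos (by exact_mod_cast hNpos) φ).trans_le hX.sparsity_lower
  have hsb : |s| ≤ (C * 4) ^ (c * 4) + 3 := hs ▸ abs_normFourthCumulant_le hX hNpos hC α i
  obtain ⟨w, hw, ρ, Lm, L, hρ, hm, hLm, hLL, hsupp, hL, ⟨f, hf, hfd, hfc⟩, hexp, hz⟩ :=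
    hsol s q t ((abs_corr_le hq ht hsb).trans (hsmall N hN q hX.sparsity_lower))
  generalize (C * 4) ^ (c * 4) + 3 = S at *
  have hK0 : 0 < K := by linarith
  have hKK : K ≤ K + 105 * S ^ 2 := by linarith [sq_nonneg S]
  have hqt : 0 ≤ Real.exp (-t) * (qt q t ^ 2)⁻¹ := by positivity
  refine ⟨w, hw, ρ, Lm, L, hρ, hm, hLm, hLL, hsupp, fun hs0 => hL ?_,
    ⟨f, hf, hfd, fun E hE => (hfc E hE).mono hK0 hKK (Real.sqrt_nonneg _)⟩, ?_, fun z hzE => ?_⟩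
  · rw [corr_mul]
    exact mul_nonneg hqt hs0
  · have e1 : 1 / √d * (1 + 1 / √d) ^ 2 * Real.exp (-t) * (qt q t ^ 2)⁻¹ * s =
        1 / √d * (1 + 1 / √d) ^ 2 * corr s q t := by rw [corr_mul]; ring
    rw [e1]
    refine hexp.trans ?_
    rw [corr_sq, ← mul_assoc]
    refine mul_le_mul_of_nonneg_right ?_ (by positivity)
    have : s ^ 2 ≤ S ^ 2 := sq_le_sq.2 (hsb.trans (le_abs_self S))
    linarith
  · obtain ⟨h1, h2, h3, h4⟩ := hz z hzE
    have hD : 0 ≤ z.im / √(edgeDist Lm L z.re + z.im) :=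
      div_nonneg hzE.2.2.1.le (Real.sqrt_nonneg _)
    exact ⟨h1.mono hK0 hKK (Real.sqrt_nonneg _), fun h => (h2 h).mono hK0 hKK hD,
      fun h h' => (h3 h h').mono hK0 hKK (Real.sqrt_nonneg _), fun h => (h4 h).trans hKK⟩
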